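/- All functions and vector fields are smooth ($C^\infty$). Let $I\subseteq\mathbb R$ be a non-empty open interval and let $A_1,A_2,A_3:I\to\mathbb R\setminus\{0\}$. The Bianchi I metric on $I\times\mathbb R^3$ is $$ds^2=-dt^2+A_1(t)^2dx^2+A_2(t)^2dy^2+A_3(t)^2dz^2 .$$ It is called proper if no two of $A_1,A_2,A_3$ are proportional on $I$ (this excludes the plane symmetric and the Friedmann–Robertson–Walker metrics). A metric is conformally flat if near every point it is, in suitable coordinates, a positive function times the Minkowski metric. A conformal Killing vector (CKV) with conformal factor $\psi$ is a vector field $\xi$ with $\mathcal L_\xi g=2\psi g$; it is a Killing vector if $\psi=0$, and a homothetic vector field if $\psi$ is a non-zero constant. For $a\neq0$ let $$ds_{RT}^2=dz^2-d\tau^2+\cos^2(\tfrac\tau a)dy^2+\sin^2(\tfrac\tau a)dx^2,\qquad ds_{ART}^2=dz^2-d\tau^2+\cosh^2(\tfrac\tau a)dy^2+\sinh^2(\tfrac\tau a)dx^2$$ (the Rebouças–Tiomno and Rebouças–Teixeira metrics). **(1) Classification.** The metric $ds^2$ is proper and conformally flat if and only if there are $a>0$, non-zero constants $c_1,c_2$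 and a function $\tau(t)$ on $I$ with $d\tau=dt/A_3(t)$ such that, in the coordinates $(\tau,c_1x,c_2y,z)$ or $(\tau,c_1y,c_2x,z)$, it is equal to $A_3^2(\tau)\,ds_{RT}^2$ or to $A_3^2(\tau)\,ds_{ART}^2$ (with $A_3$ expressed as a function of $\tau$, and the functions of $\tau$ multiplying $dx^2$ and $dy^2$ nowhere zero). A proper conformally flat Bianchi I metric admits no homothetic vector field. **(2) Conformal Killing vectors.** Write $(c_+,c_-)(w,a)=(\cosh\frac wa,\cos\frac wa)$ and $(s_+,s_-)(w,a)=(\sinh\frac wa,\sin\frac wa)$; the upper signs refer to $RT$ and the lower signs to $ART$. Let $J$ be a non-empty open interval on which $s_\mp(\tau,a)$ and $c_\mp(\tau,a)$ have no zero, and let $A_3:J\to\mathbb R\setminus\{0\}$. On $J\times\mathbb R^3$ consider the following 15 vector fields, where $k=0,1,2,3$. * $\xi_1=\partial_x$, $\xi_2=\partial_y$, $\xi_3=\partial_z$. * $\xi_{k+4}=u_k\,\partial_\tau+\frac{s_\mp(\tau,a)}{c_\mp(\tau,a)}\,v_k\,\partial_y-\frac{c_\mp(\tau,a)}{s_\mp(\tau,a)}\,w_k\,\partial_x$,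 where, with $c_+,s_+$ evaluated at $(x,a)$ and $c_\pm,s_\pm$ at $(y,a)$, $$(u_k)=(s_\pm c_+,\;s_\pm s_+,\;c_\pm c_+,\;c_\pm s_+),\quad (v_k)=(c_\pm c_+,\;c_\pm s_+,\;\pm s_\pm c_+,\;\pm s_\pm s_+),\quad (w_k)=(s_\pm s_+,\;s_\pm c_+,\;c_\pm s_+,\;c_\pm c_+).$$ * $X_{(k)}$, with covariant components (the index being lowered with $ds_{RT}^2$, resp. $ds_{ART}^2$) $X_{(k)\alpha}=\pm a^2\partial_\alpha B_k$ for $\alpha=\tau,x,y$ and $X_{(k)z}=\mp a^2\partial_zB_k$, where $$(B_k)=c_\mp(\tau,a)\,\bigl(c_\pm(y,a)s_\mp(z,a),\;c_\pm(y,a)c_\mp(z,a),\;s_\pm(y,a)s_\mp(z,a),\;s_\pm(y,a)c_\mp(z,a)\bigr).$$ * $X_{(k+4)}$, defined in the same way from $$(\Gamma_k)=s_\mp(\tau,a)\,\bigl(c_+(x,a)s_\mp(z,a),\;c_+(x,a)c_\mp(z,a),\;s_+(x,a)s_\mp(z,a),\;s_+(x,a)c_\mp(z,a)\bigr).$$ For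 $ds_{RT}^2$ (resp. $ds_{ART}^2$) the first seven are Killing vectors, and $X_{(k)}$, $X_{(k+4)}$ are CKVs with conformal factors $\phi=B_k$, $\phi=\Gamma_k$. For $A_3^2(\tau)ds_{RT}^2$ (resp. $A_3^2(\tau)ds_{ART}^2$) all 15 are CKVs, with conformal factors $\psi(X)=X(\ln|A_3|)+\phi(X)$, where $\phi=0$ for the first seven. They are linearly independent over $\mathbb R$, and every CKV of $A_3^2(\tau)ds_{RT}^2$ (resp. $A_3^2(\tau)ds_{ART}^2$) on $J\times\mathbb R^3$ is a linear combination of them with constant coefficients. This metric admits no homothetic vector field. -/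

import Mathlib

open scoped ContDiff

noncomputable section

namespace BianchiI

/-- Coordinates `(t, x, y, z)` or `(τ, x, y, z)`, numbered `0, 1, 2, 3`. -/
abbrev Pt := Fin 4 → ℝ

/-- A field of symmetric matrices: the coordinate components `g_ab` of a metric. -/
abbrev MetricField := Pt → Matrix (Fin 4) (Fin 4) ℝ

/-- The region of all points whose time coordinate lies in `I`. -/
def slab (I : Set ℝ) : Set Pt := {p | p 0 ∈ I}

/-- The partial derivative with respect to the `i`-th coordinate. -/
def pd (i : Fin 4) (f : Pt → ℝ) (p : Pt) : ℝ := fderiv ℝ f p (Pi.single i 1)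

/-- The components of the pull-back `Φ^* g`. -/
def pullback (Φ : Pt → Pt) (g : MetricField) : MetricField := fun p =>
  Matrix.of fun a b => ∑ i, ∑ j,
    pd a (fun q => Φ q i) p * pd b (fun q => Φ q j) p * g (Φ p) i j

/-- The Minkowski metric `diag(-1, 1, 1, 1)`. -/
def minkowski : MetricField := fun _ => Matrix.diagonal ![-1, 1, 1, 1]

/-- `g` is conformally flat on the open set `U`: every point of `U` has a neighbourhood with smooth
coordinates `φ` in which `g` is a smooth positive function times the Minkowski metric.
(If `g` is non-degenerate, the equation makes the Jacobian of `φ` invertible, so that `φ` is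
indeed a coordinate system near the point.) -/
def IsConformallyFlatOn (g : MetricField) (U : Set Pt) : Prop :=
  ∀ p ∈ U, ∃ V : Set Pt, IsOpen V ∧ p ∈ V ∧ V ⊆ U ∧
    ∃ (φ : Pt → Pt) (Ω : Pt → ℝ), ContDiffOn ℝ ∞ φ V ∧ ContDiffOn ℝ ∞ Ω V ∧
      ∀ q ∈ V, 0 < Ω q ∧ g q = (Ω q) ^ 2 • pullback φ minkowski q

/-- The components of the Lie derivative `L_ξ g`. -/
def lieMetric (ξ : Pt → Pt) (g : MetricField) (p : Pt) (a b : Fin 4) : ℝ :=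
  ∑ c, (ξ p c * pd c (fun q => g q a b) p
    + g p c b * pd a (fun q => ξ q c) p + g p a c * pd b (fun q => ξ q c) p)

/-- `ξ` is a smooth conformal Killing vector of `g` on `U` with conformal factor `ψ`:
`L_ξ g = 2 ψ g`. -/
def IsCKVWith (g : MetricField) (U : Set Pt) (ξ : Pt → Pt) (ψ : Pt → ℝ) : Prop :=
  ContDiffOn ℝ ∞ ξ U ∧ ∀ p ∈ U, ∀ a b, lieMetric ξ g p a b = 2 * ψ p * g p a b

/-- `ξ` is a smooth conformal Killing vector of `g` on `U`. -/
def IsCKV (g : MetricField) (U : Set Pt) (ξ : Pt → Pt) : Prop :=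
  ∃ ψ : Pt → ℝ, IsCKVWith g U ξ ψ

/-- `g` admits on `U` a (proper) homothetic vector field: `L_ξ g = 2 c g` with a constant `c ≠ 0`.
(For `c = 0` the field would be a Killing vector.) -/
def AdmitsHomothety (g : MetricField) (U : Set Pt) : Prop :=
  ∃ (ξ : Pt → Pt) (c : ℝ), c ≠ 0 ∧ IsCKVWith g U ξ (fun _ => c)

/-- The diagonal Bianchi I metric `-dt² + A₁(t)² dx² + A₂(t)² dy² + A₃(t)² dz²`; the functions
`A₁, A₂, A₃` are `A 0, A 1, A 2`. -/
def bianchi (A : Fin 3 → ℝ → ℝ) : MetricField := fun p =>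
  Matrix.diagonal ![-1, (A 0 (p 0)) ^ 2, (A 1 (p 0)) ^ 2, (A 2 (p 0)) ^ 2]

/-- Properness: no two of the metric functions are proportional. (Proportional ones could be made
equal by a constant rescaling of a coordinate, giving a plane symmetric metric, or an FRW metric if
all three are proportional.) -/
def IsProper (A : Fin 3 → ℝ → ℝ) (I : Set ℝ) : Prop :=
  ∀ μ ν, μ ≠ ν → ¬ ∃ c : ℝ, ∀ t ∈ I, A μ t = c * A ν t

/-- The two space-times: Rebouças–Tiomno and Rebouças–Teixeira. -/
inductive Family
  | RT
  | ART

namespace Family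

/-- The sign `±`: upper sign for `RT`, lower sign for `ART`. -/
def sgn : Family → ℝ
  | RT => 1
  | ART => -1

/-- `c_±(w, a)`. -/
def cPM : Family → ℝ → ℝ → ℝ
  | RT, w, a => Real.cosh (w / a)
  | ART, w, a => Real.cos (w / a)

/-- `s_±(w, a)`. -/
def sPM : Family → ℝ → ℝ → ℝ
  | RT, w, a => Real.sinh (w / a)
  | ART, w, a => Real.sin (w / a)

/-- `c_∓(w, a)`. -/
def cMP : Family → ℝ → ℝ → ℝ
  | RT, w, a => Real.cos (w / a)
  | ART, w, a => Real.cosh (w / a)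

/-- `s_∓(w, a)`. -/
def sMP : Family → ℝ → ℝ → ℝ
  | RT, w, a => Real.sin (w / a)
  | ART, w, a => Real.sinh (w / a)

/-- The Rebouças–Tiomno metric `dz² - dτ² + cos²(τ/a) dy² + sin²(τ/a) dx²`, respectively the
Rebouças–Teixeira metric `dz² - dτ² + cosh²(τ/a) dy² + sinh²(τ/a) dx²`. -/
def metric (F : Family) (a : ℝ) : MetricField := fun p =>
  Matrix.diagonal ![-1, (F.sMP (p 0) a) ^ 2, (F.cMP (p 0) a) ^ 2, 1]

/-- `B(τ)²` times the metric of the family. -/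
def scaledMetric (F : Family) (a : ℝ) (B : ℝ → ℝ) : MetricField := fun p =>
  (B (p 0)) ^ 2 • F.metric a p

/-- The data `a`, `J`, `B` for which `scaledMetric F a B` is a smooth non-degenerate metric on the
connected region `J × ℝ³`. -/
def Admissible (F : Family) (a : ℝ) (J : Set ℝ) (B : ℝ → ℝ) : Prop :=
  a ≠ 0 ∧ IsOpen J ∧ IsConnected J ∧ ContDiffOn ℝ ∞ B J ∧
    ∀ s ∈ J, F.sMP s a ≠ 0 ∧ F.cMP s a ≠ 0 ∧ B s ≠ 0

/-- The functions `B_k`. -/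
def Bfun (F : Family) (a : ℝ) (k : Fin 4) (p : Pt) : ℝ :=
  F.cMP (p 0) a *
    ![F.cPM (p 2) a * F.sMP (p 3) a, F.cPM (p 2) a * F.cMP (p 3) a,
      F.sPM (p 2) a * F.sMP (p 3) a, F.sPM (p 2) a * F.cMP (p 3) a] k

/-- The functions `Γ_k`. -/
def Gfun (F : Family) (a : ℝ) (k : Fin 4) (p : Pt) : ℝ :=
  F.sMP (p 0) a *
    ![Real.cosh (p 1 / a) * F.sMP (p 3) a, Real.cosh (p 1 / a) * F.cMP (p 3) a,
      Real.sinh (p 1 / a) * F.sMP (p 3) a, Real.sinh (p 1 / a) * F.cMP (p 3) a] k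

/-- The vector field with covariant components `X_α = ± a² f_{,α}` (`α = 0, 1, 2`) and
`X_3 = ∓ a² f_{,3}`, the index being raised with the (diagonal) metric of the family. -/
def gradField (F : Family) (a : ℝ) (f : Pt → ℝ) : Pt → Pt := fun p i =>
  (![F.sgn * a ^ 2 * pd 0 f p, F.sgn * a ^ 2 * pd 1 f p, F.sgn * a ^ 2 * pd 2 f p,
    -(F.sgn * a ^ 2 * pd 3 f p)] i) / F.metric a p i i

/-- The additional Killing vectors `ξ_{k+4}`, with components along `∂_τ, ∂_x, ∂_y, ∂_z`. -/
def extraKV (F : Family) (a : ℝ) (k : Fin 4) : Pt → Pt := fun p =>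
  let cx := Real.cosh (p 1 / a)
  let sx := Real.sinh (p 1 / a)
  let cy := F.cPM (p 2) a
  let sy := F.sPM (p 2) a
  ![![sy * cx, sy * sx, cy * cx, cy * sx] k,
    -(F.cMP (p 0) a / F.sMP (p 0) a) * ![sy * sx, sy * cx, cy * sx, cy * cx] k,
    (F.sMP (p 0) a / F.cMP (p 0) a) *
      ![cy * cx, cy * sx, F.sgn * (sy * cx), F.sgn * (sy * sx)] k,
    0]

/-- Labels of the 15 vector fields. -/
abbrev Idx := Fin 3 ⊕ Fin 4 ⊕ Fin 4 ⊕ Fin 4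

/-- The 15 vector fields: the translations `∂_x, ∂_y, ∂_z`, the four additional Killing vectors,
and the two quadruples of proper conformal Killing vectors built from `B_k` and `Γ_k`. -/
def ckv (F : Family) (a : ℝ) : Idx → Pt → Pt
  | .inl μ => fun _ => Pi.single μ.succ 1
  | .inr (.inl k) => F.extraKV a k
  | .inr (.inr (.inl k)) => F.gradField a (F.Bfun a k)
  | .inr (.inr (.inr k)) => F.gradField a (F.Gfun a k)

/-- The conformal factors of the 15 vector fields with respect to the metric of the family. -/
def factor (F : Family) (a : ℝ) : Idx → Pt → ℝ
  | .inl _ => fun _ => 0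
  | .inr (.inl _) => fun _ => 0
  | .inr (.inr (.inl k)) => F.Bfun a k
  | .inr (.inr (.inr k)) => F.Gfun a k

/-- The conformal factors `X(ln |B|) + φ(X)` of the 15 vector fields with respect to `B(τ)²` times
the metric of the family. (`Real.log` is the logarithm of the absolute value.) -/
def scaledFactor (F : Family) (a : ℝ) (B : ℝ → ℝ) (i : Idx) (p : Pt) : ℝ :=
  (∑ c, F.ckv a i p c * pd c (fun q => Real.log (B (q 0))) p) + F.factor a i p

/-- The Bianchi I metric with metric functions `A` on `I × ℝ³` is, in the coordinates given by a
time `τ` with `dτ = dt / A₃` and constant rescalings of `x` and `y` (possibly with `x` and `y`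
interchanged), equal to `A₃(τ)²` times the metric of the family `F`. Here `B` is `A₃` as a function
of `τ`, and `J` is the range of `τ`. -/
def Represents (F : Family) (A : Fin 3 → ℝ → ℝ) (I : Set ℝ) : Prop :=
  ∃ (a : ℝ) (J : Set ℝ) (B τ : ℝ → ℝ) (c₁ c₂ : ℝ) (Φ : Pt → Pt),
    0 < a ∧ F.Admissible a J B ∧ c₁ ≠ 0 ∧ c₂ ≠ 0 ∧
    τ '' I = J ∧ (∀ t ∈ I, HasDerivAt τ (1 / A 2 t) t) ∧ (∀ t ∈ I, B (τ t) = A 2 t) ∧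
    ((∀ p, Φ p = ![τ (p 0), c₁ * p 1, c₂ * p 2, p 3]) ∨
      (∀ p, Φ p = ![τ (p 0), c₁ * p 2, c₂ * p 1, p 3])) ∧
    ∀ p ∈ slab I, bianchi A p = pullback Φ (F.scaledMetric a B) p

end Family

end BianchiI

end

/-! Conformal Killing vectors. Rescaling by `B²` changes only the conformal factor of a field, so it
suffices to study the product of a line with `-dτ² + s²dx² + c²dy²`, where `s` and `c` solve the
same equation `u'' = -κu`. Differentiating the conformal Killing equations and commuting derivatives
closes them up: the four components, the gradient of the `τ`-component (whose `τ`-derivative is the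
conformal factor `ψ`), three further first derivatives and the gradient of `ψ` are 15 functions
whose derivatives are linear combinations of themselves (`CKVSystem.D_jet_mem`). Along a segment
this is a linear ODE, so a solution whose jet vanishes at one point is zero
(`eq_zero_of_closed_system`), and the solution space has dimension at most 15. The listed fields are
independent, because the `τ`-components of twelve of them are independent products of trigonometric
and hyperbolic functions and the rest are the translations; hence they span. These twelve products
are also independent of the constant 1. At fixed `τ` every conformal factor of `B²g` is a
combination of them, so it cannot be a non-zero constant: there is no homothety.

Classification. A conformally flat metric has, up to a factor, the Gram matrix of the derivatives of
a map into Minkowski space. The Koszul and Gauss equations of this map give the vanishing of the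
alternating sums of sectional curvatures that make up the Weyl tensor; the conformal factor drops
out (`weyl_eq_zero`). With `dτ = dt/A₃` and `u_μ = A_μ/A₃` the result is `u_μ'' = κu_μ` for `μ = 1,
2`, with `κ = u₁'u₂'/(u₁u₂)`, and these equations force `κ` to be constant. Solving for each sign of
`κ` gives a sine and a cosine of one phase, or their hyperbolic analogues; every other solution
makes two of the `A_μ` proportional (`represents_of_isProper`).

Conversely, the model metrics are conformally flat because they are induced on a slice of the null
cone of a six-dimensional quadratic form, and dividing by a linear function maps the cone to
Minkowski space (`isConformallyFlatOn_metric`). Properness follows from the independence of `s²` and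
`c²`. The absence of homotheties passes to the Bianchi metric by naturality of the Lie derivative.
-/

noncomputable section

namespace BianchiI

/-! ### Gradients and partial derivatives -/

/-- `f` is differentiable at `p` with partial derivatives `d`. -/
def HasGrad (f : Pt → ℝ) (d : Fin 4 → ℝ) (p : Pt) : Prop :=
  HasFDerivAt f (∑ i, d i • (ContinuousLinearMap.proj i : Pt →L[ℝ] ℝ)) p

lemma eq_sum_smul_proj (L : Pt →L[ℝ] ℝ) :
    L = ∑ i, L (Pi.single i 1) • (ContinuousLinearMap.proj i : Pt →L[ℝ] ℝ) := by
  ext v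
  conv_lhs => rw [pi_eq_sum_univ' v, map_sum]
  simp only [map_smul, sum_apply, smul_apply,
    ContinuousLinearMap.proj_apply, smul_eq_mul]
  refine Finset.sum_congr rfl fun i _ => ?_
  rw [mul_comm]

namespace HasGrad

variable {f g : Pt → ℝ} {d e : Fin 4 → ℝ} {p : Pt}

lemma pd (h : HasGrad f d p) (i : Fin 4) : pd i f p = d i := by
  simp [BianchiI.pd, HasFDerivAt.fderiv h, Pi.single_apply]

lemma differentiableAt (h : HasGrad f d p) : DifferentiableAt ℝ f p :=
  HasFDerivAt.differentiableAt h

lemma const (c : ℝ) : HasGrad (fun _ => c) 0 p := by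
  simpa [HasGrad] using hasFDerivAt_const (𝕜 := ℝ) c p

lemma add (hf : HasGrad f d p) (hg : HasGrad g e p) :
    HasGrad (fun q => f q + g q) (fun i => d i + e i) p := by
  refine (HasFDerivAt.add hf hg).congr_fderiv ?_
  simp only [add_smul, Finset.sum_add_distrib]

lemma mul (hf : HasGrad f d p) (hg : HasGrad g e p) :
    HasGrad (fun q => f q * g q) (fun i => d i * g p + f p * e i) p := by
  have := HasFDerivAt.mul hf hg
  refine this.congr_fderiv ?_
  simp only [add_smul, Finset.sum_add_distrib, Finset.smul_sum, smul_smul]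
  rw [add_comm]
  congr 1
  exact Finset.sum_congr rfl fun i _ => by rw [mul_comm]

lemma const_mul (hf : HasGrad f d p) (c : ℝ) :
    HasGrad (fun q => c * f q) (fun i => c * d i) p := by
  simpa using (HasGrad.const c).mul hf

lemma coord {u : ℝ → ℝ} {u' : ℝ} (i : Fin 4) (h : HasDerivAt u u' (p i)) :
    HasGrad (fun q => u (q i)) (Pi.single i u') p := by
  have h1 : HasFDerivAt (fun q : Pt => q i) (ContinuousLinearMap.proj i : Pt →L[ℝ] ℝ) p :=
    (ContinuousLinearMap.proj i : Pt →L[ℝ] ℝ).hasFDerivAt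
  refine (h.comp_hasFDerivAt p h1).congr_fderiv ?_
  simp [Pi.single_apply, ite_smul]

lemma sum {ι : Type*} {s : Finset ι} {f : ι → Pt → ℝ} {d : ι → Fin 4 → ℝ}
    (h : ∀ k ∈ s, HasGrad (f k) (d k) p) :
    HasGrad (fun q => ∑ k ∈ s, f k q) (fun i => ∑ k ∈ s, d k i) p := by
  classical
  induction s using Finset.induction_on with
  | empty => simpa using! HasGrad.const 0
  | insert a s ha ih =>
    simp only [Finset.sum_insert ha]
    exact (h a (by simp)).add (ih fun k hk => h k (by simp [hk]))

lemma congr_of_eqOn {U : Set Pt} (hf : HasGrad f d p) (hU : IsOpen U) (hp : p ∈ U)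
    (h : Set.EqOn g f U) : HasGrad g d p :=
  HasFDerivAt.congr_of_eventuallyEq hf (h.eventuallyEq_of_mem (hU.mem_nhds hp))

lemma unique (hf : HasGrad f d p) (hg : HasGrad f e p) : d = e := by
  ext i
  rw [← hf.pd, hg.pd]

end HasGrad

lemma hasGrad_of_differentiableAt {f : Pt → ℝ} {p : Pt} (h : DifferentiableAt ℝ f p) :
    HasGrad f (fun i => pd i f p) p := by
  have := h.hasFDerivAt
  rwa [eq_sum_smul_proj (fderiv ℝ f p)] at this

lemma pd_congr {f g : Pt → ℝ} {U : Set Pt} (hU : IsOpen U) (h : Set.EqOn f g U) {p : Pt}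
    (hp : p ∈ U) (i : Fin 4) : pd i f p = pd i g p := by
  rw [pd, pd, Filter.EventuallyEq.fderiv_eq (h.eventuallyEq_of_mem (hU.mem_nhds hp))]

lemma contDiffOn_pd {f : Pt → ℝ} {U : Set Pt} (hU : IsOpen U) (hf : ContDiffOn ℝ ∞ f U)
    (i : Fin 4) : ContDiffOn ℝ ∞ (pd i f) U :=
  (hf.fderiv_of_isOpen hU (m := ∞) le_rfl).clm_apply contDiffOn_const

lemma _root_.ContDiffOn.differentiableAt_of_isOpen {E G : Type*} [NormedAddCommGroup E]
    [NormedSpace ℝ E] [NormedAddCommGroup G] [NormedSpace ℝ G] {f : E → G} {U : Set E}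
    (hf : ContDiffOn ℝ ∞ f U) (hU : IsOpen U) {p : E} (hp : p ∈ U) : DifferentiableAt ℝ f p :=
  (hf.contDiffAt (hU.mem_nhds hp)).differentiableAt (by simp)

lemma pd_comm {f : Pt → ℝ} {U : Set Pt} (hU : IsOpen U) (hf : ContDiffOn ℝ ∞ f U)
    {p : Pt} (hp : p ∈ U) (i j : Fin 4) : pd i (pd j f) p = pd j (pd i f) p := by
  have hs : IsSymmSndFDerivAt ℝ f p :=
    (hf.contDiffAt (hU.mem_nhds hp)).isSymmSndFDerivAt (by
      simpa using WithTop.coe_le_coe.2 (le_top : (2 : ℕ∞) ≤ ⊤))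
  have hd : DifferentiableAt ℝ (fderiv ℝ f) p :=
    (hf.fderiv_of_isOpen hU (m := ∞) le_rfl).differentiableAt_of_isOpen hU hp
  have key : ∀ i j : Fin 4, pd i (pd j f) p
      = fderiv ℝ (fderiv ℝ f) p (Pi.single i 1) (Pi.single j 1) := by
    intro i j
    have : pd j f = fun q => fderiv ℝ f q (Pi.single j 1) := rfl
    rw [this, pd, fderiv_clm_apply hd (differentiableAt_const _)]
    simp
  rw [key, key, hs.eq]

/-! ### The differential ring of smooth functions on an open set -/

open Classical in
/-- Extension by zero. -/
def extendZero (U : TopologicalSpace.Opens Pt) (f : U → ℝ) : Pt → ℝ :=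
  fun p => if h : p ∈ U then f ⟨p, h⟩ else 0

lemma extendZero_of_mem {U : TopologicalSpace.Opens Pt} (f : U → ℝ) {p : Pt} (hp : p ∈ U) :
    extendZero U f p = f ⟨p, hp⟩ := dif_pos hp

/-- The smooth functions on `U`, as a subalgebra. -/
def smoothSubalgebra (U : TopologicalSpace.Opens Pt) : Subalgebra ℝ (U → ℝ) where
  carrier := {f | ContDiffOn ℝ ∞ (extendZero U f) U}
  mul_mem' {f g} hf hg := (hf.mul hg).congr fun p hp => by
    simp [extendZero_of_mem _ (SetLike.mem_coe.1 hp)]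
  add_mem' {f g} hf hg := (hf.add hg).congr fun p hp => by
    simp [extendZero_of_mem _ (SetLike.mem_coe.1 hp)]
  algebraMap_mem' r := (contDiffOn_const (c := r)).congr fun p hp => by
    simp [extendZero_of_mem _ (SetLike.mem_coe.1 hp)]

/-- The algebra of smooth functions on `U`. -/
def SmoothAlg (U : TopologicalSpace.Opens Pt) : Type := smoothSubalgebra U

instance (U : TopologicalSpace.Opens Pt) : CommRing (SmoothAlg U) :=
  inferInstanceAs (CommRing (smoothSubalgebra U))

instance (U : TopologicalSpace.Opens Pt) : Algebra ℝ (SmoothAlg U) :=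
  inferInstanceAs (Algebra ℝ (smoothSubalgebra U))

namespace SmoothAlg

variable {U : TopologicalSpace.Opens Pt}

/-- The restriction to `U` of a function that is smooth on `U`. -/
def mk (f : Pt → ℝ) (hf : ContDiffOn ℝ ∞ f U) : SmoothAlg U :=
  ⟨fun p => f p, hf.congr fun _ hp => extendZero_of_mem _ (SetLike.mem_coe.1 hp)⟩

/-- A representative of a smooth function on `U`. -/
def rep (f : SmoothAlg U) : Pt → ℝ := extendZero U f.1

lemma contDiffOn_rep (f : SmoothAlg U) : ContDiffOn ℝ ∞ (rep f) U := f.2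

lemma rep_mk (f : Pt → ℝ) (hf : ContDiffOn ℝ ∞ f U) : Set.EqOn (rep (mk f hf)) f U :=
  fun _ hp => extendZero_of_mem _ (SetLike.mem_coe.1 hp)

lemma ext_rep {f g : SmoothAlg U} (h : Set.EqOn (rep f) (rep g) U) : f = g := by
  refine Subtype.ext (funext fun ⟨p, hp⟩ => ?_)
  have := h hp
  simpa only [rep, extendZero_of_mem _ hp] using this

lemma rep_add (f g : SmoothAlg U) (p : Pt) : (rep (f + g)) p = (rep f) p + (rep g) p := by
  change extendZero U (f.1 + g.1) p = _
  by_cases hp : p ∈ U <;> simp [rep, extendZero, hp]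

lemma rep_mul (f g : SmoothAlg U) (p : Pt) : (rep (f * g)) p = (rep f) p * (rep g) p := by
  change extendZero U (f.1 * g.1) p = _
  by_cases hp : p ∈ U <;> simp [rep, extendZero, hp]

lemma rep_smul (r : ℝ) (f : SmoothAlg U) (p : Pt) : (rep (r • f)) p = r * (rep f) p := by
  change extendZero U (r • f.1) p = _
  by_cases hp : p ∈ U <;> simp [rep, extendZero, hp]

lemma rep_neg (f : SmoothAlg U) (p : Pt) : (rep (-f)) p = - (rep f) p := by
  change extendZero U (-f.1) p = _
  by_cases hp : p ∈ U <;> simp [rep, extendZero, hp]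

lemma rep_sub (f g : SmoothAlg U) (p : Pt) : (rep (f - g)) p = (rep f) p - (rep g) p := by
  change extendZero U (f.1 - g.1) p = _
  by_cases hp : p ∈ U <;> simp [rep, extendZero, hp]

lemma rep_zero (p : Pt) : (rep (0 : SmoothAlg U)) p = 0 := by
  change extendZero U 0 p = _
  by_cases hp : p ∈ U <;> simp [extendZero, hp]

lemma rep_one {p : Pt} (hp : p ∈ U) : (rep (1 : SmoothAlg U)) p = 1 := by
  change extendZero U 1 p = _
  simp [extendZero, hp]

lemma rep_sum {ι : Type*} (s : Finset ι) (f : ι → SmoothAlg U) (p : Pt) :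
    (rep (∑ i ∈ s, f i)) p = ∑ i ∈ s, (rep (f i)) p := by
  classical
  induction s using Finset.induction_on with
  | empty => simp [rep_zero]
  | insert a s ha ih => simp [Finset.sum_insert ha, rep_add, ih]

lemma hasGrad (f : SmoothAlg U) {p : Pt} (hp : p ∈ U) :
    HasGrad (rep f) (fun i => pd i (rep f) p) p :=
  hasGrad_of_differentiableAt ((contDiffOn_rep f).differentiableAt_of_isOpen U.isOpen hp)

/-- The partial derivative with respect to the `i`-th coordinate, as a derivation. -/
def D (i : Fin 4) : Derivation ℝ (SmoothAlg U) (SmoothAlg U) :=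
  Derivation.mk'
    { toFun := fun f => mk (pd i (rep f)) (contDiffOn_pd U.isOpen (contDiffOn_rep f) i)
      map_add' := fun f g => ext_rep fun p hp => by
        rw [rep_add, rep_mk _ _ hp, rep_mk _ _ hp, rep_mk _ _ hp, funext (rep_add f g),
          ((hasGrad f hp).add (hasGrad g hp)).pd]
      map_smul' := fun r f => ext_rep fun p hp => by
        rw [RingHom.id_apply, rep_smul, rep_mk _ _ hp, rep_mk _ _ hp,
          funext (rep_smul r f), ((hasGrad f hp).const_mul r).pd] }
    fun f g => ext_rep fun p hp => by
      simp only [LinearMap.coe_mk, AddHom.coe_mk, smul_eq_mul]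
      rw [rep_add, rep_mul, rep_mul, rep_mk _ _ hp, rep_mk _ _ hp, rep_mk _ _ hp,
          funext (rep_mul f g), ((hasGrad f hp).mul (hasGrad g hp)).pd]
      ring

lemma rep_D (i : Fin 4) (f : SmoothAlg U) : Set.EqOn (rep (D i f)) (pd i (rep f)) U :=
  rep_mk _ (contDiffOn_pd U.isOpen (contDiffOn_rep f) i)

lemma rep_D_mk (i : Fin 4) (f : Pt → ℝ) (hf : ContDiffOn ℝ ∞ f U) :
    Set.EqOn (rep (D i (mk f hf))) (pd i f) U := fun _ hp => by
  rw [rep_D i _ hp, pd_congr U.isOpen (rep_mk f hf) hp]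

lemma D_comm (i j : Fin 4) (f : SmoothAlg U) : D i (D j f) = D j (D i f) :=
  ext_rep fun p hp => by
    rw [rep_D i _ hp, rep_D j _ hp, pd_congr U.isOpen (rep_D j f) hp,
      pd_congr U.isOpen (rep_D i f) hp, pd_comm U.isOpen (contDiffOn_rep f) hp]

end SmoothAlg

/-! ### Prolongation of the conformal Killing equation in a differential ring -/

section Prolongation

set_option linter.unusedSimpArgs false

variable {R : Type*} [CommRing R] [Algebra ℝ R]

/-- Warping functions `s`, `c` of the `0`-th variable, with derivatives `p`, `r`, for which the
metric `-dx₀² + s² dx₁² + c² dx₂²` has constant curvature. -/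
structure WarpFrame (D : Fin 4 → Derivation ℝ R R) (s p c r κ : R) : Prop where
  comm : ∀ i j x, D i (D j x) = D j (D i x)
  ds : ∀ i, D i s = if i = 0 then p else 0
  dp : ∀ i, D i p = if i = 0 then -(κ * s) else 0
  dc : ∀ i, D i c = if i = 0 then r else 0
  dr : ∀ i, D i r = if i = 0 then -(κ * c) else 0
  dκ : ∀ i, D i κ = 0
  rel : p * r = -(κ * s * c)
  unit_s : IsUnit s
  unit_c : IsUnit c

/-- The conformal Killing equations of `-dx₀² + s² dx₁² + c² dx₂² + dx₃²`. -/
structure CKVSystem (D : Fin 4 → Derivation ℝ R R) (s p c r : R) (f : Fin 4 → R) : Prop where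
  h11 : s * D 1 (f 1) = s * D 0 (f 0) - p * f 0
  h22 : c * D 2 (f 2) = c * D 0 (f 0) - r * f 0
  h33 : D 3 (f 3) = D 0 (f 0)
  h01 : D 1 (f 0) = s * s * D 0 (f 1)
  h02 : D 2 (f 0) = c * c * D 0 (f 2)
  h03 : D 3 (f 0) = D 0 (f 3)
  h12 : s * s * D 2 (f 1) + c * c * D 1 (f 2) = 0
  h13 : s * s * D 3 (f 1) + D 1 (f 3) = 0
  h23 : c * c * D 3 (f 2) + D 2 (f 3) = 0

/-- Commuting derivatives typically produces twice the wanted identity; the real scalars allow the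
division by 2. -/
lemma two_cancel {x : R} (h : 2 * x = 0) : x = 0 := by
  have : ((2 : ℝ)⁻¹ * 2) • x = 0 := by
    rw [mul_smul, show (2 : ℝ) • x = 2 * x by rw [Algebra.smul_def, map_ofNat], h, smul_zero]
  simpa using this

variable {D : Fin 4 → Derivation ℝ R R} {s p c r κ : R} {f : Fin 4 → R}

/-- The axes 1 and 2 become interchangeable once `(s, p)` and `(c, r)` are exchanged, so the
identities below are proved for axis 1 and read off for axis 2. -/
lemma WarpFrame.swap (w : WarpFrame D s p c r κ) :
    WarpFrame (fun i => D (Equiv.swap 1 2 i)) c r s p κ := by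
  have h0 : ∀ i : Fin 4, Equiv.swap 1 2 i = 0 ↔ i = 0 := by decide
  exact ⟨fun i j => w.comm _ _, fun i => by simp [w.dc, h0], fun i => by simp [w.dr, h0],
    fun i => by simp [w.ds, h0], fun i => by simp [w.dp, h0], fun i => w.dκ _,
    by linear_combination w.rel, w.unit_c, w.unit_s⟩

lemma CKVSystem.swap (h : CKVSystem D s p c r f) :
    CKVSystem (fun i => D (Equiv.swap 1 2 i)) c r s p (fun i => f (Equiv.swap 1 2 i)) := by
  have e0 : Equiv.swap (1 : Fin 4) 2 0 = 0 := by decide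
  have e1 : Equiv.swap (1 : Fin 4) 2 1 = 2 := by decide
  have e2 : Equiv.swap (1 : Fin 4) 2 2 = 1 := by decide
  have e3 : Equiv.swap (1 : Fin 4) 2 3 = 3 := by decide
  constructor <;> simp only [e0, e1, e2, e3]
  exacts [h.h22, h.h11, h.h33, h.h02, h.h01, h.h03, by linear_combination h.h12, h.h23, h.h13]

namespace CKVSystem

variable (w : WarpFrame D s p c r κ) (h : CKVSystem D s p c r f)
include w h

lemma D3D3 : D 3 (D 3 (f 0)) = D 0 (D 0 (f 0)) := by
  rw [h.h03, w.comm, h.h33]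

/-- Both `h01` differentiated along 3 and `h13` differentiated along 0 contain the mixed derivative
of `f 1` along 0 and 3; eliminating it leaves a first-order equation in time. -/
lemma D0D1f3 : s * D 0 (D 1 (f 3)) = p * D 1 (f 3) := by
  have a := congrArg (D 3) h.h01
  have b := congrArg (D 0) h.h13
  have e : D 3 (D 1 (f 0)) = D 0 (D 1 (f 3)) := by rw [w.comm, h.h03, w.comm]
  simp only [map_add, Derivation.leibniz, smul_eq_mul, w.ds, map_zero, e, w.comm 3 0] at a b
  simp only [Fin.isValue, Fin.reduceEq, one_ne_zero, if_true, if_false] at a b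
  rw [← sub_eq_zero]
  refine two_cancel ?_
  linear_combination s * a + s * b - 2 * p * h.h13

lemma D1D3 : s * D 1 (D 3 (f 0)) = p * D 1 (f 3) := by
  rw [h.h03, w.comm, h.D0D1f3 w]

/-- The classical three-index argument: differentiate each of `h12`, `h13`, `h23` along the missing
axis and take the alternating sum. -/
lemma D1D2f3 : D 1 (D 2 (f 3)) = 0 := by
  have a := congrArg (D 2) h.h13
  have b := congrArg (D 1) h.h23
  have e := congrArg (D 3) h.h12
  simp only [map_add, Derivation.leibniz, smul_eq_mul, w.ds, w.dc, map_zero, w.comm 3,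
    w.comm 2 1] at a b e
  simp only [Fin.isValue, Fin.reduceEq, one_ne_zero, if_true, if_false] at a b e
  refine two_cancel ?_
  linear_combination a + b - e

lemma D3D2f1 : D 3 (D 2 (f 1)) = 0 := by
  have a := congrArg (D 2) h.h13
  simp only [map_add, Derivation.leibniz, smul_eq_mul, w.ds, map_zero, w.comm 2 3,
    w.comm 2 1, h.D1D2f3 w] at a
  simp only [Fin.isValue, Fin.reduceEq, one_ne_zero, if_true, if_false] at a
  exact (w.unit_s.mul w.unit_s).mul_left_cancel (by linear_combination a)

lemma D1D1f3 : D 1 (D 1 (f 3)) = -(s * (s * D 3 (D 0 (f 0)) - p * D 3 (f 0))) := by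
  have a := congrArg (D 1) h.h13
  have b := congrArg (D 3) h.h11
  simp only [map_add, map_sub, Derivation.leibniz, smul_eq_mul, w.ds, w.dp, map_zero,
    w.comm 3 1] at a b
  simp only [Fin.isValue, Fin.reduceEq, one_ne_zero, if_true, if_false] at a b
  linear_combination a - s * b

lemma D1D1 : D 1 (D 1 (f 0)) =
    s * s * D 0 (D 0 (f 0)) - s * p * D 0 (f 0) + (p * p + κ * s * s) * f 0 := by
  have a := congrArg (D 1) h.h01
  have b := congrArg (D 0) h.h11
  simp only [map_sub, Derivation.leibniz, smul_eq_mul, w.ds, w.dp, w.comm 1 0] at a b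
  simp only [Fin.isValue, Fin.reduceEq, one_ne_zero, if_true, if_false] at a b
  rw [w.comm 0 1] at b a
  linear_combination a + s * b - p * h.h11

lemma D0D2f1 : s * s * D 0 (D 2 (f 1)) = D 1 (D 2 (f 0)) := by
  have a := congrArg (D 2) h.h01
  simp only [Derivation.leibniz, smul_eq_mul, w.ds, w.comm 2 1, w.comm 2 0] at a
  simp only [Fin.isValue, Fin.reduceEq, one_ne_zero, if_true, if_false] at a
  linear_combination -a

lemma D1D2 : c * D 1 (D 2 (f 0)) = -(s * (p * c - r * s) * D 2 (f 1)) := by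
  have a := congrArg (D 1) h.h02
  have b := congrArg (D 0) h.h12
  simp only [map_add, map_zero, Derivation.leibniz, smul_eq_mul, w.ds, w.dc, w.comm 1 0] at a b
  simp only [Fin.isValue, Fin.reduceEq, one_ne_zero, if_true, if_false] at a b
  refine w.unit_c.mul_left_cancel ?_
  rw [← sub_eq_zero]
  refine two_cancel ?_
  linear_combination c * c * a + c * c * b - c * c * h.D0D2f1 w - 2 * c * r * h.h12

lemma D1D2f1 : s * D 1 (D 2 (f 1)) = s * D 2 (D 0 (f 0)) - p * D 2 (f 0) := by
  have a := congrArg (D 2) h.h11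
  simp only [map_sub, Derivation.leibniz, smul_eq_mul, w.ds, w.dp, w.comm 2 1] at a
  simp only [Fin.isValue, Fin.reduceEq, one_ne_zero, if_true, if_false] at a
  linear_combination a

lemma D2D2f1 : s * s * D 2 (D 2 (f 1)) = -(c * (c * D 1 (D 0 (f 0)) - r * D 1 (f 0))) := by
  have a := congrArg (D 1) h.h22
  have b := congrArg (D 2) h.h12
  simp only [map_add, map_zero, map_sub, Derivation.leibniz, smul_eq_mul, w.ds, w.dc, w.dr,
    w.comm 2 1] at a b
  simp only [Fin.isValue, Fin.reduceEq, one_ne_zero, if_true, if_false] at a b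
  linear_combination b - c * a

lemma D3D3ψ : D 3 (D 3 (D 0 (f 0))) = D 0 (D 0 (D 0 (f 0))) := by
  rw [w.comm 3 0, w.comm 3 0, h.D3D3 w]

lemma D1D1ψ_aux : D 1 (D 1 (D 0 (f 0))) = s * p * D 0 (D 0 (f 0))
    + s * s * D 0 (D 0 (D 0 (f 0))) + 2 * κ * s * s * D 0 (f 0) := by
  have a := congrArg (D 0) (h.D1D1 w)
  simp only [map_add, map_sub, Derivation.leibniz, smul_eq_mul, w.ds, w.dp, w.dκ,
    w.comm 0 1] at a
  simp only [Fin.isValue, Fin.reduceEq, one_ne_zero, if_true, if_false] at a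
  linear_combination a

/-- The step that closes the system. The second `x`-derivative of `ψ = D 0 (f 0)` is computed twice:
through the `z`-component, since `D 3 (f 3) = ψ`, and through the `τ`-component. The second
`τ`-derivative of `ψ` enters the two results with opposite signs. -/
lemma D0D0ψ : D 0 (D 0 (D 0 (f 0))) = -(κ * D 0 (f 0)) := by
  have a := congrArg (D 3) (h.D1D1f3 w)
  simp only [map_neg, map_sub, Derivation.leibniz, smul_eq_mul, w.ds, w.dp, w.comm 3 1, h.h33,
    h.D3D3ψ w, h.D3D3 w] at a
  simp only [Fin.isValue, Fin.reduceEq, one_ne_zero, if_true, if_false] at a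
  refine (w.unit_s.mul w.unit_s).mul_left_cancel ?_
  rw [← sub_eq_zero]
  refine two_cancel ?_
  linear_combination a - h.D1D1ψ_aux w

lemma D1D1ψ : D 1 (D 1 (D 0 (f 0))) = s * p * D 0 (D 0 (f 0)) + κ * s * s * D 0 (f 0) := by
  linear_combination h.D1D1ψ_aux w + s * s * h.D0D0ψ w

lemma D0D1ψ : s * D 0 (D 1 (D 0 (f 0))) = p * D 1 (D 0 (f 0)) := by
  have a := congrArg (D 3) (h.D0D1f3 w)
  simp only [Derivation.leibniz, smul_eq_mul, w.ds, w.dp, w.comm 3 0, w.comm 3 1, h.h33] at a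
  simp only [Fin.isValue, Fin.reduceEq, one_ne_zero, if_true, if_false] at a
  linear_combination a

lemma D3D1ψ : D 3 (D 1 (D 0 (f 0))) = -(κ * D 1 (f 3)) := by
  have a := congrArg (D 0) (h.D0D1f3 w)
  simp only [Derivation.leibniz, smul_eq_mul, w.ds, w.dp] at a
  simp only [Fin.isValue, Fin.reduceEq, one_ne_zero, if_true, if_false] at a
  have e : D 3 (D 1 (D 0 (f 0))) = D 0 (D 0 (D 1 (f 3))) := by
    rw [w.comm 1 0, w.comm 3 0, w.comm 3 1, h.h03, w.comm 1 0]
  rw [e]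
  exact w.unit_s.mul_left_cancel (by linear_combination a)

/-- The Wronskian `p * c - r * s` is constant in time, as `s` and `c` solve the same second-order
equation. In the time derivative of `D1D2` all other terms therefore cancel by `D0D2f1` and `D1D2`
itself. -/
lemma D1D2ψ : D 1 (D 2 (D 0 (f 0))) = 0 := by
  have a := congrArg (D 0) (h.D1D2 w)
  simp only [map_neg, map_sub, Derivation.leibniz, smul_eq_mul, w.ds, w.dp, w.dc, w.dr] at a
  simp only [Fin.isValue, Fin.reduceEq, one_ne_zero, if_true, if_false] at a
  have e : D 1 (D 2 (D 0 (f 0))) = D 0 (D 1 (D 2 (f 0))) := by rw [w.comm 2 0, w.comm 1 0]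
  rw [e]
  refine ((w.unit_s.mul w.unit_c).mul w.unit_c).mul_left_cancel ?_
  linear_combination s * c * a - c * (p * c - r * s) * h.D0D2f1 w
    - (p * c - r * s) * h.D1D2 w - s * r * h.D1D2 w

lemma D0D3ψ : D 0 (D 3 (D 0 (f 0))) = -(κ * D 3 (f 0)) := by
  have e := h.D1D1f3 w
  rw [w.comm 3 0 (f 0)] at e ⊢
  have a := congrArg (D 0) e
  have b := congrArg (D 1) (h.D0D1f3 w)
  simp only [map_neg, map_sub, Derivation.leibniz, smul_eq_mul, w.ds, w.dp, w.comm 1 0] at a b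
  simp only [Fin.isValue, Fin.reduceEq, one_ne_zero, if_true, if_false] at a b
  refine ((w.unit_s.mul w.unit_s).mul w.unit_s).mul_left_cancel ?_
  linear_combination s * a - b - p * e

end CKVSystem

end Prolongation

section Jets

set_option linter.unusedSimpArgs false

variable {R : Type*} [CommRing R] [Algebra ℝ R]

/-- The data at a point that determine a conformal Killing field. -/
def jet (D : Fin 4 → Derivation ℝ R R) (f : Fin 4 → R) : Fin 15 → R :=
  ![f 0, f 1, f 2, f 3, D 0 (f 0), D 1 (f 0), D 2 (f 0), D 3 (f 0), D 2 (f 1), D 1 (f 3), D 2 (f 3),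
    D 0 (D 0 (f 0)), D 1 (D 0 (f 0)), D 2 (D 0 (f 0)), D 3 (D 0 (f 0))]

variable {D : Fin 4 → Derivation ℝ R R} {s p c r κ : R} {f : Fin 4 → R}

/-- The jet of a conformal Killing field satisfies a closed linear first-order system. -/
lemma CKVSystem.D_jet_mem (w : WarpFrame D s p c r κ) (h : CKVSystem D s p c r f) (a : Fin 4)
    (i : Fin 15) : D a (jet D f i) ∈ Ideal.span (Set.range (jet D f)) := by
  -- Membership in the ideal generated by the jet says "linear combination of the jet with smooth
  -- coefficients", so the coefficient matrices need not be written out; the units `s` and `c` may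
  -- be cancelled.
  set W := Ideal.span (Set.range (jet D f)) with hW
  have e0 : Equiv.swap (1 : Fin 4) 2 0 = 0 := by decide
  have e1 : Equiv.swap (1 : Fin 4) 2 1 = 2 := by decide
  have e2 : Equiv.swap (1 : Fin 4) 2 2 = 1 := by decide
  have e3 : Equiv.swap (1 : Fin 4) 2 3 = 3 := by decide
  have w' := w.swap
  have h' := h.swap
  have hj : ∀ k, jet D f k ∈ W := fun k => Ideal.subset_span ⟨k, rfl⟩
  have m0 : f 0 ∈ W := hj 0
  have m1 : f 1 ∈ W := hj 1
  have m2 : f 2 ∈ W := hj 2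
  have m3 : f 3 ∈ W := hj 3
  have m4 : D 0 (f 0) ∈ W := hj 4
  have m5 : D 1 (f 0) ∈ W := hj 5
  have m6 : D 2 (f 0) ∈ W := hj 6
  have m7 : D 3 (f 0) ∈ W := hj 7
  have m8 : D 2 (f 1) ∈ W := hj 8
  have m9 : D 1 (f 3) ∈ W := hj 9
  have m10 : D 2 (f 3) ∈ W := hj 10
  have m11 : D 0 (D 0 (f 0)) ∈ W := hj 11
  have m12 : D 1 (D 0 (f 0)) ∈ W := hj 12
  have m13 : D 2 (D 0 (f 0)) ∈ W := hj 13
  have m14 : D 3 (D 0 (f 0)) ∈ W := hj 14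
  have us : ∀ {x}, s * x ∈ W → x ∈ W := fun hx => (Ideal.unit_mul_mem_iff_mem W w.unit_s).1 hx
  have uc : ∀ {x}, c * x ∈ W → x ∈ W := fun hx => (Ideal.unit_mul_mem_iff_mem W w.unit_c).1 hx
  have uss : ∀ {x}, s * s * x ∈ W → x ∈ W := fun hx =>
    (Ideal.unit_mul_mem_iff_mem W (w.unit_s.mul w.unit_s)).1 hx
  have ucc : ∀ {x}, c * c * x ∈ W → x ∈ W := fun hx =>
    (Ideal.unit_mul_mem_iff_mem W (w.unit_c.mul w.unit_c)).1 hx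
  have l : ∀ (y : R) {x}, x ∈ W → y * x ∈ W := fun y _ hx => W.mul_mem_left y hx
  have D12 : D 1 (D 2 (f 0)) ∈ W := by
    apply uc; rw [h.D1D2 w]; exact W.neg_mem (l _ m8)
  have D13 : D 1 (D 3 (f 0)) ∈ W := by apply us; rw [h.D1D3 w]; exact l _ m9
  have D23 : D 2 (D 3 (f 0)) ∈ W := by
    apply uc; have := h'.D1D3 w'; simp only [e0, e1, e2, e3] at this; rw [this]; exact l _ m10
  have D12f3 := h.D1D2f3 w
  have ψ01 : D 0 (D 1 (D 0 (f 0))) ∈ W := by apply us; rw [h.D0D1ψ w]; exact l _ m12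
  have ψ02 : D 0 (D 2 (D 0 (f 0))) ∈ W := by
    apply uc; have := h'.D0D1ψ w'; simp only [e0, e1, e2, e3] at this; rw [this]; exact l _ m13
  have ψ03 : D 0 (D 3 (D 0 (f 0))) ∈ W := by rw [h.D0D3ψ w]; exact W.neg_mem (l _ m7)
  have ψ31 : D 3 (D 1 (D 0 (f 0))) ∈ W := by rw [h.D3D1ψ w]; exact W.neg_mem (l _ m9)
  have ψ32 : D 3 (D 2 (D 0 (f 0))) ∈ W := by
    have := h'.D3D1ψ w'; simp only [e0, e1, e2, e3] at this; rw [this]; exact W.neg_mem (l _ m10)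
  have ψ12 := h.D1D2ψ w
  have ψ00 : D 0 (D 0 (D 0 (f 0))) ∈ W := by rw [h.D0D0ψ w]; exact W.neg_mem (l _ m4)
  have f10 : D 0 (f 1) ∈ W := by apply uss; rw [← h.h01]; exact m5
  have f11 : D 1 (f 1) ∈ W := by
    apply us; rw [h.h11]; exact W.sub_mem (l _ m4) (l _ m0)
  have f13 : D 3 (f 1) ∈ W := by
    apply uss; rw [eq_neg_of_add_eq_zero_left h.h13]; exact W.neg_mem m9
  have f20 : D 0 (f 2) ∈ W := by apply ucc; rw [← h.h02]; exact m6
  have f21 : D 1 (f 2) ∈ W := by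
    apply ucc; rw [eq_neg_of_add_eq_zero_right h.h12]; exact W.neg_mem (l _ m8)
  have f22 : D 2 (f 2) ∈ W := by
    apply uc; rw [h.h22]; exact W.sub_mem (l _ m4) (l _ m0)
  have f23 : D 3 (f 2) ∈ W := by
    apply ucc; rw [eq_neg_of_add_eq_zero_left h.h23]; exact W.neg_mem m10
  have f011 : D 1 (D 1 (f 0)) ∈ W := by
    rw [h.D1D1 w]; exact W.add_mem (W.sub_mem (l _ m11) (l _ m4)) (l _ m0)
  have f022 : D 2 (D 2 (f 0)) ∈ W := by
    have := h'.D1D1 w'; simp only [e0, e1, e2, e3] at this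
    rw [this]; exact W.add_mem (W.sub_mem (l _ m11) (l _ m4)) (l _ m0)
  have m_0 : D 0 (D 2 (f 1)) ∈ W := by apply uss; rw [h.D0D2f1 w]; exact D12
  have m_1 : D 1 (D 2 (f 1)) ∈ W := by
    apply us; rw [h.D1D2f1 w]; exact W.sub_mem (l _ m13) (l _ m6)
  have m_2 : D 2 (D 2 (f 1)) ∈ W := by
    apply uss; rw [h.D2D2f1 w]; exact W.neg_mem (l _ (W.sub_mem (l _ m12) (l _ m5)))
  have g_0 : D 0 (D 1 (f 3)) ∈ W := by apply us; rw [h.D0D1f3 w]; exact l _ m9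
  have g_1 : D 1 (D 1 (f 3)) ∈ W := by
    rw [h.D1D1f3 w]; exact W.neg_mem (l _ (W.sub_mem (l _ m14) (l _ m7)))
  have h_0 : D 0 (D 2 (f 3)) ∈ W := by
    apply uc; have := h'.D0D1f3 w'; simp only [e0, e1, e2, e3] at this; rw [this]; exact l _ m10
  have h_2 : D 2 (D 2 (f 3)) ∈ W := by
    have := h'.D1D1f3 w'; simp only [e0, e1, e2, e3] at this
    rw [this]; exact W.neg_mem (l _ (W.sub_mem (l _ m14) (l _ m7)))
  have ψ11 : D 1 (D 1 (D 0 (f 0))) ∈ W := by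
    rw [h.D1D1ψ w]; exact W.add_mem (l _ m11) (l _ m4)
  have ψ22 : D 2 (D 2 (D 0 (f 0))) ∈ W := by
    have := h'.D1D1ψ w'; simp only [e0, e1, e2, e3] at this
    rw [this]; exact W.add_mem (l _ m11) (l _ m4)
  have key : ∀ a : Fin 4, ∀ i : Fin 15, D a (jet D f i) ∈ W := by
    intro a i
    fin_cases i
    · change D a (f 0) ∈ W; fin_cases a <;> assumption
    · change D a (f 1) ∈ W; fin_cases a <;> assumption
    · change D a (f 2) ∈ W; fin_cases a <;> assumption
    · change D a (f 3) ∈ W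
      fin_cases a
      exacts [h.h03 ▸ m7, m9, m10, h.h33 ▸ m4]
    · change D a (D 0 (f 0)) ∈ W; fin_cases a <;> assumption
    · change D a (D 1 (f 0)) ∈ W
      fin_cases a
      exacts [w.comm 1 0 (f 0) ▸ m12, f011, w.comm 1 2 (f 0) ▸ D12, w.comm 1 3 (f 0) ▸ D13]
    · change D a (D 2 (f 0)) ∈ W
      fin_cases a
      exacts [w.comm 2 0 (f 0) ▸ m13, D12, f022, w.comm 2 3 (f 0) ▸ D23]
    · change D a (D 3 (f 0)) ∈ W
      fin_cases a
      exacts [w.comm 3 0 (f 0) ▸ m14, D13, D23, (h.D3D3 w).symm ▸ m11]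
    · change D a (D 2 (f 1)) ∈ W
      fin_cases a
      exacts [m_0, m_1, m_2, (h.D3D2f1 w).symm ▸ W.zero_mem]
    · change D a (D 1 (f 3)) ∈ W
      fin_cases a
      exacts [g_0, g_1, w.comm 1 2 (f 3) ▸ D12f3.symm ▸ W.zero_mem,
        w.comm 1 3 (f 3) ▸ h.h33.symm ▸ m12]
    · change D a (D 2 (f 3)) ∈ W
      fin_cases a
      exacts [h_0, D12f3.symm ▸ W.zero_mem, h_2, w.comm 2 3 (f 3) ▸ h.h33.symm ▸ m13]
    · change D a (D 0 (D 0 (f 0))) ∈ W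
      fin_cases a
      exacts [ψ00, w.comm 0 1 (D 0 (f 0)) ▸ ψ01, w.comm 0 2 (D 0 (f 0)) ▸ ψ02,
        w.comm 0 3 (D 0 (f 0)) ▸ ψ03]
    · change D a (D 1 (D 0 (f 0))) ∈ W
      fin_cases a
      exacts [ψ01, ψ11, w.comm 1 2 (D 0 (f 0)) ▸ ψ12.symm ▸ W.zero_mem, ψ31]
    · change D a (D 2 (D 0 (f 0))) ∈ W
      fin_cases a
      exacts [ψ02, ψ12.symm ▸ W.zero_mem, ψ22, ψ32]
    · change D a (D 3 (D 0 (f 0))) ∈ W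
      fin_cases a
      exacts [ψ03, w.comm 3 1 (D 0 (f 0)) ▸ ψ31, w.comm 3 2 (D 0 (f 0)) ▸ ψ32,
        (h.D3D3ψ w).symm ▸ ψ00]
  exact key a i

end Jets

/-! ### Uniqueness for closed linear systems of partial differential equations -/

namespace SmoothAlg

variable {U : TopologicalSpace.Opens Pt} {ι : Type*} [Fintype ι]

/-- Restricted to the segment from `p₀` to `p`, which convexity keeps in `U`, the functions solve a
linear ODE with continuous, hence bounded, coefficients and zero initial value; Grönwall's
inequality finishes. -/
lemma eq_zero_of_closed_system (hU : Convex ℝ (U : Set Pt)) (w : ι → SmoothAlg U)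
    (hw : ∀ a i, D a (w i) ∈ Ideal.span (Set.range w)) {p₀ : Pt} (hp₀ : p₀ ∈ U)
    (h0 : ∀ i, rep (w i) p₀ = 0) (i : ι) : w i = 0 := by
  classical
  have hM : ∀ a i, ∃ M : ι → SmoothAlg U, ∑ j, M j * w j = D a (w i) := fun a i =>
    Ideal.mem_span_range_iff_exists_fun.1 (hw a i)
  choose M hM using hM
  refine ext_rep fun p hp => ?_
  rw [rep_zero]
  set γ : ℝ → Pt := fun t => AffineMap.lineMap p₀ p t with hγ
  have hγU : ∀ t ∈ Set.Icc (0 : ℝ) 1, γ t ∈ U := fun t ht =>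
    hU.lineMap_mem hp₀ hp ht
  have hγd : ∀ t, HasDerivAt γ (p - p₀) t := fun t => AffineMap.hasDerivAt_lineMap
  have hγc : Continuous γ := AffineMap.lineMap_continuous
  set y : ℝ → ι → ℝ := fun t i => rep (w i) (γ t) with hy
  set N : ℝ → ι → ι → ℝ := fun t i j => ∑ a, (p - p₀) a * rep (M a i j) (γ t) with hN
  have hyd : ∀ t ∈ Set.Icc (0 : ℝ) 1, HasDerivAt y (fun i => ∑ j, N t i j * y t j) t := by
    intro t ht
    rw [hasDerivAt_pi]
    intro i
    have h1 := HasFDerivAt.comp_hasDerivAt t (hasGrad (w i) (hγU t ht)) (hγd t)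
    refine h1.congr_deriv ?_
    simp only [sum_apply, smul_apply, ContinuousLinearMap.proj_apply, smul_eq_mul, hN, hy]
    simp only [← rep_D _ _ (hγU t ht), ← hM, rep_sum, rep_mul, Finset.sum_mul]
    rw [Finset.sum_comm]
    refine Finset.sum_congr rfl fun a _ => Finset.sum_congr rfl fun j _ => by ring
  have hNc : ∀ i j, ContinuousOn (fun t => N t i j) (Set.Icc 0 1) := by
    intro i j
    refine continuousOn_finsetSum _ fun a _ => continuousOn_const.mul ?_
    exact (contDiffOn_rep (M a i j)).continuousOn.comp hγc.continuousOn hγU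
  have hb : ∀ i j, ∃ C, ∀ t ∈ Set.Icc (0 : ℝ) 1, ‖N t i j‖ ≤ C := fun i j =>
    isCompact_Icc.exists_bound_of_continuousOn (hNc i j)
  choose C hC using hb
  have hC0 : ∀ i j, 0 ≤ C i j := fun i j =>
    (norm_nonneg _).trans (hC i j 0 ⟨le_rfl, zero_le_one⟩)
  have hbound : ∀ t ∈ Set.Ico (0 : ℝ) 1,
      ‖(fun i => ∑ j, N t i j * y t j)‖ ≤ (∑ i, ∑ j, C i j) * ‖y t‖ := by
    intro t ht
    rw [pi_norm_le_iff_of_nonneg (mul_nonneg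
      (Finset.sum_nonneg fun i _ => Finset.sum_nonneg fun j _ => hC0 i j) (norm_nonneg _))]
    intro i
    calc ‖∑ j, N t i j * y t j‖ ≤ ∑ j, C i j * ‖y t‖ := by
          refine norm_sum_le_of_le _ fun j _ => ?_
          rw [norm_mul]
          exact mul_le_mul (hC i j t ⟨ht.1, ht.2.le⟩) (norm_le_pi_norm _ j) (norm_nonneg _)
            (hC0 i j)
      _ = (∑ j, C i j) * ‖y t‖ := by rw [Finset.sum_mul]
      _ ≤ _ := by
          refine mul_le_mul_of_nonneg_right ?_ (norm_nonneg _)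
          exact Finset.single_le_sum (f := fun i => ∑ j, C i j)
            (fun i _ => Finset.sum_nonneg fun j _ => hC0 i j) (Finset.mem_univ i)
  have hy0 : y 0 = 0 := by
    ext i
    simp [hy, hγ, h0]
  have := eq_zero_of_abs_deriv_le_mul_abs_self_of_eq_zero_right
    (fun t ht => (hyd t ht).continuousAt.continuousWithinAt)
    (fun t ht => (hyd t ⟨ht.1, ht.2.le⟩).hasDerivWithinAt) hy0 hbound 1 ⟨zero_le_one, le_rfl⟩
  have := congrFun this i
  simpa [hy, hγ] using this

end SmoothAlg

/-! ### The space of conformal Killing fields has dimension at most fifteen -/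

section Dimension

variable {R : Type*} [CommRing R] [Algebra ℝ R]

lemma jet_add (D : Fin 4 → Derivation ℝ R R) (f g : Fin 4 → R) :
    jet D (f + g) = jet D f + jet D g := by
  ext i
  fin_cases i <;> simp [jet]

lemma jet_smul (D : Fin 4 → Derivation ℝ R R) (t : ℝ) (f : Fin 4 → R) :
    jet D (t • f) = t • jet D f := by
  ext i
  fin_cases i <;> simp [jet]

/-- The solutions of the conformal Killing equations. -/
def ckvSubmodule (D : Fin 4 → Derivation ℝ R R) (s p c r : R) : Submodule ℝ (Fin 4 → R) where
  carrier := {f | CKVSystem D s p c r f}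
  add_mem' {f g} hf hg := by
    constructor <;> simp only [Pi.add_apply, map_add]
    exacts [by linear_combination hf.h11 + hg.h11, by linear_combination hf.h22 + hg.h22,
      by linear_combination hf.h33 + hg.h33, by linear_combination hf.h01 + hg.h01,
      by linear_combination hf.h02 + hg.h02, by linear_combination hf.h03 + hg.h03,
      by linear_combination hf.h12 + hg.h12, by linear_combination hf.h13 + hg.h13,
      by linear_combination hf.h23 + hg.h23]
  zero_mem' := by constructor <;> simp
  smul_mem' t f hf := by
    constructor <;> simp only [Pi.smul_apply, Derivation.map_smul] <;>
      simp only [Algebra.smul_def]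
    exacts [by linear_combination algebraMap ℝ R t * hf.h11,
      by linear_combination algebraMap ℝ R t * hf.h22,
      by linear_combination algebraMap ℝ R t * hf.h33,
      by linear_combination algebraMap ℝ R t * hf.h01,
      by linear_combination algebraMap ℝ R t * hf.h02,
      by linear_combination algebraMap ℝ R t * hf.h03,
      by linear_combination algebraMap ℝ R t * hf.h12,
      by linear_combination algebraMap ℝ R t * hf.h13,
      by linear_combination algebraMap ℝ R t * hf.h23]

/-- Dimension count: the evaluated jet embeds the solutions into a 15-dimensional space, so 15
independent solutions span. For smooth functions `ev` will be evaluation at a point. -/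
lemma exists_eq_sum_of_jet {D : Fin 4 → Derivation ℝ R R} {s p c r : R} (ev : R →ₗ[ℝ] ℝ)
    (hev : ∀ f, CKVSystem D s p c r f → (∀ i, ev (jet D f i) = 0) → f = 0)
    {ι : Type*} [Fintype ι] (hι : Fintype.card ι = 15) (X : ι → Fin 4 → R)
    (hX : ∀ i, CKVSystem D s p c r (X i)) (hli : LinearIndependent ℝ X) {f : Fin 4 → R}
    (hf : CKVSystem D s p c r f) : ∃ t : ι → ℝ, f = ∑ i, t i • X i := by
  let L : ckvSubmodule D s p c r →ₗ[ℝ] (Fin 15 → ℝ) :=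
    { toFun := fun f i => ev (jet D f.1 i)
      map_add' := fun f g => by
        ext i
        rw [Submodule.coe_add, jet_add, Pi.add_apply, map_add, Pi.add_apply]
      map_smul' := fun t f => by
        ext i
        rw [Submodule.coe_smul, jet_smul, Pi.smul_apply, map_smul, Pi.smul_apply,
          RingHom.id_apply] }
  have hL : Function.Injective L := by
    rw [injective_iff_map_eq_zero]
    exact fun f h0 => Subtype.ext (hev f.1 f.2 (fun i => congrFun h0 i))
  have := FiniteDimensional.of_injective _ hL
  let Y : ι → ckvSubmodule D s p c r := fun i => ⟨X i, hX i⟩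
  have hY : LinearIndependent ℝ Y := LinearIndependent.of_comp (Submodule.subtype _) hli
  have h15 := LinearMap.finrank_le_finrank_of_injective hL
  rw [Module.finrank_fin_fun] at h15
  have hspan := hY.span_eq_top_of_card_eq_finrank'
    (le_antisymm hY.fintype_card_le_finrank (hι ▸ h15))
  have hmem : (⟨f, hf⟩ : ckvSubmodule D s p c r) ∈
    Submodule.span ℝ (Set.range Y) := hspan ▸ Submodule.mem_top
  obtain ⟨t, ht⟩ := (Submodule.mem_span_range_iff_exists_fun ℝ).1 hmem
  refine ⟨t, ?_⟩
  have := congrArg (Submodule.subtype _) ht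
  rw [map_sum] at this
  exact this.symm

end Dimension

variable {U : TopologicalSpace.Opens Pt}

open SmoothAlg in
lemma CKVSystem.exists_eq_sum {s p c r κ : SmoothAlg U} (w : WarpFrame D s p c r κ)
    (hU : Convex ℝ (U : Set Pt)) (hne : (U : Set Pt).Nonempty) {ι : Type*} [Fintype ι]
    (hι : Fintype.card ι = 15) (X : ι → Fin 4 → SmoothAlg U) (hX : ∀ i, CKVSystem D s p c r (X i))
    (hli : LinearIndependent ℝ X) {f : Fin 4 → SmoothAlg U} (hf : CKVSystem D s p c r f) :
    ∃ t : ι → ℝ, f = ∑ i, t i • X i := by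
  obtain ⟨p₀, hp₀⟩ := hne
  refine exists_eq_sum_of_jet
    { toFun := fun f => rep f p₀
      map_add' := fun f g => rep_add f g p₀
      map_smul' := fun t f => rep_smul t f p₀ } (fun f hf h0 => ?_) hι X hX hli hf
  have := eq_zero_of_closed_system hU (jet D f) (hf.D_jet_mem w) hp₀ h0
  ext i : 1
  fin_cases i
  exacts [this 0, this 1, this 2, this 3]

lemma isOpen_slab {J : Set ℝ} (hJ : IsOpen J) : IsOpen (slab J) :=
  hJ.preimage (continuous_apply 0)

lemma convex_slab {J : Set ℝ} (hJ : IsConnected J) : Convex ℝ (slab J) :=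
  hJ.isPreconnected.ordConnected.convex.linear_preimage
    (LinearMap.proj (R := ℝ) (φ := fun _ : Fin 4 => ℝ) 0)

lemma nonempty_slab {J : Set ℝ} (hJ : IsConnected J) : (slab J).Nonempty := by
  obtain ⟨t, ht⟩ := hJ.nonempty
  exact ⟨fun _ => t, ht⟩

lemma lieMetric_diagonal (d : Pt → Fin 4 → ℝ) (ξ : Pt → Pt) (p : Pt) (a b : Fin 4) :
    lieMetric ξ (fun p => Matrix.diagonal (d p)) p a b =
      (if a = b then ∑ c, ξ p c * pd c (fun q => d q a) p else 0)
        + d p b * pd a (fun q => ξ q b) p + d p a * pd b (fun q => ξ q a) p := by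
  simp only [lieMetric, Finset.sum_add_distrib, Matrix.diagonal_apply, ite_mul, zero_mul,
    Finset.sum_ite_eq, Finset.sum_ite_eq', Finset.mem_univ, if_true]
  congr 2
  by_cases h : a = b
  · simp [h]
  · simp only [h, if_false]
    exact Finset.sum_eq_zero fun c _ => by rw [(HasGrad.const 0).pd]; simp

/-! ### The trigonometric functions of the two families and the conformal Killing equations in
components -/

namespace Family

variable (F : Family) (a : ℝ)

lemma sgn_mul_self : F.sgn * F.sgn = 1 := by cases F <;> simp [sgn]

lemma hasDerivAt_cMP (w : ℝ) : HasDerivAt (fun w => F.cMP w a) (-(F.sgn * F.sMP w a / a)) w := by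
  have h : HasDerivAt (fun w : ℝ => w / a) (1 / a) w := (hasDerivAt_id w).div_const a
  cases F
  · exact h.cos.congr_deriv (by simp only [sgn, sMP]; ring)
  · exact h.cosh.congr_deriv (by simp only [sgn, sMP]; ring)

lemma hasDerivAt_sMP (w : ℝ) : HasDerivAt (fun w => F.sMP w a) (F.cMP w a / a) w := by
  have h : HasDerivAt (fun w : ℝ => w / a) (1 / a) w := (hasDerivAt_id w).div_const a
  cases F
  · exact h.sin.congr_deriv (by simp only [cMP]; ring)
  · exact h.sinh.congr_deriv (by simp only [cMP]; ring)

lemma hasDerivAt_cPM (w : ℝ) : HasDerivAt (fun w => F.cPM w a) (F.sgn * F.sPM w a / a) w := by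
  have h : HasDerivAt (fun w : ℝ => w / a) (1 / a) w := (hasDerivAt_id w).div_const a
  cases F
  · exact h.cosh.congr_deriv (by simp only [sgn, sPM]; ring)
  · exact h.cos.congr_deriv (by simp only [sgn, sPM]; ring)

lemma hasDerivAt_sPM (w : ℝ) : HasDerivAt (fun w => F.sPM w a) (F.cPM w a / a) w := by
  have h : HasDerivAt (fun w : ℝ => w / a) (1 / a) w := (hasDerivAt_id w).div_const a
  cases F
  · exact h.sinh.congr_deriv (by simp only [cPM]; ring)
  · exact h.sin.congr_deriv (by simp only [cPM]; ring)

lemma sq_MP (w : ℝ) : F.cMP w a ^ 2 + F.sgn * F.sMP w a ^ 2 = 1 := by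
  cases F
  · simp only [cMP, sMP, sgn]; linarith [Real.sin_sq_add_cos_sq (w / a)]
  · simp only [cMP, sMP, sgn]; linarith [Real.cosh_sq (w / a)]

lemma sq_PM (w : ℝ) : F.cPM w a ^ 2 - F.sgn * F.sPM w a ^ 2 = 1 := by
  cases F
  · simp only [cPM, sPM, sgn]; linarith [Real.cosh_sq (w / a)]
  · simp only [cPM, sPM, sgn]; linarith [Real.sin_sq_add_cos_sq (w / a)]

@[fun_prop]
lemma contDiff_cMP : ContDiff ℝ ∞ (fun w => F.cMP w a) := by
  cases F <;> simp only [cMP]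
  · exact Real.contDiff_cos.comp (contDiff_id.div_const a)
  · exact Real.contDiff_cosh.comp (contDiff_id.div_const a)

@[fun_prop]
lemma contDiff_sMP : ContDiff ℝ ∞ (fun w => F.sMP w a) := by
  cases F <;> simp only [sMP]
  · exact Real.contDiff_sin.comp (contDiff_id.div_const a)
  · exact Real.contDiff_sinh.comp (contDiff_id.div_const a)

@[fun_prop]
lemma contDiff_cPM : ContDiff ℝ ∞ (fun w => F.cPM w a) := by
  cases F <;> simp only [cPM]
  · exact Real.contDiff_cosh.comp (contDiff_id.div_const a)
  · exact Real.contDiff_cos.comp (contDiff_id.div_const a)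

@[fun_prop]
lemma contDiff_sPM : ContDiff ℝ ∞ (fun w => F.sPM w a) := by
  cases F <;> simp only [sPM]
  · exact Real.contDiff_sinh.comp (contDiff_id.div_const a)
  · exact Real.contDiff_sin.comp (contDiff_id.div_const a)

/-- The conformal Killing equations of `F.metric a` at a point, in components. -/
structure CKVAt (ξ : Pt → Pt) (ψ : ℝ) (p : Pt) : Prop where
  h00 : pd 0 (fun q => ξ q 0) p = ψ
  h11 : F.sMP (p 0) a * pd 1 (fun q => ξ q 1) p = F.sMP (p 0) a * ψ - F.cMP (p 0) a / a * ξ p 0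
  h22 : F.cMP (p 0) a * pd 2 (fun q => ξ q 2) p =
    F.cMP (p 0) a * ψ + F.sgn * F.sMP (p 0) a / a * ξ p 0
  h33 : pd 3 (fun q => ξ q 3) p = ψ
  h01 : pd 1 (fun q => ξ q 0) p = F.sMP (p 0) a * F.sMP (p 0) a * pd 0 (fun q => ξ q 1) p
  h02 : pd 2 (fun q => ξ q 0) p = F.cMP (p 0) a * F.cMP (p 0) a * pd 0 (fun q => ξ q 2) p
  h03 : pd 3 (fun q => ξ q 0) p = pd 0 (fun q => ξ q 3) p
  h12 : F.sMP (p 0) a * F.sMP (p 0) a * pd 2 (fun q => ξ q 1) p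
    + F.cMP (p 0) a * F.cMP (p 0) a * pd 1 (fun q => ξ q 2) p = 0
  h13 : F.sMP (p 0) a * F.sMP (p 0) a * pd 3 (fun q => ξ q 1) p + pd 1 (fun q => ξ q 3) p = 0
  h23 : F.cMP (p 0) a * F.cMP (p 0) a * pd 3 (fun q => ξ q 2) p + pd 2 (fun q => ξ q 3) p = 0

variable {F a}

lemma lieMetric_metric (ξ : Pt → Pt) (p : Pt) (i j : Fin 4) :
    lieMetric ξ (F.metric a) p i j =
      (if i = j then ![0, 2 * F.sMP (p 0) a * (F.cMP (p 0) a / a) * ξ p 0,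
        -(2 * F.cMP (p 0) a * (F.sgn * F.sMP (p 0) a / a) * ξ p 0), 0] i else 0)
      + ![-1, F.sMP (p 0) a ^ 2, F.cMP (p 0) a ^ 2, 1] j * pd i (fun q => ξ q j) p
      + ![-1, F.sMP (p 0) a ^ 2, F.cMP (p 0) a ^ 2, 1] i * pd j (fun q => ξ q i) p := by
  unfold metric
  rw [lieMetric_diagonal]
  congr 3
  have hs : HasGrad (fun q => F.sMP (q 0) a ^ 2)
      (Pi.single 0 (2 * F.sMP (p 0) a * (F.cMP (p 0) a / a))) p :=
    HasGrad.coord (u := fun w => F.sMP w a ^ 2) 0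
      (((F.hasDerivAt_sMP a (p 0)).pow 2).congr_deriv (by simp))
  have hc : HasGrad (fun q => F.cMP (q 0) a ^ 2)
      (Pi.single 0 (-(2 * F.cMP (p 0) a * (F.sgn * F.sMP (p 0) a / a)))) p :=
    HasGrad.coord (u := fun w => F.cMP w a ^ 2) 0
      (((F.hasDerivAt_cMP a (p 0)).pow 2).congr_deriv (by simp))
  fin_cases i
  · simp [(HasGrad.const (p := p) (-1)).pd]
  · simp [hs.pd, Fin.sum_univ_four]; ring
  · simp [hc.pd, Fin.sum_univ_four]; ring
  · simp [(HasGrad.const (p := p) 1).pd]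

lemma lieMetric_metric_eq_iff {ξ : Pt → Pt} {ψ : ℝ} {p : Pt} (hs : F.sMP (p 0) a ≠ 0)
    (hc : F.cMP (p 0) a ≠ 0) :
    (∀ i j, lieMetric ξ (F.metric a) p i j = 2 * ψ * F.metric a p i j) ↔ CKVAt F a ξ ψ p := by
  simp only [lieMetric_metric]
  constructor
  · intro h
    have h00 := h 0 0
    have h11 := h 1 1
    have h22 := h 2 2
    have h33 := h 3 3
    have h01 := h 0 1
    have h02 := h 0 2
    have h03 := h 0 3
    have h12 := h 1 2
    have h13 := h 1 3
    have h23 := h 2 3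
    simp [metric] at h00 h11 h22 h33 h01 h02 h03 h12 h13 h23
    refine ⟨by linarith, ?_, ?_, by linarith, by linarith, by linarith, by linarith,
      by linarith, by linarith, by linarith⟩
    · exact mul_left_cancel₀ hs (by linear_combination h11 / 2)
    · exact mul_left_cancel₀ hc (by linear_combination h22 / 2)
  · rintro ⟨h00, h11, h22, h33, h01, h02, h03, h12, h13, h23⟩ i j
    fin_cases i <;> fin_cases j <;> simp [metric]
    · linear_combination -2 * h00
    · linear_combination -h01
    · linear_combination -h02
    · linear_combination -h03
    · linear_combination -h01
    · linear_combination 2 * F.sMP (p 0) a * h11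
    · linear_combination h12
    · linear_combination h13
    · linear_combination -h02
    · linear_combination h12
    · linear_combination 2 * F.cMP (p 0) a * h22
    · linear_combination h23
    · linear_combination -h03
    · linear_combination h13
    · linear_combination h23
    · linear_combination 2 * h33

end Family

/-! ### The fifteen fields in common form -/

/-- `u` and `v` are, up to the factor `a`, derivatives of each other, up to the sign `μ`. -/
structure OscPair (μ a : ℝ) (u v : ℝ → ℝ) : Prop where
  du : ∀ w, HasDerivAt u (v w / a) w
  dv : ∀ w, HasDerivAt v (μ * u w / a) w

namespace OscPair

variable {μ a : ℝ} {u v : ℝ → ℝ}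

lemma symm (h : OscPair μ a u v) : OscPair μ a v (fun w => μ * u w) :=
  ⟨h.dv, fun w => ((h.du w).const_mul μ).congr_deriv (by ring)⟩

/-- Bootstrapping: each function is, up to a constant, the derivative of the other, so both gain one
order of smoothness at a time. -/
lemma contDiff (h : OscPair μ a u v) : ContDiff ℝ ∞ u ∧ ContDiff ℝ ∞ v := by
  have key : ∀ n : ℕ, ContDiff ℝ n u ∧ ContDiff ℝ n v := by
    intro n
    induction n with
    | zero =>
      exact ⟨contDiff_zero.2 (continuous_iff_continuousAt.2 fun w => (h.du w).continuousAt),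
        contDiff_zero.2 (continuous_iff_continuousAt.2 fun w => (h.dv w).continuousAt)⟩
    | succ n ih =>
      constructor
      · refine (contDiff_succ_iff_deriv (n := n)).2 ⟨fun w => (h.du w).differentiableAt, by simp, ?_⟩
        rw [show deriv u = fun w => v w / a from funext fun w => (h.du w).deriv]
        exact ih.2.div_const a
      · refine (contDiff_succ_iff_deriv (n := n)).2 ⟨fun w => (h.dv w).differentiableAt, by simp, ?_⟩
        rw [show deriv v = fun w => μ * u w / a from funext fun w => (h.dv w).deriv]
        exact (contDiff_const.mul ih.1).div_const a
  exact ⟨contDiff_infty.2 fun n => (key n).1, contDiff_infty.2 fun n => (key n).2⟩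

end OscPair

lemma oscPair_cosh (a : ℝ) :
    OscPair 1 a (fun w => Real.cosh (w / a)) (fun w => Real.sinh (w / a)) where
  du w := by simpa [Family.cPM, Family.sPM, Family.sgn] using Family.RT.hasDerivAt_cPM a w
  dv w := by simpa [Family.cPM, Family.sPM] using Family.RT.hasDerivAt_sPM a w

lemma oscPair_sinh (a : ℝ) :
    OscPair 1 a (fun w => Real.sinh (w / a)) (fun w => Real.cosh (w / a)) := by
  simpa using (oscPair_cosh a).symm

namespace Family

variable (F : Family) {a : ℝ}

lemma oscPair_sPM (a : ℝ) : OscPair F.sgn a (fun w => F.sPM w a) (fun w => F.cPM w a) :=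
  ⟨F.hasDerivAt_sPM a, F.hasDerivAt_cPM a⟩

lemma oscPair_cPM (a : ℝ) : OscPair F.sgn a (fun w => F.cPM w a) (fun w => F.sgn * F.sPM w a) :=
  (F.oscPair_sPM a).symm

lemma oscPair_sMP (a : ℝ) : OscPair (-F.sgn) a (fun w => F.sMP w a) (fun w => F.cMP w a) :=
  ⟨F.hasDerivAt_sMP a, fun w => (F.hasDerivAt_cMP a w).congr_deriv (by ring)⟩

lemma oscPair_cMP (a : ℝ) :
    OscPair (-F.sgn) a (fun w => F.cMP w a) (fun w => -F.sgn * F.sMP w a) :=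
  (F.oscPair_sMP a).symm

/-- The common form of the additional Killing vectors. -/
def killingField (F : Family) (a : ℝ) (X X' Y Y' : ℝ → ℝ) : Pt → Pt := fun p =>
  ![Y (p 2) * X (p 1), -(F.cMP (p 0) a / F.sMP (p 0) a) * (Y (p 2) * X' (p 1)),
    (F.sMP (p 0) a / F.cMP (p 0) a) * (Y' (p 2) * X (p 1)), 0]

/-- The common form of the conformal Killing vectors built from the functions `B_k`. -/
def bField (F : Family) (a : ℝ) (Y Y' Z Z' : ℝ → ℝ) : Pt → Pt := fun p =>
  ![a * F.sMP (p 0) a * (Y (p 2) * Z (p 3)), 0,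
    F.sgn * a / F.cMP (p 0) a * (Y' (p 2) * Z (p 3)),
    -(F.sgn * a) * F.cMP (p 0) a * (Y (p 2) * Z' (p 3))]

/-- The common form of the conformal Killing vectors built from the functions `Γ_k`. -/
def gField (F : Family) (a : ℝ) (X X' Z Z' : ℝ → ℝ) : Pt → Pt := fun p =>
  ![-(F.sgn * a) * F.cMP (p 0) a * (X (p 1) * Z (p 3)),
    F.sgn * a / F.sMP (p 0) a * (X' (p 1) * Z (p 3)), 0,
    -(F.sgn * a) * F.sMP (p 0) a * (X (p 1) * Z' (p 3))]

variable {F} {X X' Y Y' Z Z' : ℝ → ℝ} {p : Pt}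

lemma hasGrad_product {T U V : ℝ → ℝ} {T' U' V' : ℝ} (i j : Fin 4) (hT : HasDerivAt T T' (p 0))
    (hU : HasDerivAt U U' (p i)) (hV : HasDerivAt V V' (p j)) :
    HasGrad (fun q => T (q 0) * (U (q i) * V (q j))) (fun k =>
      (Pi.single 0 T' : Fin 4 → ℝ) k * (U (p i) * V (p j)) + T (p 0) *
        ((Pi.single i U' : Fin 4 → ℝ) k * V (p j) + U (p i) * (Pi.single j V' : Fin 4 → ℝ) k)) p :=
  (HasGrad.coord 0 hT).mul ((HasGrad.coord i hU).mul (HasGrad.coord j hV))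

/-- Only the oscillator relations of `X` and `Y` and the identity `c² ± s² = 1` matter, so one
computation serves all four fields and both signs. The same applies to the `B_k` and `Γ_k` below. -/
lemma ckvAt_killingField (hX : OscPair 1 a X X') (hY : OscPair F.sgn a Y Y')
    (hs : F.sMP (p 0) a ≠ 0) (hc : F.cMP (p 0) a ≠ 0) (ha : a ≠ 0) :
    CKVAt F a (F.killingField a X X' Y Y') 0 p := by
  have h1 := F.sq_MP a (p 0)
  have ds := F.hasDerivAt_sMP a (p 0)
  have dc := F.hasDerivAt_cMP a (p 0)
  have g0 : HasGrad (fun q => F.killingField a X X' Y Y' q 0) _ p :=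
    (HasGrad.coord 2 (hY.du _)).mul (HasGrad.coord 1 (hX.du _))
  have g1 : HasGrad (fun q => F.killingField a X X' Y Y' q 1) _ p :=
    hasGrad_product 2 1 (dc.div ds hs).neg (hY.du _) (hX.dv _)
  have g2 : HasGrad (fun q => F.killingField a X X' Y Y' q 2) _ p :=
    hasGrad_product 2 1 (ds.div dc hc) (hY.dv _) (hX.du _)
  have g3 : HasGrad (fun q => F.killingField a X X' Y Y' q 3) _ p := HasGrad.const 0
  constructor <;> simp only [g0.pd, g1.pd, g2.pd, g3.pd] <;> simp [killingField] <;>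
    clear g0 g1 g2 g3 ds dc <;> field_simp <;> grind

lemma ckvAt_bField (hY : OscPair F.sgn a Y Y') (hZ : OscPair (-F.sgn) a Z Z')
    (hs : F.sMP (p 0) a ≠ 0) (hc : F.cMP (p 0) a ≠ 0) (ha : a ≠ 0) :
    CKVAt F a (F.bField a Y Y' Z Z') (F.cMP (p 0) a * (Y (p 2) * Z (p 3))) p := by
  have h1 := F.sq_MP a (p 0)
  have h2 := F.sgn_mul_self
  have ds := F.hasDerivAt_sMP a (p 0)
  have dc := F.hasDerivAt_cMP a (p 0)
  have g0 : HasGrad (fun q => F.bField a Y Y' Z Z' q 0) _ p :=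
    hasGrad_product 2 3 (ds.const_mul a) (hY.du _) (hZ.du _)
  have g1 : HasGrad (fun q => F.bField a Y Y' Z Z' q 1) _ p := HasGrad.const 0
  have g2 : HasGrad (fun q => F.bField a Y Y' Z Z' q 2) _ p :=
    hasGrad_product 2 3 (dc.fun_inv hc |>.const_mul (F.sgn * a)) (hY.dv _) (hZ.du _)
  have g3 : HasGrad (fun q => F.bField a Y Y' Z Z' q 3) _ p :=
    hasGrad_product 2 3 (dc.const_mul (-(F.sgn * a))) (hY.du _) (hZ.dv _)
  constructor <;> simp only [g0.pd, g1.pd, g2.pd, g3.pd] <;> simp [bField] <;>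
    clear g0 g1 g2 g3 ds dc <;> field_simp <;> grind

lemma ckvAt_gField (hX : OscPair 1 a X X') (hZ : OscPair (-F.sgn) a Z Z')
    (hs : F.sMP (p 0) a ≠ 0) (hc : F.cMP (p 0) a ≠ 0) (ha : a ≠ 0) :
    CKVAt F a (F.gField a X X' Z Z') (F.sMP (p 0) a * (X (p 1) * Z (p 3))) p := by
  have h1 := F.sq_MP a (p 0)
  have h2 := F.sgn_mul_self
  have ds := F.hasDerivAt_sMP a (p 0)
  have dc := F.hasDerivAt_cMP a (p 0)
  have g0 : HasGrad (fun q => F.gField a X X' Z Z' q 0) _ p :=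
    hasGrad_product 1 3 (dc.const_mul (-(F.sgn * a))) (hX.du _) (hZ.du _)
  have g1 : HasGrad (fun q => F.gField a X X' Z Z' q 1) _ p :=
    hasGrad_product 1 3 (ds.fun_inv hs |>.const_mul (F.sgn * a)) (hX.dv _) (hZ.du _)
  have g2 : HasGrad (fun q => F.gField a X X' Z Z' q 2) _ p := HasGrad.const 0
  have g3 : HasGrad (fun q => F.gField a X X' Z Z' q 3) _ p :=
    hasGrad_product 1 3 (ds.const_mul (-(F.sgn * a))) (hX.du _) (hZ.dv _)
  constructor <;> simp only [g0.pd, g1.pd, g2.pd, g3.pd] <;> simp [gField] <;>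
    clear g0 g1 g2 g3 ds dc <;> field_simp <;> grind

end Family

lemma contDiff_comp_coord {u : ℝ → ℝ} (hu : ContDiff ℝ ∞ u) (i : Fin 4) (U : Set Pt) :
    ContDiffOn ℝ ∞ (fun p : Pt => u (p i)) U :=
  (hu.comp (contDiff_apply ℝ ℝ i)).contDiffOn

lemma contDiffOn_comp_time {u : ℝ → ℝ} {J : Set ℝ} (hu : ContDiffOn ℝ ∞ u J) :
    ContDiffOn ℝ ∞ (fun p : Pt => u (p 0)) (slab J) :=
  hu.comp (contDiff_apply ℝ ℝ (0 : Fin 4)).contDiffOn fun _ hp => hp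

namespace Family

variable {F : Family} {a : ℝ} {X X' Y Y' Z Z' : ℝ → ℝ} {J : Set ℝ}

lemma contDiffOn_killingField (hX : OscPair 1 a X X') (hY : OscPair F.sgn a Y Y')
    (hJ : ∀ s ∈ J, F.sMP s a ≠ 0 ∧ F.cMP s a ≠ 0) :
    ContDiffOn ℝ ∞ (F.killingField a X X' Y Y') (slab J) := by
  have s := contDiff_comp_coord (F.contDiff_sMP a) 0 (slab J)
  have c := contDiff_comp_coord (F.contDiff_cMP a) 0 (slab J)
  rw [contDiffOn_pi]
  intro i
  fin_cases i
  · exact (contDiff_comp_coord hY.contDiff.1 2 _).mul (contDiff_comp_coord hX.contDiff.1 1 _)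
  · exact (c.div s fun p hp => (hJ _ hp).1).neg.mul
      ((contDiff_comp_coord hY.contDiff.1 2 _).mul (contDiff_comp_coord hX.contDiff.2 1 _))
  · exact (s.div c fun p hp => (hJ _ hp).2).mul
      ((contDiff_comp_coord hY.contDiff.2 2 _).mul (contDiff_comp_coord hX.contDiff.1 1 _))
  · exact contDiffOn_const

lemma contDiffOn_bField (hY : OscPair F.sgn a Y Y') (hZ : OscPair (-F.sgn) a Z Z')
    (hJ : ∀ s ∈ J, F.sMP s a ≠ 0 ∧ F.cMP s a ≠ 0) :
    ContDiffOn ℝ ∞ (F.bField a Y Y' Z Z') (slab J) := by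
  have s := contDiff_comp_coord (F.contDiff_sMP a) 0 (slab J)
  have c := contDiff_comp_coord (F.contDiff_cMP a) 0 (slab J)
  rw [contDiffOn_pi]
  intro i
  fin_cases i
  · exact (contDiffOn_const.mul s).mul
      ((contDiff_comp_coord hY.contDiff.1 2 _).mul (contDiff_comp_coord hZ.contDiff.1 3 _))
  · exact contDiffOn_const
  · exact (contDiffOn_const.div c fun p hp => (hJ _ hp).2).mul
      ((contDiff_comp_coord hY.contDiff.2 2 _).mul (contDiff_comp_coord hZ.contDiff.1 3 _))
  · exact (contDiffOn_const.mul c).mul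
      ((contDiff_comp_coord hY.contDiff.1 2 _).mul (contDiff_comp_coord hZ.contDiff.2 3 _))

lemma contDiffOn_gField (hX : OscPair 1 a X X') (hZ : OscPair (-F.sgn) a Z Z')
    (hJ : ∀ s ∈ J, F.sMP s a ≠ 0 ∧ F.cMP s a ≠ 0) :
    ContDiffOn ℝ ∞ (F.gField a X X' Z Z') (slab J) := by
  have s := contDiff_comp_coord (F.contDiff_sMP a) 0 (slab J)
  have c := contDiff_comp_coord (F.contDiff_cMP a) 0 (slab J)
  rw [contDiffOn_pi]
  intro i
  fin_cases i
  · exact (contDiffOn_const.mul c).mul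
      ((contDiff_comp_coord hX.contDiff.1 1 _).mul (contDiff_comp_coord hZ.contDiff.1 3 _))
  · exact (contDiffOn_const.div s fun p hp => (hJ _ hp).1).mul
      ((contDiff_comp_coord hX.contDiff.2 1 _).mul (contDiff_comp_coord hZ.contDiff.1 3 _))
  · exact contDiffOn_const
  · exact (contDiffOn_const.mul s).mul
      ((contDiff_comp_coord hX.contDiff.1 1 _).mul (contDiff_comp_coord hZ.contDiff.2 3 _))

set_option linter.unnecessarySeqFocus false in
lemma gradField_eq_bField (hY : OscPair F.sgn a Y Y') (hZ : OscPair (-F.sgn) a Z Z')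
    (ha : a ≠ 0) :
    F.gradField a (fun p => F.cMP (p 0) a * (Y (p 2) * Z (p 3))) = F.bField a Y Y' Z Z' := by
  have h2 := F.sgn_mul_self
  ext p i
  have g := hasGrad_product (p := p) 2 3 (F.hasDerivAt_cMP a (p 0)) (hY.du (p 2)) (hZ.du (p 3))
  by_cases hc : F.cMP (p 0) a = 0
  -- Where the warping function vanishes, both sides agree because division by zero gives zero; the
  -- identity is thus one of functions on the whole space.
  · fin_cases i <;> simp [gradField, g.pd, bField, metric, hc] <;> field_simp <;> grind
  · fin_cases i <;> simp [gradField, g.pd, bField, metric] <;> field_simp <;> grind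

set_option linter.unnecessarySeqFocus false in
lemma gradField_eq_gField (hX : OscPair 1 a X X') (hZ : OscPair (-F.sgn) a Z Z')
    (ha : a ≠ 0) :
    F.gradField a (fun p => F.sMP (p 0) a * (X (p 1) * Z (p 3))) = F.gField a X X' Z Z' := by
  have h2 := F.sgn_mul_self
  ext p i
  have g := hasGrad_product (p := p) 1 3 (F.hasDerivAt_sMP a (p 0)) (hX.du (p 1)) (hZ.du (p 3))
  by_cases hs : F.sMP (p 0) a = 0
  · fin_cases i <;> simp [gradField, g.pd, gField, metric, hs] <;> field_simp
  · fin_cases i <;> simp [gradField, g.pd, gField, metric] <;> field_simp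

lemma extraKV_eq (F : Family) (a : ℝ) (k : Fin 4) : ∃ X X' Y Y' : ℝ → ℝ,
    OscPair 1 a X X' ∧ OscPair F.sgn a Y Y' ∧ F.extraKV a k = F.killingField a X X' Y Y' := by
  fin_cases k
  · refine ⟨_, _, _, _, oscPair_cosh a, F.oscPair_sPM a, ?_⟩
    ext p i; fin_cases i <;> simp [extraKV, killingField]
  · refine ⟨_, _, _, _, oscPair_sinh a, F.oscPair_sPM a, ?_⟩
    ext p i; fin_cases i <;> simp [extraKV, killingField]
  · refine ⟨_, _, _, _, oscPair_cosh a, F.oscPair_cPM a, ?_⟩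
    ext p i; fin_cases i <;> simp [extraKV, killingField, mul_assoc]
  · refine ⟨_, _, _, _, oscPair_sinh a, F.oscPair_cPM a, ?_⟩
    ext p i; fin_cases i <;> simp [extraKV, killingField, mul_assoc]

lemma Bfun_eq (F : Family) (a : ℝ) (k : Fin 4) : ∃ Y Y' Z Z' : ℝ → ℝ,
    OscPair F.sgn a Y Y' ∧ OscPair (-F.sgn) a Z Z' ∧
      F.Bfun a k = fun p => F.cMP (p 0) a * (Y (p 2) * Z (p 3)) := by
  fin_cases k
  · exact ⟨_, _, _, _, F.oscPair_cPM a, F.oscPair_sMP a, rfl⟩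
  · exact ⟨_, _, _, _, F.oscPair_cPM a, F.oscPair_cMP a, rfl⟩
  · exact ⟨_, _, _, _, F.oscPair_sPM a, F.oscPair_sMP a, rfl⟩
  · exact ⟨_, _, _, _, F.oscPair_sPM a, F.oscPair_cMP a, rfl⟩

lemma Gfun_eq (F : Family) (a : ℝ) (k : Fin 4) : ∃ X X' Z Z' : ℝ → ℝ,
    OscPair 1 a X X' ∧ OscPair (-F.sgn) a Z Z' ∧
      F.Gfun a k = fun p => F.sMP (p 0) a * (X (p 1) * Z (p 3)) := by
  fin_cases k
  · exact ⟨_, _, _, _, oscPair_cosh a, F.oscPair_sMP a, rfl⟩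
  · exact ⟨_, _, _, _, oscPair_cosh a, F.oscPair_cMP a, rfl⟩
  · exact ⟨_, _, _, _, oscPair_sinh a, F.oscPair_sMP a, rfl⟩
  · exact ⟨_, _, _, _, oscPair_sinh a, F.oscPair_cMP a, rfl⟩

lemma ckvAt_const (v : Fin 4 → ℝ) (hv : v 0 = 0) (p : Pt) : CKVAt F a (fun _ => v) 0 p := by
  have g : ∀ i, HasGrad (fun _ : Pt => v i) 0 p := fun i => HasGrad.const _
  constructor <;> simp only [(g _).pd] <;> simp [hv]

/-- The fifteen vector fields are conformal Killing vectors of the unscaled metric. -/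
theorem isCKVWith_ckv (ha : a ≠ 0) (hJ : ∀ s ∈ J, F.sMP s a ≠ 0 ∧ F.cMP s a ≠ 0) (i : Idx) :
    IsCKVWith (F.metric a) (slab J) (F.ckv a i) (F.factor a i) := by
  suffices h : ContDiffOn ℝ ∞ (F.ckv a i) (slab J) ∧
      ∀ p ∈ slab J, CKVAt F a (F.ckv a i) (F.factor a i p) p from
    ⟨h.1, fun p hp => (lieMetric_metric_eq_iff (hJ _ hp).1 (hJ _ hp).2).2 (h.2 p hp)⟩
  rcases i with μ | k | k | k
  · exact ⟨contDiffOn_const, fun p _ => ckvAt_const _ (by simp [(Fin.succ_ne_zero μ).symm]) p⟩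
  · obtain ⟨X, X', Y, Y', hX, hY, h⟩ := F.extraKV_eq a k
    simp only [ckv, factor, h]
    exact ⟨contDiffOn_killingField hX hY hJ, fun p hp =>
      ckvAt_killingField hX hY (hJ _ hp).1 (hJ _ hp).2 ha⟩
  · obtain ⟨Y, Y', Z, Z', hY, hZ, h⟩ := F.Bfun_eq a k
    simp only [ckv, factor, h, gradField_eq_bField hY hZ ha]
    exact ⟨contDiffOn_bField hY hZ hJ, fun p hp =>
      ckvAt_bField hY hZ (hJ _ hp).1 (hJ _ hp).2 ha⟩
  · obtain ⟨X, X', Z, Z', hX, hZ, h⟩ := F.Gfun_eq a k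
    simp only [ckv, factor, h, gradField_eq_gField hX hZ ha]
    exact ⟨contDiffOn_gField hX hZ hJ, fun p hp =>
      ckvAt_gField hX hZ (hJ _ hp).1 (hJ _ hp).2 ha⟩

/-! ### Conformal rescaling -/

lemma lieMetric_scaledMetric {B : ℝ → ℝ} (ξ : Pt → Pt) {p : Pt} {B' : ℝ}
    (hB : HasDerivAt B B' (p 0)) (i j : Fin 4) :
    lieMetric ξ (F.scaledMetric a B) p i j = B (p 0) ^ 2 * lieMetric ξ (F.metric a) p i j
      + 2 * B (p 0) * B' * ξ p 0 * F.metric a p i j := by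
  have hB2 : HasGrad (fun q => B (q 0) ^ 2) (Pi.single 0 (2 * B (p 0) * B')) p :=
    HasGrad.coord (u := fun w => B w ^ 2) 0 ((hB.pow 2).congr_deriv (by simp))
  have hg : HasGrad (fun q => F.metric a q i j) (fun c => pd c (fun q => F.metric a q i j) p) p := by
    apply hasGrad_of_differentiableAt
    have s : Differentiable ℝ fun q : Pt => F.sMP (q 0) a :=
      ((F.contDiff_sMP a).differentiable (by simp)).comp (differentiable_apply 0)
    have c : Differentiable ℝ fun q : Pt => F.cMP (q 0) a :=
      ((F.contDiff_cMP a).differentiable (by simp)).comp (differentiable_apply 0)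
    fin_cases i <;> fin_cases j <;> simp [metric]
    · exact (s p).pow 2
    · exact (c p).pow 2
  have e : (fun q => F.scaledMetric a B q i j) = fun q => B (q 0) ^ 2 * F.metric a q i j := by
    ext q; simp [scaledMetric]
  have hpd : ∀ c, pd c (fun q => F.scaledMetric a B q i j) p = (Pi.single 0 (2 * B (p 0) * B') :
      Fin 4 → ℝ) c * F.metric a p i j + B (p 0) ^ 2 * pd c (fun q => F.metric a q i j) p := by
    intro c
    rw [e, (hB2.mul hg).pd]
  simp only [lieMetric, hpd]
  simp only [scaledMetric, Matrix.smul_apply, smul_eq_mul, Fin.sum_univ_four, Pi.single_apply]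
  simp
  ring

/-- By the product rule `L_ξ(B²g) = B²(L_ξ g + 2 ξ(ln |B|) g)`, so rescaling keeps the conformal
Killing fields and shifts their factors. -/
lemma isCKVWith_scaledMetric_iff {B : ℝ → ℝ} (hJ : IsOpen J) (hB : ContDiffOn ℝ ∞ B J)
    (hB0 : ∀ s ∈ J, B s ≠ 0) (ξ : Pt → Pt) (ψ : Pt → ℝ) :
    IsCKVWith (F.scaledMetric a B) (slab J) ξ (fun p =>
      (∑ c, ξ p c * pd c (fun q => Real.log (B (q 0))) p) + ψ p) ↔
      IsCKVWith (F.metric a) (slab J) ξ ψ := by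
  refine and_congr_right fun _ => forall₂_congr fun p hp => forall₂_congr fun i j => ?_
  have h0 := hB0 _ hp
  have hd := (hB.differentiableAt_of_isOpen hJ hp).hasDerivAt
  have hl : HasGrad (fun q => Real.log (B (q 0))) _ p :=
    HasGrad.coord (u := fun w => Real.log (B w)) 0 (hd.log h0)
  rw [lieMetric_scaledMetric ξ hd]
  simp only [hl.pd, scaledMetric, Matrix.smul_apply, smul_eq_mul, Fin.sum_univ_four,
    Pi.single_apply]
  simp only [Fin.isValue, Fin.reduceEq, if_true, if_false, mul_zero, add_zero]
  have e : B (p 0) ^ 2 * lieMetric ξ (F.metric a) p i j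
      + 2 * B (p 0) * deriv B (p 0) * ξ p 0 * F.metric a p i j
      - 2 * (ξ p 0 * (deriv B (p 0) / B (p 0)) + ψ p) * (B (p 0) ^ 2 * F.metric a p i j)
      = B (p 0) ^ 2 * (lieMetric ξ (F.metric a) p i j - 2 * ψ p * F.metric a p i j) := by
    field_simp
    ring
  rw [← sub_eq_zero, e, mul_eq_zero, sub_eq_zero]
  simp [h0]

end Family

/-! ### Linear independence -/

/-- `C` and `S` behave like the (hyperbolic) cosine and sine at `0` and at `±w` for some `w`. -/
structure IsTrigPair (C S : ℝ → ℝ) : Prop where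
  C0 : C 0 = 1
  S0 : S 0 = 0
  exists_ne : ∃ w, C w ≠ 1 ∧ S w ≠ 0 ∧ C (-w) = C w ∧ S (-w) = -S w

/-- Independence of `C`, `S` and 1: the values at `w` and `-w` separate the even from the odd part,
and the value at `0` separates `C` from the constant. -/
lemma IsTrigPair.eq_zero {C S : ℝ → ℝ} (h : IsTrigPair C S) {A B d : ℝ}
    (hd : ∀ w, A * C w + B * S w = d) : A = 0 ∧ B = 0 ∧ d = 0 := by
  obtain ⟨w, hC, hS, hCw, hSw⟩ := h.exists_ne
  have h0 := hd 0
  have h1 := hd w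
  have h2 := hd (-w)
  rw [h.C0, h.S0] at h0
  rw [hCw, hSw] at h2
  have hA : A = 0 := by
    have : A * (C w - 1) = 0 := by linear_combination (h1 + h2) / 2 - h0
    simpa [sub_eq_zero, hC] using this
  have hB : B = 0 := by
    have : B * S w = 0 := by linear_combination (h1 - h2) / 2
    simpa [hS] using this
  exact ⟨hA, hB, by rw [← h0, hA, hB]; ring⟩

lemma isTrigPair_cosh {a : ℝ} (ha : a ≠ 0) :
    IsTrigPair (fun w => Real.cosh (w / a)) (fun w => Real.sinh (w / a)) :=
  ⟨by simp, by simp, a, (Real.one_lt_cosh.2 (by simp [ha])).ne', by simp [ha], by simp [neg_div],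
    by simp [neg_div]⟩

lemma isTrigPair_cos {a : ℝ} (ha : a ≠ 0) :
    IsTrigPair (fun w => Real.cos (w / a)) (fun w => Real.sin (w / a)) := by
  refine ⟨by simp, by simp, a, ?_, ?_, by simp [neg_div], by simp [neg_div]⟩ <;>
    simp only [div_self ha]
  · have := Real.cos_one_le
    intro h
    linarith
  · exact (Real.sin_pos_of_pos_of_le_one one_pos le_rfl).ne'

/-- Each product involves two of the three variables, so the variables can be peeled off one at a
time: first `z`, then `y`, then `x`, by independence in a single variable. -/
lemma eq_zero_of_trig_sum {C₁ S₁ C₂ S₂ C₃ S₃ : ℝ → ℝ} (h₁ : IsTrigPair C₁ S₁)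
    (h₂ : IsTrigPair C₂ S₂) (h₃ : IsTrigPair C₃ S₃) {α β γ : Fin 4 → ℝ} {d : ℝ}
    (h : ∀ x y z, ∑ k, α k * ![S₂ y * C₁ x, S₂ y * S₁ x, C₂ y * C₁ x, C₂ y * S₁ x] k
      + ∑ k, β k * ![C₂ y * S₃ z, C₂ y * C₃ z, S₂ y * S₃ z, S₂ y * C₃ z] k
      + ∑ k, γ k * ![C₁ x * S₃ z, C₁ x * C₃ z, S₁ x * S₃ z, S₁ x * C₃ z] k = d) :
    d = 0 ∧ (∀ k, α k = 0) ∧ (∀ k, β k = 0) ∧ ∀ k, γ k = 0 := by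
  simp only [Fin.sum_univ_four, Matrix.cons_val] at h
  have hz : ∀ x y, (β 1 * C₂ y + β 3 * S₂ y + γ 1 * C₁ x + γ 3 * S₁ x = 0) ∧
      (β 0 * C₂ y + β 2 * S₂ y + γ 0 * C₁ x + γ 2 * S₁ x = 0) ∧
      d - (α 0 * (S₂ y * C₁ x) + α 1 * (S₂ y * S₁ x) + α 2 * (C₂ y * C₁ x)
        + α 3 * (C₂ y * S₁ x)) = 0 := fun x y => h₃.eq_zero fun z => by
    linear_combination h x y z
  have hβ1 := fun x => h₂.eq_zero (A := β 1) (B := β 3) (d := -(γ 1 * C₁ x + γ 3 * S₁ x))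
    fun y => by linear_combination (hz x y).1
  have hβ0 := fun x => h₂.eq_zero (A := β 0) (B := β 2) (d := -(γ 0 * C₁ x + γ 2 * S₁ x))
    fun y => by linear_combination (hz x y).2.1
  have hγ1 := h₁.eq_zero (A := γ 1) (B := γ 3) (d := 0) fun x => by
    linear_combination -(hβ1 x).2.2
  have hγ0 := h₁.eq_zero (A := γ 0) (B := γ 2) (d := 0) fun x => by
    linear_combination -(hβ0 x).2.2
  have hα := fun x => h₂.eq_zero (A := α 2 * C₁ x + α 3 * S₁ x) (B := α 0 * C₁ x + α 1 * S₁ x)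
    (d := d) fun y => by linear_combination -(hz x y).2.2
  have hα2 := h₁.eq_zero fun x => (hα x).1
  have hα0 := h₁.eq_zero fun x => (hα x).2.1
  refine ⟨(hα 0).2.2, ?_, ?_, ?_⟩ <;> intro k <;> fin_cases k
  exacts [hα0.1, hα0.2.1, hα2.1, hα2.2.1, (hβ0 0).1, (hβ1 0).1, (hβ0 0).2.1, (hβ1 0).2.1,
    hγ0.1, hγ1.1, hγ0.2.1, hγ1.2.1]

namespace Family

variable {F : Family} {a : ℝ} {J : Set ℝ}

lemma isTrigPair_PM (ha : a ≠ 0) : IsTrigPair (fun w => F.cPM w a) (fun w => F.sPM w a) := by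
  cases F
  exacts [isTrigPair_cosh ha, isTrigPair_cos ha]

lemma isTrigPair_MP (ha : a ≠ 0) : IsTrigPair (fun w => F.cMP w a) (fun w => F.sMP w a) := by
  cases F
  exacts [isTrigPair_cos ha, isTrigPair_cosh ha]

lemma gradField_Bfun_zero (ha : a ≠ 0) (k : Fin 4) (p : Pt) :
    F.gradField a (F.Bfun a k) p 0 = a * F.sMP (p 0) a *
      ![F.cPM (p 2) a * F.sMP (p 3) a, F.cPM (p 2) a * F.cMP (p 3) a,
        F.sPM (p 2) a * F.sMP (p 3) a, F.sPM (p 2) a * F.cMP (p 3) a] k := by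
  fin_cases k
  · exact congrFun (congrFun (gradField_eq_bField (F.oscPair_cPM a) (F.oscPair_sMP a) ha) p) 0
  · exact congrFun (congrFun (gradField_eq_bField (F.oscPair_cPM a) (F.oscPair_cMP a) ha) p) 0
  · exact congrFun (congrFun (gradField_eq_bField (F.oscPair_sPM a) (F.oscPair_sMP a) ha) p) 0
  · exact congrFun (congrFun (gradField_eq_bField (F.oscPair_sPM a) (F.oscPair_cMP a) ha) p) 0

lemma gradField_Gfun_zero (ha : a ≠ 0) (k : Fin 4) (p : Pt) :
    F.gradField a (F.Gfun a k) p 0 = -(F.sgn * a) * F.cMP (p 0) a *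
      ![Real.cosh (p 1 / a) * F.sMP (p 3) a, Real.cosh (p 1 / a) * F.cMP (p 3) a,
        Real.sinh (p 1 / a) * F.sMP (p 3) a, Real.sinh (p 1 / a) * F.cMP (p 3) a] k := by
  fin_cases k
  · exact congrFun (congrFun (gradField_eq_gField (oscPair_cosh a) (F.oscPair_sMP a) ha) p) 0
  · exact congrFun (congrFun (gradField_eq_gField (oscPair_cosh a) (F.oscPair_cMP a) ha) p) 0
  · exact congrFun (congrFun (gradField_eq_gField (oscPair_sinh a) (F.oscPair_sMP a) ha) p) 0
  · exact congrFun (congrFun (gradField_eq_gField (oscPair_sinh a) (F.oscPair_cMP a) ha) p) 0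

/-- An affine combination of the `∂_τ`-component and the conformal factor of a combination of the
fifteen fields is constant in space only if it is trivial. -/
lemma eq_zero_of_time_component (ha : a ≠ 0) {τ : ℝ} (t : Idx → ℝ) {b e d : ℝ}
    (h : ∀ x y z, b * ∑ i, t i * F.ckv a i ![τ, x, y, z] 0
      + e * ∑ i, t i * F.factor a i ![τ, x, y, z] = d) :
    d = 0 ∧ (∀ k, b * t (.inr (.inl k)) = 0) ∧
      (∀ k, (b * a * F.sMP τ a + e * F.cMP τ a) * t (.inr (.inr (.inl k))) = 0) ∧
      ∀ k, (-(b * F.sgn * a) * F.cMP τ a + e * F.sMP τ a) * t (.inr (.inr (.inr k))) = 0 := by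
  refine eq_zero_of_trig_sum (isTrigPair_cosh ha) (F.isTrigPair_PM ha) (F.isTrigPair_MP ha)
    fun x y z => ?_
  rw [← h x y z]
  simp only [Fintype.sum_sum_type, ckv, factor, gradField_Bfun_zero ha, gradField_Gfun_zero ha]
  simp [Fin.sum_univ_four, extraKV, Bfun, Gfun]
  ring

theorem linearIndependent_ckv (ha : a ≠ 0) (hJ : ∀ s ∈ J, F.sMP s a ≠ 0 ∧ F.cMP s a ≠ 0)
    (hne : J.Nonempty) :
    LinearIndependent ℝ (fun (i : Idx) (p : slab J) => F.ckv a i p) := by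
  rw [Fintype.linearIndependent_iff]
  intro t ht
  obtain ⟨τ, hτ⟩ := hne
  have key : ∀ p ∈ slab J, ∀ j, ∑ i, t i * F.ckv a i p j = 0 := by
    intro p hp j
    have := congrFun (congrFun ht ⟨p, hp⟩) j
    simpa using this
  -- The `∂_τ`-component alone kills the twelve coefficients of the non-translations; the
  -- translations are then separated by the spatial components.
  obtain ⟨-, h1, h2, h3⟩ := F.eq_zero_of_time_component ha (τ := τ) t (b := 1) (e := 0) (d := 0)
    fun x y z => by simp [key ![τ, x, y, z] hτ]
  obtain ⟨hs, hc⟩ := hJ τ hτ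
  have hσ : F.sgn ≠ 0 := fun h => by simpa [h] using F.sgn_mul_self
  replace h1 : ∀ k, t (.inr (.inl k)) = 0 := fun k => by simpa using h1 k
  replace h2 : ∀ k, t (.inr (.inr (.inl k))) = 0 := fun k => by simpa [ha, hs] using h2 k
  replace h3 : ∀ k, t (.inr (.inr (.inr k))) = 0 := fun k => by simpa [ha, hc, hσ] using h3 k
  rintro (μ | k | k | k)
  · have := key ![τ, 0, 0, 0] hτ μ.succ
    simpa [Fintype.sum_sum_type, h1, h2, h3, ckv, Pi.single_apply] using this
  exacts [h1 k, h2 k, h3 k]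

/-! ### Classification of the conformal Killing vectors -/

section Classification

variable (hJ : IsOpen J)

/-- The components of a vector field, as elements of the ring of smooth functions. -/
def components (hJ : IsOpen J) (ξ : Pt → Pt) (hξ : ContDiffOn ℝ ∞ ξ (slab J)) :
    Fin 4 → SmoothAlg ⟨slab J, isOpen_slab hJ⟩ :=
  fun i => SmoothAlg.mk (fun q => ξ q i) (contDiffOn_pi.1 hξ i)

/-- A smooth function of time, as an element of the ring of smooth functions. -/
def timeFun (hJ : IsOpen J) (u : ℝ → ℝ) (hu : ContDiffOn ℝ ∞ u J) :
    SmoothAlg ⟨slab J, isOpen_slab hJ⟩ :=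
  SmoothAlg.mk (fun q => u (q 0)) (contDiffOn_comp_time hu)

open SmoothAlg

lemma D_timeFun {u u' : ℝ → ℝ} (hu : ContDiffOn ℝ ∞ u J) (hu' : ContDiffOn ℝ ∞ u' J)
    (hd : ∀ t ∈ J, HasDerivAt u (u' t) t) (i : Fin 4) :
    D i (timeFun hJ u hu) = if i = 0 then timeFun hJ u' hu' else 0 := by
  refine ext_rep fun p hp => ?_
  have g : HasGrad (fun q => u (q 0)) _ p := HasGrad.coord 0 (hd _ hp)
  rw [timeFun, rep_D_mk _ _ _ hp, g.pd]
  split_ifs with h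
  · rw [timeFun, rep_mk _ _ hp, h, Pi.single_eq_same]
  · rw [rep_zero, Pi.single_eq_of_ne h]

lemma isUnit_timeFun {u : ℝ → ℝ} (hu : ContDiffOn ℝ ∞ u J) (h0 : ∀ t ∈ J, u t ≠ 0) :
    IsUnit (timeFun hJ u hu) := by
  refine IsUnit.of_mul_eq_one (timeFun hJ (fun t => (u t)⁻¹) (hu.inv h0)) (ext_rep fun p hp => ?_)
  rw [rep_mul, timeFun, timeFun, rep_mk _ _ hp, rep_mk _ _ hp, rep_one hp]
  exact mul_inv_cancel₀ (h0 _ hp)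

variable (F a) in
lemma warpFrame (h0 : ∀ s ∈ J, F.sMP s a ≠ 0 ∧ F.cMP s a ≠ 0) : WarpFrame D
    (timeFun hJ (fun t => F.sMP t a) (F.contDiff_sMP a).contDiffOn)
    (timeFun hJ (fun t => F.cMP t a / a) ((F.contDiff_cMP a).div_const a).contDiffOn)
    (timeFun hJ (fun t => F.cMP t a) (F.contDiff_cMP a).contDiffOn)
    (timeFun hJ (fun t => -(F.sgn * F.sMP t a / a))
      (((contDiff_const.mul (F.contDiff_sMP a)).div_const a).neg).contDiffOn)
    (timeFun hJ (fun _ => F.sgn / a ^ 2) contDiffOn_const) := by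
  refine ⟨D_comm, D_timeFun hJ _ _ fun t _ => F.hasDerivAt_sMP a t, ?_,
    D_timeFun hJ _ _ fun t _ => F.hasDerivAt_cMP a t, ?_, ?_, ?_,
    isUnit_timeFun hJ _ fun t ht => (h0 t ht).1, isUnit_timeFun hJ _ fun t ht => (h0 t ht).2⟩
  · intro i
    rw [D_timeFun hJ _ (u' := fun t => -(F.sgn * F.sMP t a / a) / a)
      ((((contDiff_const.mul (F.contDiff_sMP a)).div_const a).neg).div_const a).contDiffOn
      fun t _ => (F.hasDerivAt_cMP a t).div_const a]
    congr 1
    refine ext_rep fun p hp => ?_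
    simp only [rep_neg, rep_mul, timeFun, rep_mk _ _ hp]
    ring
  · intro i
    rw [D_timeFun hJ (u := fun t => -(F.sgn * F.sMP t a / a)) _
      (u' := fun t => -(F.sgn * (F.cMP t a / a) / a)) (((contDiff_const.mul ((F.contDiff_cMP a).div_const a)).div_const a).neg).contDiffOn
      fun t _ => (((F.hasDerivAt_sMP a t).const_mul F.sgn).div_const a).neg]
    congr 1
    refine ext_rep fun p hp => ?_
    simp only [rep_neg, rep_mul, timeFun, rep_mk _ _ hp]
    ring
  · intro i
    rw [D_timeFun hJ _ (u' := fun _ => 0) contDiffOn_const fun t _ => hasDerivAt_const t _]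
    split_ifs
    · refine ext_rep fun p hp => ?_
      rw [timeFun, rep_mk _ _ hp, rep_zero]
    · rfl
  · refine ext_rep fun p hp => ?_
    simp only [rep_neg, rep_mul, timeFun, rep_mk _ _ hp]
    ring

variable {hJ} in
lemma ckvSystem {ξ : Pt → Pt} (hξ : ContDiffOn ℝ ∞ ξ (slab J)) {ψ : Pt → ℝ}
    (h : ∀ p ∈ slab J, CKVAt F a ξ (ψ p) p) : CKVSystem D
    (timeFun hJ (fun t => F.sMP t a) (F.contDiff_sMP a).contDiffOn)
    (timeFun hJ (fun t => F.cMP t a / a) ((F.contDiff_cMP a).div_const a).contDiffOn)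
    (timeFun hJ (fun t => F.cMP t a) (F.contDiff_cMP a).contDiffOn)
    (timeFun hJ (fun t => -(F.sgn * F.sMP t a / a))
      (((contDiff_const.mul (F.contDiff_sMP a)).div_const a).neg).contDiffOn)
    (components hJ ξ hξ) := by
  constructor <;> refine ext_rep fun p hp => ?_ <;> have hp' := h p hp <;>
    simp only [components, timeFun, rep_add, rep_sub, rep_mul, rep_zero, rep_mk _ _ hp,
      rep_D_mk _ _ _ hp]
  · rw [hp'.h00, hp'.h11]
  · rw [hp'.h00, hp'.h22]; ring
  · rw [hp'.h00, hp'.h33]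
  · exact hp'.h01
  · exact hp'.h02
  · exact hp'.h03
  · exact hp'.h12
  · exact hp'.h13
  · exact hp'.h23

/-- Every conformal Killing vector of the unscaled metric is a combination of the fifteen. -/
theorem exists_eq_sum_ckv (ha : a ≠ 0) (hJ : IsOpen J) (hJc : IsConnected J)
    (h0 : ∀ s ∈ J, F.sMP s a ≠ 0 ∧ F.cMP s a ≠ 0) {ξ : Pt → Pt} {ψ : Pt → ℝ}
    (h : IsCKVWith (F.metric a) (slab J) ξ ψ) :
    ∃ t : Idx → ℝ, ∀ p ∈ slab J, ξ p = ∑ i, t i • F.ckv a i p := by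
  have hX := fun i => F.isCKVWith_ckv ha h0 i
  have conv : ∀ {ξ ψ}, IsCKVWith (F.metric a) (slab J) ξ ψ → ∀ p ∈ slab J, CKVAt F a ξ (ψ p) p :=
    fun h p hp => (lieMetric_metric_eq_iff (h0 _ hp).1 (h0 _ hp).2).1 (h.2 p hp)
  have hli : LinearIndependent ℝ (fun i => components hJ (F.ckv a i) (hX i).1) := by
    -- Independence in the differential ring is inherited from independence as vector-valued
    -- functions on the slab.
    let L : (Fin 4 → SmoothAlg ⟨slab J, isOpen_slab hJ⟩) →ₗ[ℝ] (slab J → Pt) :=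
      { toFun := fun f p j => rep (f j) p
        map_add' := fun f g => by ext p j; exact rep_add _ _ _
        map_smul' := fun t f => by ext p j; exact rep_smul _ _ _ }
    refine LinearIndependent.of_comp L ?_
    convert F.linearIndependent_ckv ha h0 hJc.nonempty using 1
    ext i p j
    exact rep_mk _ _ p.2
  obtain ⟨t, ht⟩ := CKVSystem.exists_eq_sum (F.warpFrame a hJ h0) (convex_slab hJc)
    (nonempty_slab hJc) (by simp) _ (fun i => ckvSystem (hX i).1 (conv (hX i))) hli
    (ckvSystem h.1 (conv h))
  refine ⟨t, fun p hp => funext fun j => ?_⟩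
  have := congrArg (fun f => rep f p) (congrFun ht j)
  simp only [Finset.sum_apply, Pi.smul_apply, rep_sum, rep_smul, components,
    rep_mk (U := ⟨slab J, isOpen_slab hJ⟩) _ _ hp] at this
  simpa using this

end Classification

variable {B : ℝ → ℝ}

/-- Every conformal Killing vector of the scaled metric is a combination of the fifteen. -/
theorem exists_eq_sum_ckv_scaled (hA : F.Admissible a J B) {ξ : Pt → Pt} {ψ : Pt → ℝ}
    (h : IsCKVWith (F.scaledMetric a B) (slab J) ξ ψ) :
    (∃ t : Idx → ℝ, ∀ p ∈ slab J, ξ p = ∑ i, t i • F.ckv a i p) ∧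
    IsCKVWith (F.metric a) (slab J) ξ
      (fun p => ψ p - ∑ c, ξ p c * pd c (fun q => Real.log (B (q 0))) p) := by
  obtain ⟨ha, hJ, hJc, hB, h0⟩ := hA
  have h' : IsCKVWith (F.metric a) (slab J) ξ
      (fun p => ψ p - ∑ c, ξ p c * pd c (fun q => Real.log (B (q 0))) p) := by
    rw [← isCKVWith_scaledMetric_iff hJ hB fun s hs => (h0 s hs).2.2]
    simpa using h
  exact ⟨F.exists_eq_sum_ckv ha hJ hJc (fun s hs => ⟨(h0 s hs).1, (h0 s hs).2.1⟩) h', h'⟩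

/-- At a fixed time the factor of `∑ tᵢ Xᵢ` is `(B'/B)` times its `τ`-component plus `∑ tᵢ φᵢ`, a
combination of the twelve products; being constant in space, it must vanish. -/
theorem not_admitsHomothety_scaledMetric (hA : F.Admissible a J B) :
    ¬ AdmitsHomothety (F.scaledMetric a B) (slab J) := by
  rintro ⟨ξ, d, hd, h⟩
  obtain ⟨⟨t, ht⟩, h'⟩ := exists_eq_sum_ckv_scaled hA h
  obtain ⟨ha, hJ, hJc, hB, h0⟩ := hA
  have h0' : ∀ s ∈ J, F.sMP s a ≠ 0 ∧ F.cMP s a ≠ 0 := fun s hs => ⟨(h0 s hs).1, (h0 s hs).2.1⟩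
  have conv : ∀ {ξ ψ}, IsCKVWith (F.metric a) (slab J) ξ ψ → ∀ p ∈ slab J, CKVAt F a ξ (ψ p) p :=
    fun h p hp => (lieMetric_metric_eq_iff (h0' _ hp).1 (h0' _ hp).2).1 (h.2 p hp)
  obtain ⟨τ, hτ⟩ := hJc.nonempty
  refine hd (F.eq_zero_of_time_component ha (τ := τ) t (b := deriv B τ / B τ) (e := 1)
    fun x y z => ?_).1
  have hp : (![τ, x, y, z] : Pt) ∈ slab J := hτ
  set p : Pt := ![τ, x, y, z] with hpdef
  have hl : HasGrad (fun q => Real.log (B (q 0))) _ p :=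
    HasGrad.coord (u := fun w => Real.log (B w)) 0
      ((hB.differentiableAt_of_isOpen hJ hτ).hasDerivAt.log (h0 _ hτ).2.2)
  -- For the unscaled metric the conformal factor is the `τ`-derivative of the `τ`-component, so the
  -- factor of the sum is the sum of the factors.
  have h00 := (conv h' p hp).h00
  have e0 : Set.EqOn (fun q => ξ q 0) (fun q => ∑ i, t i * F.ckv a i q 0) (slab J) := by
    intro q hq
    simp [ht q hq]
  have hg : HasGrad (fun q => ∑ i, t i * F.ckv a i q 0) _ p := HasGrad.sum fun i _ =>
    (hasGrad_of_differentiableAt ((contDiffOn_pi.1 (F.isCKVWith_ckv ha h0' i).1 0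
      ).differentiableAt_of_isOpen (isOpen_slab hJ) hp)).const_mul (t i)
  rw [pd_congr (isOpen_slab hJ) e0 hp, hg.pd] at h00
  simp only [fun i => (conv (F.isCKVWith_ckv ha h0' i) p hp).h00] at h00
  have e1 := e0 hp
  simp only at e1
  rw [h00, ← e1]
  simp only [Fin.sum_univ_four, hl.pd]
  simp
  ring

end Family

/-! ### The integrability conditions of conformal flatness -/

/-- The Minkowski bilinear form. -/
def mink {R : Type*} [CommRing R] (u v : Fin 4 → R) : R :=
  -(u 0 * v 0) + u 1 * v 1 + u 2 * v 2 + u 3 * v 3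

section Gauss

variable {R : Type*} [CommRing R]

variable [Algebra ℝ R] {D : Fin 4 → Derivation ℝ R R} {φ : Fin 4 → R}

/-- The coordinate vector fields of the map `φ`. -/
def frame (D : Fin 4 → Derivation ℝ R R) (φ : Fin 4 → R) (a : Fin 4) : Fin 4 → R :=
  fun i => D a (φ i)

/-- The second derivatives of the map `φ`. -/
def hess (D : Fin 4 → Derivation ℝ R R) (φ : Fin 4 → R) (a b : Fin 4) : Fin 4 → R :=
  fun i => D a (D b (φ i))

lemma D_mink (d : Derivation ℝ R R) (u v : Fin 4 → R) :
    d (mink u v) = mink (fun i => d (u i)) v + mink u (fun i => d (v i)) := by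
  simp only [mink, map_add, map_neg, Derivation.leibniz, smul_eq_mul]
  ring

variable (comm : ∀ i j x, D i (D j x) = D j (D i x))
include comm

lemma hess_comm (a b : Fin 4) : hess D φ a b = hess D φ b a :=
  funext fun i => comm a b (φ i)

/-- This and the two `koszul` lemmas below determine all Christoffel symbols of the first kind of an
orthogonal frame: the pairings of the second derivatives of `φ` with its first derivatives. -/
lemma koszul_same (a c : Fin 4) :
    D c (mink (frame D φ a) (frame D φ a)) = 2 * mink (hess D φ a c) (frame D φ a) := by
  rw [D_mink, hess_comm comm a c]
  simp only [frame, hess, mink]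
  ring

variable (orth : ∀ a b, a ≠ b → mink (frame D φ a) (frame D φ b) = 0)
include orth

/-- The Gauss equation for the flat ambient space. -/
lemma gauss_equation {a b : Fin 4} (hab : a ≠ b) :
    2 * (mink (hess D φ a a) (hess D φ b b) - mink (hess D φ a b) (hess D φ a b)) =
      -(D b (D b (mink (frame D φ a) (frame D φ a)))
        + D a (D a (mink (frame D φ b) (frame D φ b)))) := by
  have h := congrArg (fun x => D a (D b x)) (orth a b hab)
  simp only [D_mink, map_add, map_zero] at h ⊢
  simp only [frame, hess, mink] at h ⊢
  simp only [comm b a] at h ⊢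
  linear_combination 2 * h

lemma koszul_diag {a c : Fin 4} (hac : a ≠ c) :
    D c (mink (frame D φ a) (frame D φ a)) = -(2 * mink (hess D φ a a) (frame D φ c)) := by
  have h := congrArg (D a) (orth a c hac)
  rw [koszul_same comm]
  simp only [D_mink, map_zero] at h
  simp only [frame, hess, mink] at h ⊢
  linear_combination 2 * h

lemma koszul_distinct {a b c : Fin 4} (hab : a ≠ b) (hac : a ≠ c) (hbc : b ≠ c) :
    2 * mink (hess D φ a b) (frame D φ c) = 0 := by
  have h1 := congrArg (D a) (orth b c hbc)
  have h2 := congrArg (D b) (orth a c hac)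
  have h3 := congrArg (D c) (orth a b hab)
  simp only [D_mink, map_zero] at h1 h2 h3
  simp only [frame, hess, mink] at h1 h2 h3 ⊢
  simp only [comm b a, comm c a, comm c b] at h1 h2 h3
  linear_combination h1 + h2 - h3

end Gauss

/-- Expansion in an orthogonal basis. Together with the Koszul formulas it turns the Gauss equation
into one that involves only the metric. -/
lemma mink_eq_sum {E : Fin 4 → Fin 4 → ℝ} {G : Fin 4 → ℝ} (hG : ∀ c, G c ≠ 0)
    (hE : ∀ a b, mink (E a) (E b) = if a = b then G a else 0) (u v : Fin 4 → ℝ) :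
    mink u v = ∑ c, mink u (E c) * mink v (E c) / G c := by
  set η : Fin 4 → ℝ := ![-1, 1, 1, 1] with hη
  set M : Matrix (Fin 4) (Fin 4) ℝ := Matrix.of E
  have h1 : M * (Matrix.diagonal η * M.transpose * Matrix.diagonal (fun c => (G c)⁻¹)) = 1 := by
    rw [← mul_assoc, ← mul_assoc]
    ext a b
    rw [Matrix.mul_diagonal, Matrix.mul_apply]
    have : ∑ j, (M * Matrix.diagonal η) a j * M.transpose j b = mink (E a) (E b) := by
      simp [Fin.sum_univ_four, Matrix.mul_diagonal, M, mink, hη]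
    rw [this, hE, Matrix.one_apply]
    split_ifs with h
    · rw [h, mul_inv_cancel₀ (hG b)]
    · rw [zero_mul]
  -- Orthogonality gives a right inverse of the square matrix of the frame; that it is also a left
  -- inverse is the completeness relation.
  have h2 := mul_eq_one_comm.1 h1
  have h3 : ∀ i j, ∑ c, E c i * E c j / G c = if i = j then η i else 0 := by
    intro i j
    have := congrFun (congrFun h2 i) j
    rw [Matrix.mul_apply] at this
    have hηi : η i * η i = 1 := by fin_cases i <;> simp [hη]
    calc ∑ c, E c i * E c j / G c = η i * ∑ c, (Matrix.diagonal η * M.transpose *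
          Matrix.diagonal (fun c => (G c)⁻¹)) i c * M c j := by
          rw [Finset.mul_sum]
          refine Finset.sum_congr rfl fun c _ => ?_
          rw [Matrix.mul_diagonal, Matrix.diagonal_mul]
          simp only [M, Matrix.transpose_apply, Matrix.of_apply]
          linear_combination -(E c i * (G c)⁻¹ * E c j) * hηi
      _ = _ := by
          rw [this, Matrix.one_apply]
          split_ifs <;> simp
  have e : ∑ c, mink u (E c) * mink v (E c) / G c =
      ∑ i, ∑ j, η i * u i * (η j * v j) * ∑ c, E c i * E c j / G c := by
    simp only [Fin.sum_univ_four, mink, hη]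
    simp
    ring
  rw [e]
  simp only [h3]
  simp [mink, Fin.sum_univ_four, hη]

namespace SmoothAlg

variable {U : TopologicalSpace.Opens Pt}

lemma rep_mink (u v : Fin 4 → SmoothAlg U) (p : Pt) :
    rep (mink u v) p = mink (fun i => rep (u i) p) (fun i => rep (v i) p) := by
  simp only [mink, rep_add, rep_neg, rep_mul]

lemma rep_two_mul (x : SmoothAlg U) (p : Pt) : rep (2 * x) p = 2 * rep x p := by
  rw [two_mul, rep_add, two_mul]

/-- The components `R_{abab}` of the curvature of a flat diagonal metric vanish. -/
lemma flat_diagonal {φ : Fin 4 → SmoothAlg U}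
    (orth : ∀ a b, a ≠ b → mink (frame D φ a) (frame D φ b) = 0) {G : Fin 4 → SmoothAlg U}
    (hG : ∀ a, mink (frame D φ a) (frame D φ a) = G a) {p : Pt}
    (h0 : ∀ a, rep (G a) p ≠ 0) {a b : Fin 4} (hab : a ≠ b) :
    -(rep (D b (D b (G a))) p + rep (D a (D a (G b))) p) / 2 =
      ∑ c, (if c = a then -(rep (D a (G a)) p * rep (D a (G b)) p + rep (D b (G a)) p ^ 2) / 4
        else if c = b then -(rep (D b (G b)) p * rep (D b (G a)) p + rep (D a (G b)) p ^ 2) / 4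
        else rep (D c (G a)) p * rep (D c (G b)) p / 4) / rep (G c) p := by
  have hE : ∀ a b, mink (fun i => rep (frame D φ a i) p) (fun i => rep (frame D φ b i) p) =
      if a = b then rep (G a) p else 0 := by
    intro a b
    rw [← rep_mink]
    split_ifs with h
    · rw [← h, hG]
    · rw [orth a b h, rep_zero]
  have same : ∀ a c, mink (fun i => rep (hess D φ a c i) p) (fun i => rep (frame D φ a i) p) =
      rep (D c (G a)) p / 2 := by
    intro a c
    rw [← rep_mink, ← hG, koszul_same D_comm, rep_two_mul]
    ring
  have diag : ∀ a c, a ≠ c → mink (fun i => rep (hess D φ a a i) p)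
      (fun i => rep (frame D φ c i) p) = -rep (D c (G a)) p / 2 := by
    intro a c hac
    rw [← rep_mink, ← hG, koszul_diag D_comm orth hac, rep_neg, rep_two_mul]
    ring
  have same' : ∀ a c, mink (fun i => rep (hess D φ c a i) p) (fun i => rep (frame D φ a i) p) =
      rep (D c (G a)) p / 2 := by
    intro a c
    rw [hess_comm D_comm, same]
  have distinct : ∀ c, c ≠ a → c ≠ b → mink (fun i => rep (hess D φ a b i) p)
      (fun i => rep (frame D φ c i) p) = 0 := by
    intro c hca hcb
    have := congrArg (fun x => rep x p) (koszul_distinct D_comm orth hab hca.symm hcb.symm)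
    simp only [rep_two_mul, rep_zero, rep_mink] at this
    linarith
  have gauss := congrArg (fun x => rep x p) (gauss_equation D_comm orth hab)
  simp only [rep_two_mul, rep_sub, rep_neg, rep_add, hG, rep_mink] at gauss
  rw [mink_eq_sum h0 hE (fun i => rep (hess D φ a a i) p) (fun i => rep (hess D φ b b i) p),
    mink_eq_sum h0 hE (fun i => rep (hess D φ a b i) p) (fun i => rep (hess D φ a b i) p),
    ← Finset.sum_sub_distrib] at gauss
  have e : -(rep (D b (D b (G a))) p + rep (D a (D a (G b))) p) / 2 = ∑ c,
      (mink (fun i => rep (hess D φ a a i) p) (fun i => rep (frame D φ c i) p) *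
        mink (fun i => rep (hess D φ b b i) p) (fun i => rep (frame D φ c i) p) / rep (G c) p -
      mink (fun i => rep (hess D φ a b i) p) (fun i => rep (frame D φ c i) p) *
        mink (fun i => rep (hess D φ a b i) p) (fun i => rep (frame D φ c i) p) / rep (G c) p) := by
    linarith
  rw [e]
  refine Finset.sum_congr rfl fun c _ => ?_
  split_ifs with hca hcb
  · subst hca
    rw [same c c, diag b c hab.symm, same c b]
    ring
  · subst hcb
    rw [same c c, diag a c hab, same' c a]
    ring
  · rw [diag a c (Ne.symm hca), diag b c (Ne.symm hcb), distinct c hca hcb]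
    ring

/-- Conformal invariance of the Weyl tensor in diagonal form. In the combination `K(0,i) + K(j,k) -
K(0,j) - K(i,k)` of sectional curvatures of `W g` all derivatives of `W` cancel. Here `W1`, `W2`
stand for the first and pure second derivatives of `W`, and `g'`, `g''` for time derivatives. -/
lemma weyl_eq_zero_real {W : ℝ} {W1 W2 g g' g'' : Fin 4 → ℝ} (hW : W ≠ 0) (h0 : ∀ a, g a ≠ 0)
    (r0 : g 0 = -1) (r0' : g' 0 = 0) (r0'' : g'' 0 = 0)
    (flat : ∀ a b, a ≠ b →
      -((W2 b * g a + if b = 0 then 2 * W1 b * g' a + W * g'' a else 0)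
        + (W2 a * g b + if a = 0 then 2 * W1 a * g' b + W * g'' b else 0)) / 2 =
      ∑ c, (if c = a then
          -((W1 a * g a + if a = 0 then W * g' a else 0) *
              (W1 a * g b + if a = 0 then W * g' b else 0)
            + (W1 b * g a + if b = 0 then W * g' a else 0) ^ 2) / 4
        else if c = b then
          -((W1 b * g b + if b = 0 then W * g' b else 0) *
              (W1 b * g a + if b = 0 then W * g' a else 0)
            + (W1 a * g b + if a = 0 then W * g' b else 0) ^ 2) / 4
        else (W1 c * g a + if c = 0 then W * g' a else 0) *
          (W1 c * g b + if c = 0 then W * g' b else 0) / 4) / (W * g c))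
    {i j k : Fin 4} (hijk : (i = 1 ∧ j = 2 ∧ k = 3) ∨ (i = 1 ∧ j = 3 ∧ k = 2)) :
    g'' i / (2 * g i) - g' i ^ 2 / (4 * g i ^ 2) + g' j * g' k / (4 * g j * g k) =
      g'' j / (2 * g j) - g' j ^ 2 / (4 * g j ^ 2) + g' i * g' k / (4 * g i * g k) := by
  have e1 := h0 1
  have e2 := h0 2
  have e3 := h0 3
  have f1 := flat 0 i (by rcases hijk with ⟨rfl, -, -⟩ | ⟨rfl, -, -⟩ <;> decide)
  have f2 := flat j k (by rcases hijk with ⟨-, rfl, rfl⟩ | ⟨-, rfl, rfl⟩ <;> decide)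
  have f3 := flat 0 j (by rcases hijk with ⟨-, rfl, -⟩ | ⟨-, rfl, -⟩ <;> decide)
  have f4 := flat i k (by rcases hijk with ⟨rfl, -, rfl⟩ | ⟨rfl, -, rfl⟩ <;> decide)
  clear flat h0
  rcases hijk with ⟨rfl, rfl, rfl⟩ | ⟨rfl, rfl, rfl⟩
  all_goals
    simp only [r0, r0', r0'', Fin.sum_univ_four, Fin.isValue, Fin.reduceEq, if_true, if_false,
      add_zero, mul_zero] at f1 f2 f3 f4
    rw [← sub_eq_zero] at f1 f2 f3 f4 ⊢
  -- Up to a power of `W`, the coefficients are those dividing each curvature component by the norms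
  -- of its two axes; the sign of `g 0 = -1` accounts for the signs of `f1` and `f3`.
  · linear_combination (norm := (field_simp; ring)) -(1 / (W * g 1)) * f1 + 1 / (W * g 2 * g 3) * f2
      + 1 / (W * g 2) * f3 - 1 / (W * g 1 * g 3) * f4
  · linear_combination (norm := (field_simp; ring)) -(1 / (W * g 1)) * f1 + 1 / (W * g 2 * g 3) * f2
      + 1 / (W * g 3) * f3 - 1 / (W * g 1 * g 2) * f4

/-- If a metric `diag(-1, h₁, h₂, h₃)` with `hᵢ` depending on time only is, up to the factor `w`,
flat, then the components of its Weyl tensor vanish. -/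
lemma weyl_eq_zero {φ : Fin 4 → SmoothAlg U} {w : SmoothAlg U} {h h' h'' : Fin 4 → SmoothAlg U}
    (hh : ∀ a i, D i (h a) = if i = 0 then h' a else 0)
    (hh' : ∀ a i, D i (h' a) = if i = 0 then h'' a else 0)
    (hφ : ∀ a b, mink (frame D φ a) (frame D φ b) = if a = b then w * h a else 0) {p : Pt}
    (hp : p ∈ U) (hw : rep w p ≠ 0) (h0 : ∀ a, rep (h a) p ≠ 0) (hm : h 0 = -1)
    (hm' : h' 0 = 0) {i j k : Fin 4} (hijk : (i = 1 ∧ j = 2 ∧ k = 3) ∨ (i = 1 ∧ j = 3 ∧ k = 2)) :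
    rep (h'' i) p / (2 * rep (h i) p) - rep (h' i) p ^ 2 / (4 * rep (h i) p ^ 2)
        + rep (h' j) p * rep (h' k) p / (4 * rep (h j) p * rep (h k) p) =
      rep (h'' j) p / (2 * rep (h j) p) - rep (h' j) p ^ 2 / (4 * rep (h j) p ^ 2)
        + rep (h' i) p * rep (h' k) p / (4 * rep (h i) p * rep (h k) p) := by
  have hm'' : h'' 0 = 0 := by simpa [hm'] using (hh' 0 0).symm
  have orth : ∀ a b, a ≠ b → mink (frame D φ a) (frame D φ b) = 0 := fun a b hab => by
    rw [hφ, if_neg hab]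
  have hG : ∀ a, mink (frame D φ a) (frame D φ a) = w * h a := fun a => by rw [hφ, if_pos rfl]
  have hG0 : ∀ a, rep (w * h a) p ≠ 0 := fun a => by
    rw [rep_mul]; exact mul_ne_zero hw (h0 a)
  have flat := fun a b (hab : a ≠ b) => flat_diagonal (p := p) orth hG hG0 hab
  have D1 : ∀ a c, rep (D c (w * h a)) p = rep (D c w) p * rep (h a) p
      + if c = 0 then rep w p * rep (h' a) p else 0 := by
    intro a c
    rw [Derivation.leibniz, hh]
    split_ifs <;> simp only [smul_eq_mul, rep_add, rep_mul, rep_zero] <;> ring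
  have D2 : ∀ a c, rep (D c (D c (w * h a))) p = rep (D c (D c w)) p * rep (h a) p
      + if c = 0 then 2 * rep (D c w) p * rep (h' a) p + rep w p * rep (h'' a) p else 0 := by
    intro a c
    rw [Derivation.leibniz, hh]
    split_ifs with hc
    · simp only [smul_eq_mul, map_add, Derivation.leibniz, rep_add, rep_mul, hh, hh', hc, if_true]
      ring
    · simp only [smul_eq_mul, map_add, mul_zero, map_zero, Derivation.leibniz, rep_add, rep_mul,
        hh, if_neg hc, rep_zero]
      ring
  have r0 : rep (h 0) p = -1 := by rw [hm, rep_neg, rep_one hp]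
  have r0' : rep (h' 0) p = 0 := by rw [hm', rep_zero]
  have r0'' : rep (h'' 0) p = 0 := by rw [hm'', rep_zero]
  refine weyl_eq_zero_real (g := fun a => rep (h a) p)
    (g' := fun a => rep (h' a) p) (g'' := fun a => rep (h'' a) p) hw h0 r0 r0' r0'' (W1 := fun c => rep (D c w) p)
    (W2 := fun c => rep (D c (D c w)) p) (fun a b hab => ?_) hijk
  simpa only [D1, D2, rep_mul] using flat a b hab

end SmoothAlg

lemma pullback_minkowski (φ : Pt → Pt) (p : Pt) (a b : Fin 4) :
    pullback φ minkowski p a b =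
      mink (fun i => pd a (fun q => φ q i) p) (fun i => pd b (fun q => φ q i) p) := by
  simp [pullback, minkowski, Matrix.diagonal_apply, mink, Fin.sum_univ_four]

/-! ### The Weyl equations of a Bianchi I metric -/

section BianchiFlat

variable {A : Fin 3 → ℝ → ℝ} {I : Set ℝ}

lemma contDiffOn_deriv_of_isOpen {u : ℝ → ℝ} (hI : IsOpen I) (hu : ContDiffOn ℝ ∞ u I) :
    ContDiffOn ℝ ∞ (deriv u) I :=
  ((contDiffOn_infty_iff_deriv_of_isOpen hI).1 hu).2

/-- The components of a conformally flat Bianchi I metric satisfy the vanishing of Weyl. -/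
lemma weyl_bianchi (hI : IsOpen I) (hA : ∀ μ, ContDiffOn ℝ ∞ (A μ) I)
    (hA0 : ∀ μ, ∀ t ∈ I, A μ t ≠ 0) (hflat : IsConformallyFlatOn (bianchi A) (slab I))
    {t : ℝ} (ht : t ∈ I) :
    deriv (deriv (A 0)) t / A 0 t + deriv (A 1) t * deriv (A 2) t / (A 1 t * A 2 t) =
      deriv (deriv (A 1)) t / A 1 t + deriv (A 0) t * deriv (A 2) t / (A 0 t * A 2 t) ∧
    deriv (deriv (A 0)) t / A 0 t + deriv (A 1) t * deriv (A 2) t / (A 1 t * A 2 t) =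
      deriv (deriv (A 2)) t / A 2 t + deriv (A 0) t * deriv (A 1) t / (A 0 t * A 1 t) := by
  obtain ⟨V, hV, hpV, hVI, φ, Ω, hφ, hΩ, hg⟩ := hflat (fun _ => t) ht
  set U : TopologicalSpace.Opens Pt := ⟨V, hV⟩
  have hA' := fun μ => contDiffOn_deriv_of_isOpen hI (hA μ)
  have hA'' := fun μ => contDiffOn_deriv_of_isOpen hI (hA' μ)
  have time : ∀ {u : ℝ → ℝ}, ContDiffOn ℝ ∞ u I →
      ContDiffOn ℝ ∞ (fun q : Pt => u (q 0)) (U : Set Pt) :=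
    fun hu => (contDiffOn_comp_time hu).mono hVI
  let f : Fin 4 → ℝ → ℝ := ![fun _ => -1, fun t => A 0 t ^ 2, fun t => A 1 t ^ 2, fun t => A 2 t ^ 2]
  let f' : Fin 4 → ℝ → ℝ := ![fun _ => 0, fun t => 2 * A 0 t * deriv (A 0) t,
    fun t => 2 * A 1 t * deriv (A 1) t, fun t => 2 * A 2 t * deriv (A 2) t]
  let f'' : Fin 4 → ℝ → ℝ := ![fun _ => 0,
    fun t => 2 * deriv (A 0) t * deriv (A 0) t + 2 * A 0 t * deriv (deriv (A 0)) t,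
    fun t => 2 * deriv (A 1) t * deriv (A 1) t + 2 * A 1 t * deriv (deriv (A 1)) t,
    fun t => 2 * deriv (A 2) t * deriv (A 2) t + 2 * A 2 t * deriv (deriv (A 2)) t]
  have c : ∀ a, ContDiffOn ℝ ∞ (f a) I := by
    intro a
    fin_cases a
    exacts [contDiffOn_const, (hA 0).pow 2, (hA 1).pow 2, (hA 2).pow 2]
  have c' : ∀ a, ContDiffOn ℝ ∞ (f' a) I := by
    intro a
    fin_cases a
    exacts [contDiffOn_const, (contDiffOn_const.mul (hA 0)).mul (hA' 0),
      (contDiffOn_const.mul (hA 1)).mul (hA' 1), (contDiffOn_const.mul (hA 2)).mul (hA' 2)]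
  have c'' : ∀ a, ContDiffOn ℝ ∞ (f'' a) I := by
    intro a
    fin_cases a
    exacts [contDiffOn_const,
      ((contDiffOn_const.mul (hA' 0)).mul (hA' 0)).add ((contDiffOn_const.mul (hA 0)).mul (hA'' 0)),
      ((contDiffOn_const.mul (hA' 1)).mul (hA' 1)).add ((contDiffOn_const.mul (hA 1)).mul (hA'' 1)),
      ((contDiffOn_const.mul (hA' 2)).mul (hA' 2)).add ((contDiffOn_const.mul (hA 2)).mul (hA'' 2))]
  have dA : ∀ μ, ∀ t ∈ I, HasDerivAt (A μ) (deriv (A μ) t) t := fun μ t ht =>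
    ((hA μ).differentiableAt_of_isOpen hI ht).hasDerivAt
  have dA' : ∀ μ, ∀ t ∈ I, HasDerivAt (deriv (A μ)) (deriv (deriv (A μ)) t) t := fun μ t ht =>
    ((hA' μ).differentiableAt_of_isOpen hI ht).hasDerivAt
  have d2 : ∀ μ, ∀ t ∈ I, HasDerivAt (fun t => A μ t ^ 2) (2 * A μ t * deriv (A μ) t) t :=
    fun μ t ht => ((dA μ t ht).pow 2).congr_deriv (by simp)
  have d2' : ∀ μ, ∀ t ∈ I, HasDerivAt (fun t => 2 * A μ t * deriv (A μ) t)
      (2 * deriv (A μ) t * deriv (A μ) t + 2 * A μ t * deriv (deriv (A μ)) t) t :=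
    fun μ t ht => ((dA μ t ht).const_mul 2).mul (dA' μ t ht)
  have d : ∀ a, ∀ t ∈ I, HasDerivAt (f a) (f' a t) t := by
    intro a t ht
    fin_cases a
    exacts [hasDerivAt_const _ _, d2 0 t ht, d2 1 t ht, d2 2 t ht]
  have d' : ∀ a, ∀ t ∈ I, HasDerivAt (f' a) (f'' a t) t := by
    intro a t ht
    fin_cases a
    exacts [hasDerivAt_const _ _, d2' 0 t ht, d2' 1 t ht, d2' 2 t ht]
  let m : (u : ℝ → ℝ) → ContDiffOn ℝ ∞ u I → SmoothAlg U := fun u hu => SmoothAlg.mk _ (time hu)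
  have hm : ∀ u hu, ∀ p ∈ V, SmoothAlg.rep (m u hu) p = u (p 0) := fun u hu p hp =>
    SmoothAlg.rep_mk (U := U) _ _ hp
  have hD : ∀ {u u'} (hu : ContDiffOn ℝ ∞ u I) (hu' : ContDiffOn ℝ ∞ u' I),
      (∀ t ∈ I, HasDerivAt u (u' t) t) → ∀ i, SmoothAlg.D i (m u hu) =
        if i = 0 then m u' hu' else 0 := by
    intro u u' hu hu' hd i
    refine SmoothAlg.ext_rep fun p hp => ?_
    have g : HasGrad (fun q => u (q 0)) _ p := HasGrad.coord 0 (hd _ (hVI hp))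
    rw [SmoothAlg.rep_D_mk (U := U) _ _ _ hp, g.pd]
    split_ifs with h
    · rw [hm _ hu' _ hp, h, Pi.single_eq_same]
    · rw [SmoothAlg.rep_zero, Pi.single_eq_of_ne h]
  -- Conformal flatness writes the metric as `Ω²` times a flat one, so the factor in front of the
  -- Bianchi metric that makes it flat is the reciprocal.
  have hw : ContDiffOn ℝ ∞ (fun q => (Ω q ^ 2)⁻¹) (U : Set Pt) :=
    (hΩ.pow 2).inv fun q hq => (pow_pos (hg q hq).1 2).ne'
  have hmink : ∀ a b, mink (frame SmoothAlg.D (fun i => SmoothAlg.mk (U := U) (fun q => φ q i)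
      (contDiffOn_pi.1 hφ i)) a) (frame SmoothAlg.D (fun i => SmoothAlg.mk (U := U)
      (fun q => φ q i) (contDiffOn_pi.1 hφ i)) b) =
      if a = b then SmoothAlg.mk _ hw * m (f a) (c a) else 0 := by
    intro a b
    refine SmoothAlg.ext_rep fun p hp => ?_
    obtain ⟨hΩp, hgp⟩ := hg p hp
    have hgab := congrFun (congrFun hgp a) b
    rw [Matrix.smul_apply, pullback_minkowski, smul_eq_mul] at hgab
    have hb : bianchi A p a b = if a = b then f a (p 0) else 0 := by
      rw [bianchi, Matrix.diagonal_apply]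
      congr 1
      fin_cases a <;> rfl
    rw [SmoothAlg.rep_mink]
    simp only [frame, SmoothAlg.rep_D_mk (U := U) _ _ _ hp]
    refine mul_left_cancel₀ (pow_pos hΩp 2).ne' (hgab.symm.trans ?_)
    rw [hb]
    split_ifs
    · rw [SmoothAlg.rep_mul, hm _ (c a) _ hp, SmoothAlg.rep_mk _ _ hp, ← mul_assoc,
        mul_inv_cancel₀ (pow_pos hΩp 2).ne', one_mul]
    · rw [SmoothAlg.rep_zero, mul_zero]
  have h0 : ∀ a, SmoothAlg.rep (m (f a) (c a)) (fun _ => t) ≠ 0 := by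
    intro a
    rw [hm _ (c a) _ hpV]
    fin_cases a
    exacts [by simp [f], pow_ne_zero 2 (hA0 0 t ht), pow_ne_zero 2 (hA0 1 t ht),
      pow_ne_zero 2 (hA0 2 t ht)]
  have W := fun {i j k} => SmoothAlg.weyl_eq_zero (p := fun _ => t) (i := i) (j := j) (k := k)
    (fun a => hD (c a) (c' a) (d a)) (fun a => hD (c' a) (c'' a) (d' a)) hmink hpV
    (by rw [SmoothAlg.rep_mk _ _ hpV]; exact (inv_pos.2 (pow_pos (hg _ hpV).1 2)).ne') h0
    (SmoothAlg.ext_rep fun p hp => by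
      rw [hm _ (c 0) _ hp, SmoothAlg.rep_neg, SmoothAlg.rep_one hp]; rfl)
    (SmoothAlg.ext_rep fun p hp => by rw [hm _ (c' 0) _ hp, SmoothAlg.rep_zero]; rfl)
  have W1 := W (i := 1) (j := 2) (k := 3) (by simp)
  have W2 := W (i := 1) (j := 3) (k := 2) (by simp)
  simp only [hm _ _ _ hpV, f, f', f'', Matrix.cons_val] at W1 W2
  have e0 := hA0 0 t ht
  have e1 := hA0 1 t ht
  have e2 := hA0 2 t ht
  -- Back from the metric coefficients `h = A²` to the functions `A`: the combination `h''/2h -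
  -- h'²/4h²` is `A''/A`.
  have s : ∀ μ, (2 * deriv (A μ) t * deriv (A μ) t + 2 * A μ t * deriv (deriv (A μ)) t) /
      (2 * A μ t ^ 2) - (2 * A μ t * deriv (A μ) t) ^ 2 / (4 * (A μ t ^ 2) ^ 2) =
      deriv (deriv (A μ)) t / A μ t := by
    intro μ
    have := hA0 μ t ht
    field_simp
    ring
  have s' : ∀ μ ν, (2 * A μ t * deriv (A μ) t) * (2 * A ν t * deriv (A ν) t) /
      (4 * A μ t ^ 2 * A ν t ^ 2) = deriv (A μ) t * deriv (A ν) t / (A μ t * A ν t) := by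
    intro μ ν
    have := hA0 μ t ht
    have := hA0 ν t ht
    field_simp
    ring
  simp only [s, s'] at W1 W2
  refine ⟨W1, ?_⟩
  rw [← W2, mul_comm (deriv (A 1) t), mul_comm (A 1 t)]

end BianchiFlat

/-! ### The time coordinate `τ` with `dτ = dt/A₃` -/

section TimeCoordinate

variable {I : Set ℝ} {c τ : ℝ → ℝ}

/-- A nowhere vanishing smooth function on an interval has a primitive of its reciprocal. -/
lemma exists_hasDerivAt_one_div (hI : IsOpen I) (hIc : IsConnected I) (hc : ContDiffOn ℝ ∞ c I)
    (hc0 : ∀ t ∈ I, c t ≠ 0) : ∃ τ : ℝ → ℝ, ∀ t ∈ I, HasDerivAt τ (1 / c t) t := by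
  obtain ⟨t₀, ht₀⟩ := hIc.nonempty
  have hcont : ContinuousOn (fun t => 1 / c t) I := continuousOn_const.div hc.continuousOn hc0
  refine ⟨fun t => ∫ s in t₀..t, 1 / c s, fun t ht => ?_⟩
  have hsub : Set.uIcc t₀ t ⊆ I := hIc.isPreconnected.ordConnected.uIcc_subset ht₀ ht
  exact intervalIntegral.integral_hasDerivAt_right (hcont.mono hsub).intervalIntegrable
    (hcont.stronglyMeasurableAtFilter hI t ht) (hcont.continuousAt (hI.mem_nhds ht))

lemma contDiffOn_of_hasDerivAt_one_div (hI : IsOpen I) (hc : ContDiffOn ℝ ∞ c I)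
    (hc0 : ∀ t ∈ I, c t ≠ 0) (hτ : ∀ t ∈ I, HasDerivAt τ (1 / c t) t) : ContDiffOn ℝ ∞ τ I :=
  (contDiffOn_infty_iff_deriv_of_isOpen hI).2
    ⟨fun t ht => (hτ t ht).differentiableAt.differentiableWithinAt,
      (contDiffOn_const.div hc hc0).congr fun t ht => (hτ t ht).deriv⟩

/-- Rolle's theorem makes `τ` injective on the interval, as its derivative never vanishes; the
inverse function theorem makes it open, with smooth inverse. -/
lemma exists_inverse_time (hI : IsOpen I) (hIc : IsConnected I) (hc : ContDiffOn ℝ ∞ c I)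
    (hc0 : ∀ t ∈ I, c t ≠ 0) (hτ : ∀ t ∈ I, HasDerivAt τ (1 / c t) t) :
    IsOpen (τ '' I) ∧ IsConnected (τ '' I) ∧ ∃ T : ℝ → ℝ, ContDiffOn ℝ ∞ T (τ '' I) ∧
      ContDiffOn ℝ ∞ (fun s => c (T s)) (τ '' I) ∧ (∀ t ∈ I, T (τ t) = t) ∧
      (∀ s ∈ τ '' I, T s ∈ I ∧ τ (T s) = s ∧ HasDerivAt T (c (T s)) s) := by
  have hcτ := contDiffOn_of_hasDerivAt_one_div hI hc hc0 hτ
  have hord := hIc.isPreconnected.ordConnected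
  have hne : ∀ t ∈ I, 1 / c t ≠ 0 := fun t ht => one_div_ne_zero (hc0 t ht)
  have hlt : ∀ x ∈ I, ∀ y ∈ I, x < y → τ x ≠ τ y := by
    intro x hx y hy hxy he
    have hsub : Set.Icc x y ⊆ I := hord.out hx hy
    obtain ⟨z, hz, hz0⟩ := exists_deriv_eq_zero hxy (hcτ.continuousOn.mono hsub) he
    have hzI := hsub (Set.Ioo_subset_Icc_self hz)
    exact hne z hzI ((hτ z hzI).deriv.symm.trans hz0)
  have hinj : Set.InjOn τ I := by
    intro x hx y hy he
    rcases lt_trichotomy x y with h | h | h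
    exacts [(hlt x hx y hy h he).elim, h, (hlt y hy x hx h he.symm).elim]
  have hmap : ∀ t ∈ I, Filter.map τ (nhds t) = nhds (τ t) := fun t ht =>
    ((hcτ.contDiffAt (hI.mem_nhds ht)).hasStrictDerivAt' (hτ t ht) (by simp)).map_nhds_eq
      (hne t ht)
  have hopen : ∀ W ⊆ I, IsOpen W → IsOpen (τ '' W) := by
    intro W hW hWo
    rw [isOpen_iff_mem_nhds]
    rintro _ ⟨t, ht, rfl⟩
    rw [← hmap t (hW ht)]
    exact Filter.image_mem_map (hWo.mem_nhds ht)
  have hmapI : IsOpenMap (I.domRestrict τ) := by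
    intro W hW
    rw [Set.domRestrict_eq, Set.image_comp]
    exact hopen _ (Subtype.coe_image_subset I W) (hI.isOpenMap_subtype_val W hW)
  let e := OpenPartialHomeomorph.ofContinuousOpenRestrict hinj.toPartialEquiv hcτ.continuousOn
    hmapI hI
  have hT : ∀ s ∈ τ '' I, e.symm s ∈ I := fun s hs => e.map_target hs
  have hTs : ContDiffOn ℝ ∞ e.symm (τ '' I) := fun s hs =>
    (e.contDiffAt_symm_deriv (hne _ (hT s hs)) hs (hτ _ (hT s hs))
      (hcτ.contDiffAt (hI.mem_nhds (hT s hs)))).contDiffWithinAt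
  refine ⟨hopen I subset_rfl hI, hIc.image τ hcτ.continuousOn, e.symm, hTs,
    hc.comp hTs hT, fun t ht => e.left_inv ht, fun s hs => ⟨hT s hs, e.right_inv hs, ?_⟩⟩
  refine (e.hasDerivAt_symm hs (hne _ (hT s hs)) (hτ _ (hT s hs))).congr_deriv ?_
  simp

end TimeCoordinate

/-! ### Explicit pull-backs of the model metrics under rescaled coordinates -/

namespace Family

variable {A : Fin 3 → ℝ → ℝ} {I : Set ℝ} {F : Family} {a R S : ℝ} {τ : ℝ → ℝ}

lemma admissible_of_time (hI : IsOpen I) (hIc : IsConnected I)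
    (hA : ∀ μ, ContDiffOn ℝ ∞ (A μ) I) (hA0 : ∀ μ, ∀ t ∈ I, A μ t ≠ 0) (ha : 0 < a)
    (hτ : ∀ t ∈ I, HasDerivAt τ (1 / A 2 t) t)
    (h0 : ∀ t ∈ I, F.sMP (τ t) a ≠ 0 ∧ F.cMP (τ t) a ≠ 0) :
    ∃ B, F.Admissible a (τ '' I) B ∧ ∀ t ∈ I, B (τ t) = A 2 t := by
  obtain ⟨hJ, hJc, T, -, hB, hT, hT'⟩ := exists_inverse_time hI hIc (hA 2) (hA0 2) hτ
  refine ⟨fun s => A 2 (T s), ⟨ha.ne', hJ, hJc, hB, ?_⟩, fun t ht => by simp only [hT t ht]⟩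
  intro s hs
  obtain ⟨t, ht, rfl⟩ := hs
  exact ⟨(h0 t ht).1, (h0 t ht).2, hA0 2 _ (hT' _ ⟨t, ht, rfl⟩).1⟩

lemma pullback_scaledMetric (Φ : Pt → Pt) (B : ℝ → ℝ) (p : Pt) (b c : Fin 4) :
    pullback Φ (F.scaledMetric a B) p b c = ∑ i, pd b (fun q => Φ q i) p *
      pd c (fun q => Φ q i) p * (B (Φ p 0) ^ 2 * F.metric a (Φ p) i i) := by
  rw [pullback, Matrix.of_apply]
  refine Finset.sum_congr rfl fun i _ => ?_
  rw [Finset.sum_eq_single i _ (by simp)]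
  · simp [scaledMetric]
  · intro j _ hj
    simp [scaledMetric, metric, Matrix.diagonal_apply_ne _ hj.symm]

lemma pullback_rescale {t' : ℝ} {c₁ c₂ : ℝ} {p : Pt} {B : ℝ → ℝ} (hτ : HasDerivAt τ t' (p 0)) :
    pullback (fun p => ![τ (p 0), c₁ * p 1, c₂ * p 2, p 3]) (F.scaledMetric a B) p =
      Matrix.diagonal ![-(t' * B (τ (p 0))) ^ 2, (c₁ * B (τ (p 0)) * F.sMP (τ (p 0)) a) ^ 2,
        (c₂ * B (τ (p 0)) * F.cMP (τ (p 0)) a) ^ 2, B (τ (p 0)) ^ 2] := by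
  have g0 : ∀ i, pd i (fun q : Pt => τ (q 0)) p = (Pi.single 0 t' : Pt) i :=
    (HasGrad.coord 0 hτ).pd
  have g1 : ∀ i, pd i (fun q : Pt => c₁ * q 1) p = (Pi.single 1 c₁ : Pt) i :=
    (HasGrad.coord 1 (by simpa using (hasDerivAt_id (p 1)).const_mul c₁)).pd
  have g2 : ∀ i, pd i (fun q : Pt => c₂ * q 2) p = (Pi.single 2 c₂ : Pt) i :=
    (HasGrad.coord 2 (by simpa using (hasDerivAt_id (p 2)).const_mul c₂)).pd
  have g3 : ∀ i, pd i (fun q : Pt => q 3) p = (Pi.single 3 1 : Pt) i :=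
    (HasGrad.coord 3 (hasDerivAt_id (p 3))).pd
  ext b c
  rw [pullback_scaledMetric, Fin.sum_univ_four]
  simp only [Matrix.cons_val, g0, g1, g2, g3, metric, Matrix.diagonal_apply_eq]
  fin_cases b <;> fin_cases c <;> simp <;> ring

lemma pullback_rescale_swap {t' : ℝ} {c₁ c₂ : ℝ} {p : Pt} {B : ℝ → ℝ}
    (hτ : HasDerivAt τ t' (p 0)) :
    pullback (fun p => ![τ (p 0), c₁ * p 2, c₂ * p 1, p 3]) (F.scaledMetric a B) p =
      Matrix.diagonal ![-(t' * B (τ (p 0))) ^ 2, (c₂ * B (τ (p 0)) * F.cMP (τ (p 0)) a) ^ 2,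
        (c₁ * B (τ (p 0)) * F.sMP (τ (p 0)) a) ^ 2, B (τ (p 0)) ^ 2] := by
  have g0 : ∀ i, pd i (fun q : Pt => τ (q 0)) p = (Pi.single 0 t' : Pt) i :=
    (HasGrad.coord 0 hτ).pd
  have g1 : ∀ i, pd i (fun q : Pt => c₁ * q 2) p = (Pi.single 2 c₁ : Pt) i :=
    (HasGrad.coord 2 (by simpa using (hasDerivAt_id (p 2)).const_mul c₁)).pd
  have g2 : ∀ i, pd i (fun q : Pt => c₂ * q 1) p = (Pi.single 1 c₂ : Pt) i :=
    (HasGrad.coord 1 (by simpa using (hasDerivAt_id (p 1)).const_mul c₂)).pd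
  have g3 : ∀ i, pd i (fun q : Pt => q 3) p = (Pi.single 3 1 : Pt) i :=
    (HasGrad.coord 3 (hasDerivAt_id (p 3))).pd
  ext b c
  rw [pullback_scaledMetric, Fin.sum_univ_four]
  simp only [Matrix.cons_val, g0, g1, g2, g3, metric, Matrix.diagonal_apply_eq]
  fin_cases b <;> fin_cases c <;> simp <;> ring

variable (hI : IsOpen I) (hIc : IsConnected I) (hA : ∀ μ, ContDiffOn ℝ ∞ (A μ) I)
  (hA0 : ∀ μ, ∀ t ∈ I, A μ t ≠ 0) (ha : 0 < a) (hR : R ≠ 0) (hS : S ≠ 0)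
  (hτ : ∀ t ∈ I, HasDerivAt τ (1 / A 2 t) t)

include hI hIc hA hA0 ha hR hS hτ

lemma represents_of_eq (h : ∀ t ∈ I, A 0 t = R * A 2 t * F.sMP (τ t) a ∧
    A 1 t = S * A 2 t * F.cMP (τ t) a) : F.Represents A I := by
  obtain ⟨B, hB, hBA⟩ := admissible_of_time (F := F) hI hIc hA hA0 ha hτ fun t ht =>
    ⟨right_ne_zero_of_mul ((h t ht).1 ▸ hA0 0 t ht), right_ne_zero_of_mul ((h t ht).2 ▸ hA0 1 t ht)⟩
  refine ⟨a, _, B, τ, R, S, _, ha, hB, hR, hS, rfl, hτ, hBA, Or.inl fun p => rfl, fun p hp => ?_⟩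
  rw [pullback_rescale (hτ _ hp), hBA _ hp, one_div_mul_cancel (hA0 2 _ hp), ← (h _ hp).1,
    ← (h _ hp).2, bianchi, one_pow]

lemma represents_of_eq_swap (h : ∀ t ∈ I, A 1 t = R * A 2 t * F.sMP (τ t) a ∧
    A 0 t = S * A 2 t * F.cMP (τ t) a) : F.Represents A I := by
  obtain ⟨B, hB, hBA⟩ := admissible_of_time (F := F) hI hIc hA hA0 ha hτ fun t ht =>
    ⟨right_ne_zero_of_mul ((h t ht).1 ▸ hA0 1 t ht), right_ne_zero_of_mul ((h t ht).2 ▸ hA0 0 t ht)⟩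
  refine ⟨a, _, B, τ, R, S, _, ha, hB, hR, hS, rfl, hτ, hBA, Or.inr fun p => rfl, fun p hp => ?_⟩
  rw [pullback_rescale_swap (hτ _ hp), hBA _ hp, one_div_mul_cancel (hA0 2 _ hp), ← (h _ hp).1,
    ← (h _ hp).2, bianchi, one_pow]

end Family

/-! ### Oscillator equations with constant coefficient -/

section Oscillator

variable {I : Set ℝ} {r τ u v p q : ℝ → ℝ} {k : ℝ}

lemma eq_of_hasDerivAt_zero {f : ℝ → ℝ} (hI : IsOpen I) (hIc : IsConnected I)
    (hf : ∀ t ∈ I, HasDerivAt f 0 t) : ∃ C, ∀ t ∈ I, f t = C := by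
  obtain ⟨t₀, ht₀⟩ := hIc.nonempty
  exact ⟨f t₀, fun t ht => hI.is_const_of_deriv_eq_zero hIc.isPreconnected
    (fun s hs => (hf s hs).differentiableAt.differentiableWithinAt)
    (fun s hs => (hf s hs).deriv) ht ht₀⟩

/-- Variation of constants: the two candidate coefficients, written through `u` and `p = du/dτ`, are
conserved. -/
lemma exists_eq_cos_add_sin (hI : IsOpen I) (hIc : IsConnected I) (hk : k ≠ 0)
    (hτ : ∀ t ∈ I, HasDerivAt τ (r t) t) (hu : ∀ t ∈ I, HasDerivAt u (p t * r t) t)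
    (hp : ∀ t ∈ I, HasDerivAt p (-k ^ 2 * u t * r t) t) :
    ∃ P Q, ∀ t ∈ I, u t = P * Real.cos (k * τ t) + Q * Real.sin (k * τ t) ∧
      p t = k * (Q * Real.cos (k * τ t) - P * Real.sin (k * τ t)) := by
  have hc := fun t ht => ((hτ t ht).const_mul k).cos
  have hs := fun t ht => ((hτ t ht).const_mul k).sin
  obtain ⟨P, hP⟩ := eq_of_hasDerivAt_zero hI hIc
    (f := fun t => u t * Real.cos (k * τ t) - p t / k * Real.sin (k * τ t)) fun t ht =>
      (((hu t ht).mul (hc t ht)).sub (((hp t ht).div_const k).mul (hs t ht))).congr_deriv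
        (by field_simp; ring)
  obtain ⟨Q, hQ⟩ := eq_of_hasDerivAt_zero hI hIc
    (f := fun t => u t * Real.sin (k * τ t) + p t / k * Real.cos (k * τ t)) fun t ht =>
      (((hu t ht).mul (hs t ht)).add (((hp t ht).div_const k).mul (hc t ht))).congr_deriv
        (by field_simp; ring)
  refine ⟨P, Q, fun t ht => ?_⟩
  have h1 := Real.sin_sq_add_cos_sq (k * τ t)
  rw [← hP t ht, ← hQ t ht]
  constructor
  · linear_combination (-u t) * h1
  · field_simp
    linear_combination (-p t) * h1

lemma exists_eq_cosh_add_sinh (hI : IsOpen I) (hIc : IsConnected I) (hk : k ≠ 0)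
    (hτ : ∀ t ∈ I, HasDerivAt τ (r t) t) (hu : ∀ t ∈ I, HasDerivAt u (p t * r t) t)
    (hp : ∀ t ∈ I, HasDerivAt p (k ^ 2 * u t * r t) t) :
    ∃ P Q, ∀ t ∈ I, u t = P * Real.cosh (k * τ t) + Q * Real.sinh (k * τ t) ∧
      p t = k * (Q * Real.cosh (k * τ t) + P * Real.sinh (k * τ t)) := by
  have hc := fun t ht => ((hτ t ht).const_mul k).cosh
  have hs := fun t ht => ((hτ t ht).const_mul k).sinh
  obtain ⟨P, hP⟩ := eq_of_hasDerivAt_zero hI hIc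
    (f := fun t => u t * Real.cosh (k * τ t) - p t / k * Real.sinh (k * τ t)) fun t ht =>
      (((hu t ht).mul (hc t ht)).sub (((hp t ht).div_const k).mul (hs t ht))).congr_deriv
        (by field_simp; ring)
  obtain ⟨Q, hQ⟩ := eq_of_hasDerivAt_zero hI hIc
    (f := fun t => p t / k * Real.cosh (k * τ t) - u t * Real.sinh (k * τ t)) fun t ht =>
      ((((hp t ht).div_const k).mul (hc t ht)).sub ((hu t ht).mul (hs t ht))).congr_deriv
        (by field_simp; ring)
  refine ⟨P, Q, fun t ht => ?_⟩
  have h1 := Real.cosh_sq_sub_sinh_sq (k * τ t)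
  rw [← hP t ht, ← hQ t ht]
  constructor
  · linear_combination (-u t) * h1
  · field_simp
    linear_combination (-p t) * h1

/-- The product relation `hpq` says that the coefficient vectors of `u` and `v` are orthogonal. So
`v` is a quarter period out of phase with `u`. -/
lemma exists_sin_cos (hI : IsOpen I) (hIc : IsConnected I) (hk : k ≠ 0)
    (hτ : ∀ t ∈ I, HasDerivAt τ (r t) t) (hu : ∀ t ∈ I, HasDerivAt u (p t * r t) t)
    (hp : ∀ t ∈ I, HasDerivAt p (-k ^ 2 * u t * r t) t)
    (hv : ∀ t ∈ I, HasDerivAt v (q t * r t) t)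
    (hq : ∀ t ∈ I, HasDerivAt q (-k ^ 2 * v t * r t) t)
    (hpq : ∀ t ∈ I, p t * q t = -k ^ 2 * u t * v t) (hu0 : ∀ t ∈ I, u t ≠ 0) :
    ∃ R S δ, ∀ t ∈ I, u t = R * Real.sin (k * τ t + δ) ∧ v t = S * Real.cos (k * τ t + δ) := by
  obtain ⟨P, Q, h⟩ := exists_eq_cos_add_sin hI hIc hk hτ hu hp
  obtain ⟨P', Q', h'⟩ := exists_eq_cos_add_sin hI hIc hk hτ hv hq
  obtain ⟨t₀, ht₀⟩ := hIc.nonempty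
  have horth : P * P' + Q * Q' = 0 := by
    have e := hpq t₀ ht₀
    rw [(h _ ht₀).1, (h _ ht₀).2, (h' _ ht₀).1, (h' _ ht₀).2] at e
    have h1 := Real.sin_sq_add_cos_sq (k * τ t₀)
    refine (mul_eq_zero.1 (?_ : k ^ 2 * (P * P' + Q * Q') = 0)).resolve_left (pow_ne_zero 2 hk)
    linear_combination e - k ^ 2 * (P * P' + Q * Q') * h1
  -- Polar coordinates of the coefficient vector: the argument is the phase of the sine.
  let z : ℂ := ⟨Q, P⟩
  have hQ : ‖z‖ * Real.cos z.arg = Q := Complex.norm_mul_cos_arg z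
  have hP : ‖z‖ * Real.sin z.arg = P := Complex.norm_mul_sin_arg z
  have hz : ‖z‖ ≠ 0 := by
    intro hz
    rw [hz, zero_mul] at hQ hP
    exact hu0 t₀ ht₀ (by rw [(h _ ht₀).1, ← hQ, ← hP]; ring)
  have h1 := Real.sin_sq_add_cos_sq z.arg
  have horth' : Real.sin z.arg * P' + Real.cos z.arg * Q' = 0 := by
    refine (mul_eq_zero.1 (?_ : ‖z‖ * (Real.sin z.arg * P' + Real.cos z.arg * Q') = 0)).resolve_left
      hz
    linear_combination horth + P' * hP + Q' * hQ
  refine ⟨‖z‖, P' * Real.cos z.arg - Q' * Real.sin z.arg, z.arg, fun t ht => ⟨?_, ?_⟩⟩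
  · rw [(h _ ht).1, Real.sin_add]
    linear_combination (-Real.cos (k * τ t)) * hP - Real.sin (k * τ t) * hQ
  · rw [(h' _ ht).1, Real.cos_add]
    linear_combination (-P' * Real.cos (k * τ t) - Q' * Real.sin (k * τ t)) * h1 +
      (Real.cos (k * τ t) * Real.sin z.arg + Real.sin (k * τ t) * Real.cos z.arg) * horth'

/-- The phase of a hyperbolic sine. -/
lemma exists_phase {P Q : ℝ} (h : |P| < |Q|) :
    ∃ R δ, R * Real.sinh δ = P ∧ R * Real.cosh δ = Q := by
  have hQ : Q ≠ 0 := abs_pos.1 ((abs_nonneg P).trans_lt h)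
  have hpos : 0 < Q ^ 2 - P ^ 2 := sub_pos.2 (sq_lt_sq.2 h)
  -- The amplitude must carry the sign of `Q`, since the hyperbolic cosine is positive.
  obtain ⟨w, hw, hw2⟩ : ∃ w : ℝ, w ≠ 0 ∧ w ^ 2 = Q ^ 2 - P ^ 2 ∧ 0 < Q / w := by
    have hs := Real.sqrt_pos.2 hpos
    rcases lt_or_gt_of_ne hQ with hQ | hQ
    · exact ⟨-√(Q ^ 2 - P ^ 2), (neg_lt_zero.2 hs).ne, by rw [neg_sq, Real.sq_sqrt hpos.le],
        div_pos_of_neg_of_neg hQ (neg_lt_zero.2 hs)⟩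
    · exact ⟨√(Q ^ 2 - P ^ 2), hs.ne', Real.sq_sqrt hpos.le, div_pos hQ hs⟩
  refine ⟨w, Real.arsinh (P / w), ?_, ?_⟩
  · rw [Real.sinh_arsinh, mul_div_cancel₀ _ hw]
  · rw [Real.cosh_arsinh, show 1 + (P / w) ^ 2 = (Q / w) ^ 2 by
      field_simp; linear_combination hw2.1, Real.sqrt_sq hw2.2.le, mul_div_cancel₀ _ hw]

/-- Hyperbolic orthogonality `QQ' = PP'` pairs a solution of `sinh` type (`|P| < |Q|`) with one of
`cosh` type. The null case `|P| = |Q|` is a pure exponential, where the two solutions are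
proportional. -/
lemma exists_sinh_cosh (hI : IsOpen I) (hIc : IsConnected I) (hk : k ≠ 0)
    (hτ : ∀ t ∈ I, HasDerivAt τ (r t) t) (hu : ∀ t ∈ I, HasDerivAt u (p t * r t) t)
    (hp : ∀ t ∈ I, HasDerivAt p (k ^ 2 * u t * r t) t)
    (hv : ∀ t ∈ I, HasDerivAt v (q t * r t) t)
    (hq : ∀ t ∈ I, HasDerivAt q (k ^ 2 * v t * r t) t)
    (hpq : ∀ t ∈ I, p t * q t = k ^ 2 * u t * v t) (hu0 : ∀ t ∈ I, u t ≠ 0)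
    (hv0 : ∀ t ∈ I, v t ≠ 0) :
    (∃ C, ∀ t ∈ I, v t = C * u t) ∨
    (∃ R S δ, ∀ t ∈ I, u t = R * Real.sinh (k * τ t + δ) ∧ v t = S * Real.cosh (k * τ t + δ)) ∨
    ∃ R S δ, ∀ t ∈ I, v t = R * Real.sinh (k * τ t + δ) ∧ u t = S * Real.cosh (k * τ t + δ) := by
  obtain ⟨P, Q, h⟩ := exists_eq_cosh_add_sinh hI hIc hk hτ hu hp
  obtain ⟨P', Q', h'⟩ := exists_eq_cosh_add_sinh hI hIc hk hτ hv hq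
  obtain ⟨t₀, ht₀⟩ := hIc.nonempty
  have horth : Q * Q' = P * P' := by
    have e := hpq t₀ ht₀
    rw [(h _ ht₀).1, (h _ ht₀).2, (h' _ ht₀).1, (h' _ ht₀).2] at e
    have h1 := Real.cosh_sq_sub_sinh_sq (k * τ t₀)
    refine mul_left_cancel₀ (pow_ne_zero 2 hk) ?_
    linear_combination e - k ^ 2 * (Q * Q' - P * P') * h1
  have key : ∀ {w w' : ℝ → ℝ} {P Q P' Q' : ℝ},
      (∀ t ∈ I, w t = P * Real.cosh (k * τ t) + Q * Real.sinh (k * τ t)) →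
      (∀ t ∈ I, w' t = P' * Real.cosh (k * τ t) + Q' * Real.sinh (k * τ t)) →
      Q * Q' = P * P' → |P| < |Q| →
      ∃ R S δ, ∀ t ∈ I, w t = R * Real.sinh (k * τ t + δ) ∧ w' t = S * Real.cosh (k * τ t + δ) := by
    intro w w' P Q P' Q' hw hw' ho hlt
    obtain ⟨R, δ, hP, hQ⟩ := exists_phase hlt
    have hR : R ≠ 0 := by
      rintro rfl
      rw [zero_mul] at hP hQ
      rw [← hP, ← hQ] at hlt
      exact lt_irrefl _ hlt
    have hc := (Real.cosh_pos δ).ne'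
    have hQ' : Real.cosh δ * Q' = Real.sinh δ * P' := by
      refine mul_left_cancel₀ hR ?_
      linear_combination ho + Q' * hQ - P' * hP
    refine ⟨R, P' / Real.cosh δ, δ, fun t ht => ⟨?_, ?_⟩⟩
    · rw [hw _ ht, Real.sinh_add]
      linear_combination (-Real.cosh (k * τ t)) * hP - Real.sinh (k * τ t) * hQ
    · rw [hw' _ ht, Real.cosh_add]
      field_simp
      linear_combination Real.sinh (k * τ t) * hQ'
  rcases lt_trichotomy |P| |Q| with hlt | heq | hgt
  · exact Or.inr (Or.inl (key (fun t ht => (h t ht).1) (fun t ht => (h' t ht).1) horth hlt))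
  · left
    have hP : P ≠ 0 := by
      intro hP
      rw [hP, abs_zero] at heq
      exact hu0 t₀ ht₀ (by rw [(h _ ht₀).1, hP, abs_eq_zero.1 heq.symm]; ring)
    refine ⟨P' / P, fun t ht => ?_⟩
    rw [(h _ ht).1, (h' _ ht).1]
    rcases abs_eq_abs.1 heq with e | e
    · have e' : Q' = P' := mul_left_cancel₀ hP (by linear_combination horth + Q' * e)
      rw [e', ← e]
      field_simp
    · have e' : Q' = -P' := mul_left_cancel₀ hP (by linear_combination -horth + Q' * e)
      rw [e', ← neg_eq_iff_eq_neg.2 e]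
      field_simp
  · refine Or.inr (Or.inr (key (fun t ht => (h' t ht).1) (fun t ht => (h t ht).1)
      (by linear_combination horth) ?_))
    -- If `v` were not of `sinh` type as well, then `|QQ'| < |PP'|` unless `P' = 0`, and `P' = 0`
    -- would make `v` vanish.
    by_contra! hle
    have hP' : P' = 0 := by
      by_contra hP'
      have := mul_lt_mul_of_lt_of_le_of_nonneg_of_pos hgt hle (abs_nonneg _) (abs_pos.2 hP')
      rw [← abs_mul, ← abs_mul, horth] at this
      exact lt_irrefl _ this
    rw [hP', abs_zero] at hle
    exact hv0 t₀ ht₀ (by rw [(h' _ ht₀).1, hP', abs_nonpos_iff.1 hle]; ring)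

end Oscillator

/-! ### From conformal flatness to the model metrics -/

namespace Family

/-- A proper conformally flat Bianchi I metric is, up to rescalings and a change of the time
coordinate, conformal to the metric of one of the two families. -/
lemma represents_of_isProper {A : Fin 3 → ℝ → ℝ} {I : Set ℝ} (hI : IsOpen I) (hIc : IsConnected I)
    (hA : ∀ μ, ContDiffOn ℝ ∞ (A μ) I) (hA0 : ∀ μ, ∀ t ∈ I, A μ t ≠ 0) (hproper : IsProper A I)
    (hflat : IsConformallyFlatOn (bianchi A) (slab I)) :
    RT.Represents A I ∨ ART.Represents A I := by
  obtain ⟨τ, hτ⟩ := exists_hasDerivAt_one_div hI hIc (hA 2) (hA0 2)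
  have hA' := fun μ => contDiffOn_deriv_of_isOpen hI (hA μ)
  have dA : ∀ μ, ∀ t ∈ I, HasDerivAt (A μ) (deriv (A μ) t) t := fun μ t ht =>
    ((hA μ).differentiableAt_of_isOpen hI ht).hasDerivAt
  have dA' : ∀ μ, ∀ t ∈ I, HasDerivAt (deriv (A μ)) (deriv (deriv (A μ)) t) t := fun μ t ht =>
    ((hA' μ).differentiableAt_of_isOpen hI ht).hasDerivAt
  let u : Fin 3 → ℝ → ℝ := fun μ t => A μ t / A 2 t
  -- This is the derivative of the ratio `u μ` with respect to `τ`; each factor `1 / A 2 t` below is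
  -- `dτ/dt`.
  let p : Fin 3 → ℝ → ℝ := fun μ t => deriv (A μ) t - A μ t * deriv (A 2) t / A 2 t
  have hu0 : ∀ μ, ∀ t ∈ I, u μ t ≠ 0 := fun μ t ht => div_ne_zero (hA0 μ t ht) (hA0 2 t ht)
  have hu : ∀ μ, ∀ t ∈ I, HasDerivAt (u μ) (p μ t * (1 / A 2 t)) t := by
    intro μ t ht
    have h2 := hA0 2 t ht
    exact ((dA μ t ht).div (dA 2 t ht) h2).congr_deriv (by simp only [p]; field_simp)
  let κ : ℝ → ℝ := fun t => p 0 t * p 1 t / (u 0 t * u 1 t)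
  -- In the variables `u` and `τ` the two Weyl equations say that both ratios solve the same
  -- oscillator equation, with `κ` as coefficient.
  have hp : ∀ μ, μ ≠ 2 → ∀ t ∈ I, HasDerivAt (p μ) (κ t * u μ t * (1 / A 2 t)) t := by
    intro μ hμ t ht
    have h0 := hA0 0 t ht
    have h1 := hA0 1 t ht
    have h2 := hA0 2 t ht
    obtain ⟨W1, W2⟩ := weyl_bianchi hI hA hA0 hflat ht
    refine ((dA' μ t ht).sub (((dA μ t ht).mul (dA' 2 t ht)).div (dA 2 t ht) h2)).congr_deriv ?_
    simp only [κ, p, u, Pi.mul_apply]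
    field_simp at W1 W2
    fin_cases μ
    · simp only [Fin.zero_eta, Fin.isValue]
      field_simp
      linear_combination A 2 t * W2
    · simp only [Fin.mk_one, Fin.isValue]
      field_simp
      linear_combination A 2 t * (W2 - W1)
    · exact absurd rfl hμ
  -- The oscillator equations give `(p₀p₁)' = κ (u₀u₁)'`, with derivatives in `τ`; hence the
  -- quotient `κ = p₀p₁/(u₀u₁)` is constant.
  obtain ⟨K, hK⟩ : ∃ K, ∀ t ∈ I, κ t = K := by
    refine eq_of_hasDerivAt_zero hI hIc fun t ht => ?_
    have h0 := hu0 0 t ht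
    have h1 := hu0 1 t ht
    have h2 := hA0 2 t ht
    refine (((hp 0 (by decide) t ht).mul (hp 1 (by decide) t ht)).div
      ((hu 0 t ht).mul (hu 1 t ht)) (mul_ne_zero h0 h1)).congr_deriv ?_
    simp only [κ, Pi.mul_apply]
    field_simp
    ring
  have hpq : ∀ t ∈ I, p 0 t * p 1 t = K * u 0 t * u 1 t := by
    intro t ht
    rw [← hK t ht, mul_assoc, div_mul_cancel₀ _ (mul_ne_zero (hu0 0 t ht) (hu0 1 t ht))]
  have hp' : ∀ μ, μ ≠ 2 → ∀ t ∈ I, HasDerivAt (p μ) (K * u μ t * (1 / A 2 t)) t :=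
    fun μ hμ t ht => hK t ht ▸ hp μ hμ t ht
  have hprop : ∀ μ ν, μ ≠ ν → ¬ ∃ c, ∀ t ∈ I, u μ t = c * u ν t := by
    rintro μ ν hμν ⟨c, hc⟩
    refine hproper μ ν hμν ⟨c, fun t ht => ?_⟩
    have h := hc t ht
    simp only [u] at h
    field_simp [hA0 2 t ht] at h
    exact h
  have hA2 : ∀ μ, ∀ t ∈ I, A μ t = u μ t * A 2 t := fun μ t ht =>
    (div_mul_cancel₀ _ (hA0 2 t ht)).symm
  -- The primitive `τ` is free up to a constant, which absorbs the phase; the parameter is `a =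
  -- 1/k`.
  have shift : ∀ {k : ℝ} (δ : ℝ), k ≠ 0 → (∀ t ∈ I, HasDerivAt (fun t => τ t + δ / k) (1 / A 2 t) t)
      ∧ ∀ t, (τ t + δ / k) / k⁻¹ = k * τ t + δ := fun δ hk =>
    ⟨fun t ht => (hτ t ht).add_const _, fun t => by field_simp⟩
  obtain ⟨t₀, ht₀⟩ := hIc.nonempty
  have nz : ∀ {μ : Fin 3} {R : ℝ} {f : ℝ → ℝ}, (∀ t ∈ I, u μ t = R * f t) → R ≠ 0 := by
    intro μ R f h
    exact left_ne_zero_of_mul (h t₀ ht₀ ▸ hu0 μ t₀ ht₀)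
  rcases lt_trichotomy K 0 with hK0 | rfl | hK0
  · left
    have hk := Real.sqrt_pos.2 (neg_pos.2 hK0)
    have hKk : K = -√(-K) ^ 2 := by rw [Real.sq_sqrt (neg_pos.2 hK0).le, neg_neg]
    set k := √(-K)
    rw [hKk] at hp' hpq
    obtain ⟨R, S, δ, h⟩ := exists_sin_cos hI hIc hk.ne' hτ (hu 0) (hp' 0 (by decide)) (hu 1)
      (hp' 1 (by decide)) hpq (hu0 0)
    obtain ⟨hτ', e⟩ := shift δ hk.ne'
    refine represents_of_eq hI hIc hA hA0 (inv_pos.2 hk) (nz fun t ht => (h t ht).1)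
      (nz fun t ht => (h t ht).2) hτ' fun t ht => ?_
    simp only [sMP, cMP, e]
    rw [hA2 0 t ht, hA2 1 t ht, (h t ht).1, (h t ht).2]
    constructor <;> ring
  -- For `K = 0` each `p μ` is constant and `p₀p₁ = 0`. A vanishing `p μ` would make `A μ`
  -- proportional to `A 2`, so properness excludes this case.
  · have hc : ∀ μ, μ ≠ 2 → p μ t₀ ≠ 0 := by
      intro μ hμ h0
      obtain ⟨C, hC⟩ := eq_of_hasDerivAt_zero hI hIc fun t ht =>
        (hp' μ hμ t ht).congr_deriv (by ring)
      have hC0 : C = 0 := by rw [← hC t₀ ht₀, h0]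
      obtain ⟨C', hC'⟩ := eq_of_hasDerivAt_zero hI hIc fun t ht =>
        (hu μ t ht).congr_deriv (by rw [hC t ht, hC0, zero_mul])
      refine hprop μ 2 hμ ⟨C', fun t ht => ?_⟩
      simp only [hC' t ht, u, div_self (hA0 2 t ht), mul_one]
    exact absurd (hpq t₀ ht₀) (by
      rw [zero_mul, zero_mul]; exact mul_ne_zero (hc 0 (by decide)) (hc 1 (by decide)))
  · right
    have hk := Real.sqrt_pos.2 hK0
    have hKk : K = √K ^ 2 := by rw [Real.sq_sqrt hK0.le]
    set k := √K
    rw [hKk] at hp' hpq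
    rcases exists_sinh_cosh hI hIc hk.ne' hτ (hu 0) (hp' 0 (by decide)) (hu 1)
      (hp' 1 (by decide)) hpq (hu0 0) (hu0 1) with h | ⟨R, S, δ, h⟩ | ⟨R, S, δ, h⟩
    · exact absurd h (hprop 1 0 (by decide))
    · obtain ⟨hτ', e⟩ := shift δ hk.ne'
      refine represents_of_eq hI hIc hA hA0 (inv_pos.2 hk) (nz fun t ht => (h t ht).1)
        (nz fun t ht => (h t ht).2) hτ' fun t ht => ?_
      simp only [sMP, cMP, e]
      rw [hA2 0 t ht, hA2 1 t ht, (h t ht).1, (h t ht).2]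
      constructor <;> ring
    · obtain ⟨hτ', e⟩ := shift δ hk.ne'
      refine represents_of_eq_swap hI hIc hA hA0 (inv_pos.2 hk) (nz fun t ht => (h t ht).1)
        (nz fun t ht => (h t ht).2) hτ' fun t ht => ?_
      simp only [sMP, cMP, e]
      rw [hA2 0 t ht, hA2 1 t ht, (h t ht).1, (h t ht).2]
      constructor <;> ring

end Family

/-! ### Properness of the model metrics -/

namespace Family

variable {F : Family} {a : ℝ} {A : Fin 3 → ℝ → ℝ} {I J : Set ℝ}

/-- Differentiating gives `α = ±β`, after which `c² ± s² = 1` leaves `β = 0`. -/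
lemma eq_zero_of_sq_MP_eq_zero {α β : ℝ} (ha : a ≠ 0) (hJ : IsOpen J) (hJn : J.Nonempty)
    (h0 : ∀ s ∈ J, F.sMP s a ≠ 0 ∧ F.cMP s a ≠ 0)
    (h : ∀ s ∈ J, α * F.sMP s a ^ 2 + β * F.cMP s a ^ 2 = 0) : α = 0 ∧ β = 0 := by
  obtain ⟨s, hs⟩ := hJn
  have hd : HasDerivAt (fun s => α * F.sMP s a ^ 2 + β * F.cMP s a ^ 2)
      ((α - F.sgn * β) * (2 * F.sMP s a * F.cMP s a / a)) s :=
    ((((F.hasDerivAt_sMP a s).pow 2).const_mul α).add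
      (((F.hasDerivAt_cMP a s).pow 2).const_mul β)).congr_deriv (by simp; ring)
  have hz : HasDerivAt (fun s => α * F.sMP s a ^ 2 + β * F.cMP s a ^ 2) 0 s :=
    (hasDerivAt_const s (0 : ℝ)).congr_of_eventuallyEq
      (Filter.eventually_of_mem (hJ.mem_nhds hs) h)
  have hne : 2 * F.sMP s a * F.cMP s a / a ≠ 0 :=
    div_ne_zero (mul_ne_zero (mul_ne_zero two_ne_zero (h0 s hs).1) (h0 s hs).2) ha
  have hα : α = F.sgn * β :=
    sub_eq_zero.1 ((mul_eq_zero.1 (hd.unique hz)).resolve_right hne)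
  have hβ : β = 0 := by
    have := h s hs
    rw [hα] at this
    linear_combination this - β * F.sq_MP a s
  exact ⟨by rw [hα, hβ, mul_zero], hβ⟩

lemma Represents.isProper (hIn : I.Nonempty) (hA0 : ∀ μ, ∀ t ∈ I, A μ t ≠ 0)
    (h : F.Represents A I) : IsProper A I := by
  obtain ⟨a, J, B, τ, c₁, c₂, Φ, ha, ⟨-, hJ, hJc, -, h0⟩, hc₁, hc₂, rfl, hτ, hBA, hΦ, hg⟩ := h
  have h1 := pow_ne_zero 2 hc₁
  have h2 := pow_ne_zero 2 hc₂
  -- Divided by `A 2 ^ 2`, the three squares are combinations of `s²` and `c²`, the last one through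
  -- `1 = c² ± s²`. Their coefficient vectors are pairwise non-proportional.
  obtain ⟨α, β, hαβ, hind⟩ : ∃ α β : Fin 3 → ℝ,
      (∀ t ∈ I, ∀ μ, A μ t ^ 2 = A 2 t ^ 2 *
        (α μ * F.sMP (τ t) a ^ 2 + β μ * F.cMP (τ t) a ^ 2)) ∧
      ∀ μ ν, μ ≠ ν → ∀ C, α μ = C * α ν → β μ = C * β ν → False := by
    have h3 : F.sgn ≠ 0 := left_ne_zero_of_mul (F.sgn_mul_self ▸ one_ne_zero)
    rcases hΦ with hΦ | hΦ
    · refine ⟨![c₁ ^ 2, 0, F.sgn], ![0, c₂ ^ 2, 1], fun t ht μ => ?_, ?_⟩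
      · have e := hg (fun _ => t) ht
        rw [funext hΦ, pullback_rescale (hτ t ht), bianchi, Matrix.diagonal_eq_diagonal_iff] at e
        have e1 := e 1
        have e2 := e 2
        simp only [hBA t ht, Matrix.cons_val] at e1 e2
        fin_cases μ
        · simp; linear_combination e1
        · simp; linear_combination e2
        · simp; linear_combination -A 2 t ^ 2 * F.sq_MP a (τ t)
      · intro μ ν hμν C
        fin_cases μ <;> fin_cases ν <;> simp_all
        all_goals grind
    · refine ⟨![0, c₁ ^ 2, F.sgn], ![c₂ ^ 2, 0, 1], fun t ht μ => ?_, ?_⟩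
      · have e := hg (fun _ => t) ht
        rw [funext hΦ, pullback_rescale_swap (hτ t ht), bianchi,
          Matrix.diagonal_eq_diagonal_iff] at e
        have e1 := e 1
        have e2 := e 2
        simp only [hBA t ht, Matrix.cons_val] at e1 e2
        fin_cases μ
        · simp; linear_combination e1
        · simp; linear_combination e2
        · simp; linear_combination -A 2 t ^ 2 * F.sq_MP a (τ t)
      · intro μ ν hμν C
        fin_cases μ <;> fin_cases ν <;> simp_all
        all_goals grind
  rintro μ ν hμν ⟨C, hC⟩
  have hz := eq_zero_of_sq_MP_eq_zero (α := α μ - C ^ 2 * α ν) (β := β μ - C ^ 2 * β ν) ha.ne' hJ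
    (hIn.image τ) (fun s hs => ⟨(h0 s hs).1, (h0 s hs).2.1⟩) (by
      rintro _ ⟨t, ht, rfl⟩
      refine (mul_eq_zero.1 (?_ : A 2 t ^ 2 * _ = 0)).resolve_left (pow_ne_zero 2 (hA0 2 t ht))
      have e : A μ t ^ 2 = C ^ 2 * A ν t ^ 2 := by rw [hC t ht, mul_pow]
      rw [hαβ t ht μ, hαβ t ht ν] at e
      linear_combination e)
  exact hind μ ν hμν (C ^ 2) (sub_eq_zero.1 hz.1) (sub_eq_zero.1 hz.2)

end Family

/-! ### Pull-backs and conformally flat coordinates -/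

lemma HasGrad.congr_grad {f : Pt → ℝ} {d e : Fin 4 → ℝ} {p : Pt} (hf : HasGrad f d p)
    (h : ∀ i, e i = d i) : HasGrad f e p := by rwa [funext h]

lemma HasGrad.div {f g : Pt → ℝ} {d e : Fin 4 → ℝ} {p : Pt} (hf : HasGrad f d p)
    (hg : HasGrad g e p) (h0 : g p ≠ 0) :
    HasGrad (fun q => f q / g q) (fun i => (d i * g p - f p * e i) / g p ^ 2) p := by
  have hdiff : DifferentiableAt ℝ (fun q => f q / g q) p :=
    DifferentiableAt.mul hf.differentiableAt
      ((hasDerivAt_inv h0).comp_hasFDerivAt p hg).differentiableAt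
  have h := hasGrad_of_differentiableAt hdiff
  have hgn : ∀ᶠ q in nhds p, g q ≠ 0 := hg.differentiableAt.continuousAt.eventually_ne h0
  -- The quotient rule is read off from the product rule for `(f / g) * g = f`.
  have hm : HasGrad f _ p := HasFDerivAt.congr_of_eventuallyEq (h.mul hg)
    (hgn.mono fun q hq => (div_mul_cancel₀ (f q) hq).symm)
  have e1 := hf.unique hm
  convert h using 2 with i
  rw [e1]
  field_simp
  ring

lemma pd_comp {φ : Pt → ℝ} {Φ : Pt → Pt} {p : Pt} (hφ : DifferentiableAt ℝ φ (Φ p))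
    (hΦ : DifferentiableAt ℝ Φ p) (a : Fin 4) :
    pd a (fun q => φ (Φ q)) p = ∑ j, pd j φ (Φ p) * pd a (fun q => Φ q j) p := by
  have h1 : fderiv ℝ (fun q => φ (Φ q)) p = (fderiv ℝ φ (Φ p)).comp (fderiv ℝ Φ p) :=
    fderiv_comp p hφ hΦ
  rw [pd, h1, ContinuousLinearMap.comp_apply, eq_sum_smul_proj (fderiv ℝ φ (Φ p))]
  simp only [sum_apply, smul_apply, ContinuousLinearMap.proj_apply, smul_eq_mul]
  refine Finset.sum_congr rfl fun j _ => ?_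
  rw [pd, pd, ((hasFDerivAt_pi'.1 hΦ.hasFDerivAt) j).fderiv]
  rfl

lemma pullback_eq_mul (Φ : Pt → Pt) (g : MetricField) (p : Pt) :
    pullback Φ g p = (Matrix.of fun i a => pd a (fun q => Φ q i) p).transpose * g (Φ p) *
      Matrix.of fun i a => pd a (fun q => Φ q i) p := by
  ext a b
  simp only [pullback, Matrix.mul_apply, Matrix.of_apply, Matrix.transpose_apply, Finset.sum_mul]
  rw [Finset.sum_comm]
  exact Finset.sum_congr rfl fun i _ => Finset.sum_congr rfl fun j _ => by ring

lemma pullback_pullback {φ Φ : Pt → Pt} {g : MetricField} {p : Pt}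
    (hφ : DifferentiableAt ℝ φ (Φ p)) (hΦ : DifferentiableAt ℝ Φ p) :
    pullback Φ (pullback φ g) p = pullback (fun q => φ (Φ q)) g p := by
  have h : Matrix.of (fun i a => pd a (fun q => φ (Φ q) i) p) =
      Matrix.of (fun i a => pd a (fun q => φ q i) (Φ p)) *
        Matrix.of (fun i a => pd a (fun q => Φ q i) p) := by
    ext i a
    exact pd_comp (differentiableAt_pi.1 hφ i) hΦ a
  simp only [pullback_eq_mul, h, Matrix.transpose_mul, Matrix.mul_assoc]

lemma pullback_smul (Φ : Pt → Pt) (g : MetricField) (w : Pt → ℝ) (p : Pt) :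
    pullback Φ (fun q => w q • g q) p = w (Φ p) • pullback Φ g p := by
  ext a b
  simp only [pullback, Matrix.of_apply, Matrix.smul_apply, smul_eq_mul, Finset.mul_sum]
  exact Finset.sum_congr rfl fun i _ => Finset.sum_congr rfl fun j _ => by ring

lemma pullback_congr_metric {Φ : Pt → Pt} {g g' : MetricField} {p : Pt} (h : g (Φ p) = g' (Φ p)) :
    pullback Φ g p = pullback Φ g' p := by
  simp only [pullback, h]

lemma IsConformallyFlatOn.pullback {g : MetricField} {U W : Set Pt} (hg : IsConformallyFlatOn g W)
    {Φ : Pt → Pt} (hU : IsOpen U) (hΦ : ContDiffOn ℝ ∞ Φ U) (hUW : Set.MapsTo Φ U W) :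
    IsConformallyFlatOn (pullback Φ g) U := by
  intro p hp
  obtain ⟨V, hV, hpV, hVW, φ, Ω, hφ, hΩ, h⟩ := hg (Φ p) (hUW hp)
  have hm : Set.MapsTo Φ (U ∩ Φ ⁻¹' V) V := fun q hq => hq.2
  have hVo := hΦ.continuousOn.isOpen_inter_preimage hU hV
  refine ⟨U ∩ Φ ⁻¹' V, hVo, ⟨hp, hpV⟩,
    Set.inter_subset_left, fun q => φ (Φ q), fun q => Ω (Φ q),
    hφ.comp (hΦ.mono Set.inter_subset_left) hm, hΩ.comp (hΦ.mono Set.inter_subset_left) hm,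
    fun q hq => ⟨(h _ hq.2).1, ?_⟩⟩
  rw [← pullback_pullback (hφ.differentiableAt_of_isOpen hV hq.2)
    (hΦ.differentiableAt_of_isOpen hU hq.1),
    ← pullback_smul Φ (BianchiI.pullback φ minkowski) (fun q => Ω q ^ 2)]
  exact pullback_congr_metric (h _ hq.2).2

lemma IsConformallyFlatOn.smul {g : MetricField} {U : Set Pt} (hg : IsConformallyFlatOn g U)
    {w : Pt → ℝ} (hw : ContDiffOn ℝ ∞ w U) (hw0 : ∀ p ∈ U, w p ≠ 0) :
    IsConformallyFlatOn (fun p => w p ^ 2 • g p) U := by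
  intro p hp
  obtain ⟨V, hV, hpV, hVU, φ, Ω, hφ, hΩ, h⟩ := hg p hp
  -- The conformal factor must be positive, while `w` may be negative.
  refine ⟨V, hV, hpV, hVU, φ, fun q => |w q| * Ω q, hφ,
    ((hw.abs hw0).mono hVU).mul hΩ, fun q hq =>
      ⟨mul_pos (abs_pos.2 (hw0 q (hVU hq))) (h q hq).1, ?_⟩⟩
  simp only [(h q hq).2, mul_pow, sq_abs, smul_smul]

lemma IsConformallyFlatOn.congr {g g' : MetricField} {U : Set Pt} (hg : IsConformallyFlatOn g U)
    (h : ∀ p ∈ U, g' p = g p) : IsConformallyFlatOn g' U := by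
  intro p hp
  obtain ⟨V, hV, hpV, hVU, φ, Ω, hφ, hΩ, hv⟩ := hg p hp
  exact ⟨V, hV, hpV, hVU, φ, Ω, hφ, hΩ, fun q hq => ⟨(hv q hq).1, (h q (hVU hq)).trans (hv q hq).2⟩⟩

/-- Dividing by `N` a map into the cone `⟨M, M⟩ = σ N N'`. -/
lemma mink_div {M Ma Mb : Fin 4 → ℝ} {N N' na na' nb nb' σ : ℝ} (hN : N ≠ 0)
    (h : mink M M = σ * N * N') (ha : 2 * mink M Ma = σ * (na * N' + N * na'))
    (hb : 2 * mink M Mb = σ * (nb * N' + N * nb')) :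
    N ^ 2 * mink (fun i => (Ma i * N - M i * na) / N ^ 2) (fun i => (Mb i * N - M i * nb) / N ^ 2) =
      mink Ma Mb - σ * (na * nb' + na' * nb) / 2 := by
  have e : N ^ 2 * mink (fun i => (Ma i * N - M i * na) / N ^ 2)
      (fun i => (Mb i * N - M i * nb) / N ^ 2) =
      (N ^ 2 * mink Ma Mb - N * na * mink M Mb - N * nb * mink M Ma + na * nb * mink M M) / N ^ 2 := by
    simp only [mink]
    field_simp
    ring
  rw [e]
  field_simp
  linear_combination (2 * na * nb) * h - N * nb * ha - N * na * hb

namespace Family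

variable {F : Family} {a : ℝ}

/-- The six functions `n` embed the space into the null cone of `mink - sgn (n₀² - n₁²)`, inducing
the metric divided by `a²`. This cone is `⟨M, M⟩ = sgn N N'`, with `N = εn₀ + n₁` and `N' = εn₀ -
n₁`. Hence `M / N` is a map to Minkowski space that is conformal with factor `a N`. -/
lemma isConformallyFlatOn_metric (ha : 0 < a) (U : Set Pt) (hU : IsOpen U) :
    IsConformallyFlatOn (F.metric a) U := by
  intro p hp
  -- The sign makes `N p = ε c + 1` positive, where `c` may be a negative cosine; this is also why
  -- `y` and `z` are centred at `p` below, whereas `x` does not enter `N`.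
  obtain ⟨ε, hε, hεc⟩ : ∃ ε : ℝ, ε ^ 2 = 1 ∧ 0 ≤ ε * F.cMP (p 0) a := by
    rcases le_total 0 (F.cMP (p 0) a) with h | h
    exacts [⟨1, by norm_num, by simpa using h⟩, ⟨-1, by norm_num, by simpa using h⟩]
  let n : Pt → Fin 6 → ℝ := fun q =>
    ![F.cMP (q 0) a * F.cPM (q 2 - p 2) a, F.cMP (q 3 - p 3) a,
      F.sMP (q 0) a * cPM RT (q 1) a, F.sMP (q 0) a * sPM RT (q 1) a,
      F.cMP (q 0) a * F.sPM (q 2 - p 2) a, F.sMP (q 3 - p 3) a]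
  let d : Pt → Fin 6 → Fin 4 → ℝ := fun q =>
    ![![-(F.sgn * F.sMP (q 0) a / a) * F.cPM (q 2 - p 2) a, 0,
        F.cMP (q 0) a * (F.sgn * F.sPM (q 2 - p 2) a / a), 0],
      ![0, 0, 0, -(F.sgn * F.sMP (q 3 - p 3) a / a)],
      ![F.cMP (q 0) a / a * cPM RT (q 1) a, F.sMP (q 0) a * (sPM RT (q 1) a / a), 0, 0],
      ![F.cMP (q 0) a / a * sPM RT (q 1) a, F.sMP (q 0) a * (cPM RT (q 1) a / a), 0, 0],
      ![-(F.sgn * F.sMP (q 0) a / a) * F.sPM (q 2 - p 2) a, 0,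
        F.cMP (q 0) a * (F.cPM (q 2 - p 2) a / a), 0],
      ![0, 0, 0, F.cMP (q 3 - p 3) a / a]]
  have hd : ∀ q i, HasGrad (fun q => n q i) (d q i) q := by
    intro q i
    have c0 := HasGrad.coord 0 (F.hasDerivAt_cMP a (q 0))
    have s0 := HasGrad.coord 0 (F.hasDerivAt_sMP a (q 0))
    have cx := HasGrad.coord 1 (RT.hasDerivAt_cPM a (q 1))
    have sx := HasGrad.coord 1 (RT.hasDerivAt_sPM a (q 1))
    have cy : HasGrad (fun q : Pt => F.cPM (q 2 - p 2) a) _ q := HasGrad.coord 2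
      (HasDerivAt.comp_sub_const (q 2) (p 2) (F.hasDerivAt_cPM a _))
    have sy : HasGrad (fun q : Pt => F.sPM (q 2 - p 2) a) _ q := HasGrad.coord 2
      (HasDerivAt.comp_sub_const (q 2) (p 2) (F.hasDerivAt_sPM a _))
    have cz : HasGrad (fun q : Pt => F.cMP (q 3 - p 3) a) _ q := HasGrad.coord 3
      (HasDerivAt.comp_sub_const (q 3) (p 3) (F.hasDerivAt_cMP a _))
    have sz : HasGrad (fun q : Pt => F.sMP (q 3 - p 3) a) _ q := HasGrad.coord 3
      (HasDerivAt.comp_sub_const (q 3) (p 3) (F.hasDerivAt_sMP a _))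
    fin_cases i
    · refine HasGrad.congr_grad (c0.mul cy) fun i => ?_; fin_cases i <;> simp [d]
    · refine HasGrad.congr_grad (cz) fun i => ?_; fin_cases i <;> simp [d]
    · refine HasGrad.congr_grad (s0.mul cx) fun i => ?_; fin_cases i <;> simp [d, sgn]
    · refine HasGrad.congr_grad (s0.mul sx) fun i => ?_; fin_cases i <;> simp [d]
    · refine HasGrad.congr_grad (c0.mul sy) fun i => ?_; fin_cases i <;> simp [d]
    · refine HasGrad.congr_grad (sz) fun i => ?_; fin_cases i <;> simp [d]
  have hn : ∀ i V, ContDiffOn ℝ ∞ (fun q => n q i) V := by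
    intro i V
    have sh : ∀ {u : ℝ → ℝ} (w : ℝ), ContDiff ℝ ∞ u → ContDiff ℝ ∞ (fun s => u (s - w)) :=
      fun w hu => hu.comp (contDiff_id.sub contDiff_const)
    have c0 := contDiff_comp_coord (F.contDiff_cMP a) 0 V
    have s0 := contDiff_comp_coord (F.contDiff_sMP a) 0 V
    have cx := contDiff_comp_coord (RT.contDiff_cPM a) 1 V
    have sx := contDiff_comp_coord (RT.contDiff_sPM a) 1 V
    have cy := contDiff_comp_coord (sh (p 2) (F.contDiff_cPM a)) 2 V
    have sy := contDiff_comp_coord (sh (p 2) (F.contDiff_sPM a)) 2 V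
    have cz := contDiff_comp_coord (sh (p 3) (F.contDiff_cMP a)) 3 V
    have sz := contDiff_comp_coord (sh (p 3) (F.contDiff_sMP a)) 3 V
    fin_cases i
    exacts [c0.mul cy, cz, s0.mul cx, s0.mul sx, c0.mul sy, sz]
  let N : Pt → ℝ := fun q => ε * n q 0 + n q 1
  have hNs : ∀ V, ContDiffOn ℝ ∞ N V := fun V => (contDiffOn_const.mul (hn 0 V)).add (hn 1 V)
  have hNp : 0 < N p := by
    have h1 : F.cPM 0 a = 1 := by cases F <;> simp [cPM]
    have h2 : F.cMP 0 a = 1 := by cases F <;> simp [cMP]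
    simp only [N, n, sub_self, Matrix.cons_val, h1, h2]
    linarith
  let m : Fin 4 → Fin 6 := ![2, 3, 4, 5]
  refine ⟨U ∩ N ⁻¹' Set.Ioi 0, (hNs U).continuousOn.isOpen_inter_preimage hU isOpen_Ioi, ⟨hp, hNp⟩,
    Set.inter_subset_left, fun q i => n q (m i) / N q, fun q => a * N q,
    contDiffOn_pi.2 fun i => (hn _ _).div (hNs _) fun q hq => (ne_of_gt hq.2),
    contDiffOn_const.mul (hNs _), fun q hq => ⟨mul_pos ha hq.2, ?_⟩⟩
  have hN0 : N q ≠ 0 := ne_of_gt hq.2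
  have hND : HasGrad N (fun i => ε * d q 0 i + d q 1 i) q := ((hd q 0).const_mul ε).add (hd q 1)
  have e0 := F.sq_MP a (q 0)
  have e1 := RT.sq_PM a (q 1)
  have e2 := F.sq_PM a (q 2 - p 2)
  have e3 := F.sq_MP a (q 3 - p 3)
  have es := F.sgn_mul_self
  ext b c
  rw [Matrix.smul_apply, pullback_minkowski, smul_eq_mul]
  simp only [((hd q _).div hND hN0).pd]
  have hnull : mink (fun i => n q (m i)) (fun i => n q (m i)) =
      F.sgn * N q * (ε * n q 0 - n q 1) := by
    simp only [mink, m, n, N, Matrix.cons_val]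
    simp only [sgn] at e1
    linear_combination -F.sMP (q 0) a ^ 2 * e1 - F.sgn * F.cMP (q 0) a ^ 2 * e2 + F.sgn * e3 -
      F.sgn * e0 - F.sgn * (F.cMP (q 0) a * F.cPM (q 2 - p 2) a) ^ 2 * hε +
      (F.sMP (q 0) a ^ 2 - (F.cMP (q 0) a * F.sPM (q 2 - p 2) a) ^ 2 -
        F.sMP (q 3 - p 3) a ^ 2) * es
  have hnull' : ∀ b, 2 * mink (fun i => n q (m i)) (fun i => d q (m i) b) =
      F.sgn * ((ε * d q 0 b + d q 1 b) * (ε * n q 0 - n q 1) +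
        N q * (ε * d q 0 b - d q 1 b)) := by
    intro b
    have e' : F.sgn * ((ε * d q 0 b + d q 1 b) * (ε * n q 0 - n q 1) +
        N q * (ε * d q 0 b - d q 1 b)) = 2 * F.sgn * (n q 0 * d q 0 b - n q 1 * d q 1 b) := by
      simp only [N]
      linear_combination 2 * F.sgn * n q 0 * d q 0 b * hε
    rw [e']
    simp only [mink, m, n, d, Matrix.cons_val]
    simp only [sgn] at e1
    fin_cases b <;> simp <;> field_simp
    · linear_combination F.sMP (q 0) a * F.cMP (q 0) a *
        (-e1 + e2 + F.cPM (q 2 - p 2) a ^ 2 * es)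
    · ring
    · linear_combination -F.cMP (q 0) a ^ 2 * F.sPM (q 2 - p 2) a * F.cPM (q 2 - p 2) a * es
    · linear_combination -F.sMP (q 3 - p 3) a * F.cMP (q 3 - p 3) a * es
  -- The form induced by the six-dimensional embedding.
  have e : ∀ b c, mink (fun i => d q (m i) b) (fun i => d q (m i) c) -
      F.sgn * (d q 0 b * d q 0 c - d q 1 b * d q 1 c) = F.metric a q b c / a ^ 2 := by
    intro b c
    simp only [mink, m, d, Matrix.cons_val]
    simp only [sgn] at e1
    fin_cases b <;> fin_cases c <;> simp [metric] <;> field_simp <;> ring_nf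
    · linear_combination -F.cMP (q 0) a ^ 2 * e1 - F.sgn * F.sMP (q 0) a ^ 2 * e2 - e0 -
        F.sgn * (F.sMP (q 0) a * F.cPM (q 2 - p 2) a) ^ 2 * es
    · linear_combination F.sgn * F.sMP (q 0) a * F.sPM (q 2 - p 2) a * F.cMP (q 0) a *
        F.cPM (q 2 - p 2) a * es
    · linear_combination F.sMP (q 0) a ^ 2 * e1
    · linear_combination F.sgn * F.sMP (q 0) a * F.sPM (q 2 - p 2) a * F.cMP (q 0) a *
        F.cPM (q 2 - p 2) a * es
    · linear_combination F.cMP (q 0) a ^ 2 * e2 -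
        F.sgn * (F.cMP (q 0) a * F.sPM (q 2 - p 2) a) ^ 2 * es
    · linear_combination e3 + F.sgn * F.sMP (q 3 - p 3) a ^ 2 * es
  have h := e b c
  field_simp at h
  rw [mul_pow, mul_assoc, mink_div hN0 hnull (hnull' b) (hnull' c), ← h]
  linear_combination a ^ 2 * F.sgn * d q 0 b * d q 0 c * hε

end Family

/-! ### Naturality of the Lie derivative -/

/-- If `Φ` carries `ξ` to `η`, then `L_ξ (Φ^* g) = Φ^* (L_η g)`. -/
lemma lieMetric_pullback {g : MetricField} {Φ ξ η : Pt → Pt} {U : Set Pt} (hU : IsOpen U)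
    (hΦ : ContDiffOn ℝ ∞ Φ U) (hξ : ContDiffOn ℝ ∞ ξ U) {p : Pt} (hp : p ∈ U)
    (hη : DifferentiableAt ℝ η (Φ p)) (hg : ∀ i j, DifferentiableAt ℝ (fun q => g q i j) (Φ p))
    (hξη : ∀ q ∈ U, ∀ i, ∑ c, ξ q c * pd c (fun q => Φ q i) q = η (Φ q) i) (a b : Fin 4) :
    lieMetric ξ (pullback Φ g) p a b = ∑ i, ∑ j, pd a (fun q => Φ q i) p *
      pd b (fun q => Φ q j) p * lieMetric η g (Φ p) i j := by
  have hΦd := hΦ.differentiableAt_of_isOpen hU hp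
  have hΦi := fun i => contDiffOn_pi.1 hΦ i
  have dP : ∀ a i, HasGrad (fun q => pd a (fun q => Φ q i) q)
      (fun c => pd c (fun q => pd a (fun q => Φ q i) q) p) p := fun a i =>
    hasGrad_of_differentiableAt ((contDiffOn_pd hU (hΦi i) a).differentiableAt_of_isOpen hU hp)
  have dG : ∀ i j, HasGrad (fun q => g (Φ q) i j) (fun c => pd c (fun q => g (Φ q) i j) p) p :=
    fun i j => hasGrad_of_differentiableAt ((hg i j).comp p hΦd)
  have dξ : ∀ c, HasGrad (fun q => ξ q c) (fun a => pd a (fun q => ξ q c) p) p := fun c =>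
    hasGrad_of_differentiableAt ((contDiffOn_pi.1 hξ c).differentiableAt_of_isOpen hU hp)
  have hE : ∀ i j, ∑ c, ξ p c * pd c (fun q => g (Φ q) i j) p =
      ∑ k, η (Φ p) k * pd k (fun q => g q i j) (Φ p) := by
    intro i j
    simp only [pd_comp (hg i j) hΦd, ← hξη p hp, Finset.mul_sum, Finset.sum_mul]
    rw [Finset.sum_comm]
    exact Finset.sum_congr rfl fun k _ => Finset.sum_congr rfl fun c _ => by ring
  -- The relation `dΦ(ξ) = η ∘ Φ` differentiated, with the second derivatives of `Φ` commuted: it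
  -- absorbs all derivatives of the Jacobian in the Lie derivative.
  have hQ : ∀ a i, ∑ c, (ξ p c * pd c (fun q => pd a (fun q => Φ q i) q) p +
      pd a (fun q => ξ q c) p * pd c (fun q => Φ q i) p) =
      ∑ k, pd a (fun q => Φ q k) p * pd k (fun q => η q i) (Φ p) := by
    intro a i
    have h1 := (HasGrad.sum (s := Finset.univ) fun c _ => (dξ c).mul (dP c i)).congr_of_eqOn hU hp
      (g := fun q => η (Φ q) i) (fun q hq => (hξη q hq i).symm)
    have h2 := h1.pd a
    rw [pd_comp (differentiableAt_pi.1 hη i) hΦd] at h2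
    simp only [mul_comm (pd a _ p) (pd _ _ (Φ p)), h2]
    refine Finset.sum_congr rfl fun c _ => ?_
    rw [pd_comm hU (hΦi i) hp a c]
    ring
  have hL : ∀ c, pd c (fun q => pullback Φ g q a b) p = ∑ i, ∑ j,
      ((pd c (fun q => pd a (fun q => Φ q i) q) p * pd b (fun q => Φ q j) p +
        pd a (fun q => Φ q i) p * pd c (fun q => pd b (fun q => Φ q j) q) p) * g (Φ p) i j +
      pd a (fun q => Φ q i) p * pd b (fun q => Φ q j) p * pd c (fun q => g (Φ q) i j) p) :=
    (HasGrad.sum (s := Finset.univ) fun i _ => HasGrad.sum (s := Finset.univ) fun j _ =>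
      ((dP a i).mul (dP b j)).mul (dG i j)).pd
  have step : lieMetric ξ (pullback Φ g) p a b = ∑ i, ∑ j,
      ((∑ c, (ξ p c * pd c (fun q => pd a (fun q => Φ q i) q) p +
        pd a (fun q => ξ q c) p * pd c (fun q => Φ q i) p)) * pd b (fun q => Φ q j) p *
          g (Φ p) i j +
      pd a (fun q => Φ q i) p * (∑ c, (ξ p c * pd c (fun q => pd b (fun q => Φ q j) q) p +
        pd b (fun q => ξ q c) p * pd c (fun q => Φ q j) p)) * g (Φ p) i j +
      pd a (fun q => Φ q i) p * pd b (fun q => Φ q j) p *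
        ∑ c, ξ p c * pd c (fun q => g (Φ q) i j) p) := by
    simp only [lieMetric, hL, Finset.mul_sum, Finset.sum_mul, ← Finset.sum_add_distrib]
    simp only [pullback, Matrix.of_apply, Finset.sum_mul, ← Finset.sum_add_distrib]
    rw [Finset.sum_comm]
    refine Finset.sum_congr rfl fun i _ => ?_
    rw [Finset.sum_comm]
    exact Finset.sum_congr rfl fun j _ => Finset.sum_congr rfl fun c _ => by ring
  have swap₁ : ∀ j, ∑ i, (∑ k, pd a (fun q => Φ q k) p * pd k (fun q => η q i) (Φ p)) *
      g (Φ p) i j = ∑ i, pd a (fun q => Φ q i) p *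
        ∑ k, g (Φ p) k j * pd i (fun q => η q k) (Φ p) := by
    intro j
    simp only [Finset.mul_sum, Finset.sum_mul]
    rw [Finset.sum_comm]
    exact Finset.sum_congr rfl fun i _ => Finset.sum_congr rfl fun k _ => by ring
  have swap₂ : ∀ i, ∑ j, (∑ k, pd b (fun q => Φ q k) p * pd k (fun q => η q j) (Φ p)) *
      g (Φ p) i j = ∑ j, pd b (fun q => Φ q j) p *
        ∑ k, g (Φ p) i k * pd j (fun q => η q k) (Φ p) := by
    intro i
    simp only [Finset.mul_sum, Finset.sum_mul]
    rw [Finset.sum_comm]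
    exact Finset.sum_congr rfl fun i _ => Finset.sum_congr rfl fun k _ => by ring
  rw [step]
  simp only [hE, hQ, lieMetric, Finset.sum_add_distrib, mul_add]
  rw [add_comm _ (∑ i, ∑ j, _ * _ * ∑ k, _), ← add_assoc]
  congr 1
  · congr 1
    rw [Finset.sum_comm, Finset.sum_comm (f := fun i j => _ * _ * ∑ k, g (Φ p) k j * _)]
    refine Finset.sum_congr rfl fun j _ => ?_
    have := ((Finset.mul_sum _ _ _).symm.trans (congrArg (pd b (fun q => Φ q j) p * ·)
      (swap₁ j))).trans (Finset.mul_sum _ _ _)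
    refine Eq.trans (Finset.sum_congr rfl fun i _ => ?_) (this.trans
      (Finset.sum_congr rfl fun i _ => ?_)) <;> ring
  · refine Finset.sum_congr rfl fun i _ => ?_
    have := ((Finset.mul_sum _ _ _).symm.trans (congrArg (pd a (fun q => Φ q i) p * ·)
      (swap₂ i))).trans (Finset.mul_sum _ _ _)
    refine Eq.trans (Finset.sum_congr rfl fun j _ => ?_) (this.trans
      (Finset.sum_congr rfl fun j _ => ?_)) <;> ring

/-- Homotheties are transported by diffeomorphisms. -/
lemma AdmitsHomothety.of_pullback {g g' : MetricField} {U W : Set Pt} (hU : IsOpen U)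
    (hW : IsOpen W) {Φ Ψ : Pt → Pt} (hΦ : ContDiffOn ℝ ∞ Φ U) (hΨ : ContDiffOn ℝ ∞ Ψ W)
    (hΦW : Set.MapsTo Φ U W) (hΨU : Set.MapsTo Ψ W U) (hl : ∀ p ∈ U, Ψ (Φ p) = p)
    (hr : ∀ q ∈ W, Φ (Ψ q) = q) (hg' : ∀ i j, ContDiffOn ℝ ∞ (fun q => g' q i j) W)
    (hg : ∀ p ∈ U, g p = pullback Φ g' p) (h : AdmitsHomothety g U) : AdmitsHomothety g' W := by
  obtain ⟨ξ, c, hc, hξ, hL⟩ := h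
  -- The push-forward of `ξ` by `Φ`.
  have hη : ContDiffOn ℝ ∞ (fun q i => ∑ k, ξ (Ψ q) k * pd k (fun q => Φ q i) (Ψ q)) W :=
    contDiffOn_pi.2 fun i => ContDiffOn.sum fun k _ => ((contDiffOn_pi.1 hξ k).comp hΨ hΨU).mul
      ((contDiffOn_pd hU (contDiffOn_pi.1 hΦ i) k).comp hΨ hΨU)
  refine ⟨fun q i => ∑ k, ξ (Ψ q) k * pd k (fun q => Φ q i) (Ψ q), c, hc, hη, fun q hq => ?_⟩
  have hp := hΨU hq
  have hnat := lieMetric_pullback (g := g') hU hΦ hξ hp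
    (hη.differentiableAt_of_isOpen hW (hΦW hp))
    (fun i j => (hg' i j).differentiableAt_of_isOpen hW (hΦW hp)) (fun p hp i => by rw [hl p hp])
  rw [hr q hq] at hnat
  set L : Matrix (Fin 4) (Fin 4) ℝ := Matrix.of (lieMetric
    (fun q i => ∑ k, ξ (Ψ q) k * pd k (fun q => Φ q i) (Ψ q)) g' q)
  have hcongr : ∀ a b, lieMetric ξ (pullback Φ g') (Ψ q) a b = lieMetric ξ g (Ψ q) a b := by
    intro a b
    simp only [lieMetric, hg _ hp]
    refine Finset.sum_congr rfl fun c _ => ?_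
    rw [pd_congr (g := fun q => g q a b) hU (fun p hp => by simp only [hg p hp]) hp]
  set P : Matrix (Fin 4) (Fin 4) ℝ := Matrix.of fun i a => pd a (fun q => Φ q i) (Ψ q)
  set P' : Matrix (Fin 4) (Fin 4) ℝ := Matrix.of fun i a => pd a (fun q => Ψ q i) q
  -- The Jacobian is invertible, so the homothety equation can be freed from the congruence by `P`.
  have hPP : P * P' = 1 := by
    ext i a
    have h1 : pd a (fun q => Φ (Ψ q) i) q = (P * P') i a :=
      pd_comp ((contDiffOn_pi.1 hΦ i).differentiableAt_of_isOpen hU hp)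
        (hΨ.differentiableAt_of_isOpen hW hq) a
    rw [← h1, pd_congr (g := fun q => q i) hW (fun p hp => by simp only [hr p hp]) hq,
      (HasGrad.coord (u := fun x => x) i (hasDerivAt_id _)).pd, Matrix.one_apply, Pi.single_apply]
    simp only [eq_comm]
  have e : P.transpose * L * P = P.transpose * ((2 * c) • g' q) * P := by
    have e1 : P.transpose * L * P = Matrix.of (lieMetric ξ (pullback Φ g') (Ψ q)) := by
      ext a b
      rw [Matrix.of_apply, hnat]
      simp only [Matrix.mul_apply, Matrix.transpose_apply, Finset.sum_mul, P, L, Matrix.of_apply]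
      rw [Finset.sum_comm]
      exact Finset.sum_congr rfl fun i _ => Finset.sum_congr rfl fun j _ => by ring
    have e2 := pullback_eq_mul Φ g' (Ψ q)
    rw [hr q hq] at e2
    rw [e1, Matrix.mul_smul, Matrix.smul_mul, ← e2]
    ext a b
    rw [Matrix.of_apply, hcongr, hL _ hp, Matrix.smul_apply, smul_eq_mul, hg _ hp]
  have e' := congrArg (fun M => P'.transpose * M * P') e
  have hPT : P'.transpose * P.transpose = 1 := by
    rw [← Matrix.transpose_mul, hPP, Matrix.transpose_one]
  have cancel : ∀ M, P'.transpose * (P.transpose * M * P) * P' = M := by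
    intro M
    rw [Matrix.mul_assoc, Matrix.mul_assoc (P.transpose * M), hPP, Matrix.mul_one,
      ← Matrix.mul_assoc, hPT, Matrix.one_mul]
  simp only [cancel] at e'
  intro a b
  have := congrFun (congrFun e' a) b
  simpa [L] using this

/-! ### Consequences for the Bianchi metric -/

namespace Family

variable {F : Family} {a : ℝ} {A : Fin 3 → ℝ → ℝ} {I J : Set ℝ}

lemma contDiffOn_vec {f : Fin 4 → Pt → ℝ} {U : Set Pt} (h : ∀ i, ContDiffOn ℝ ∞ (f i) U) :
    ContDiffOn ℝ ∞ (fun p => ![f 0 p, f 1 p, f 2 p, f 3 p]) U := by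
  refine contDiffOn_pi.2 fun i => ?_
  fin_cases i
  exacts [h 0, h 1, h 2, h 3]

lemma contDiffOn_rescale {τ : ℝ → ℝ} (hτ : ContDiffOn ℝ ∞ τ I) (c₁ c₂ : ℝ) (i j : Fin 4) :
    ContDiffOn ℝ ∞ (fun p : Pt => (![τ (p 0), c₁ * p i, c₂ * p j, p 3] : Pt)) (slab I) :=
  contDiffOn_vec (f := ![fun p => τ (p 0), fun p => c₁ * p i, fun p => c₂ * p j, fun p => p 3])
    fun k => by
      fin_cases k
      exacts [contDiffOn_comp_time hτ, contDiffOn_const.mul (contDiff_apply ℝ ℝ i).contDiffOn,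
        contDiffOn_const.mul (contDiff_apply ℝ ℝ j).contDiffOn, (contDiff_apply ℝ ℝ 3).contDiffOn]

lemma contDiffOn_scaledMetric {B : ℝ → ℝ} (hB : ContDiffOn ℝ ∞ B J) (i j : Fin 4) :
    ContDiffOn ℝ ∞ (fun p => F.scaledMetric a B p i j) (slab J) := by
  simp only [scaledMetric, metric, Matrix.smul_apply, Matrix.diagonal_apply, smul_eq_mul]
  refine ((contDiffOn_comp_time hB).pow 2).mul ?_
  split_ifs
  · fin_cases i
    exacts [contDiffOn_const, (contDiff_comp_coord (F.contDiff_sMP a) 0 _).pow 2,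
      (contDiff_comp_coord (F.contDiff_cMP a) 0 _).pow 2, contDiffOn_const]
  · exact contDiffOn_const

variable (hI : IsOpen I) (hIc : IsConnected I) (hA : ContDiffOn ℝ ∞ (A 2) I)
  (hA0 : ∀ t ∈ I, A 2 t ≠ 0)

include hI hA hA0 in
lemma Represents.isConformallyFlatOn (h : F.Represents A I) :
    IsConformallyFlatOn (bianchi A) (slab I) := by
  obtain ⟨a, J, B, τ, c₁, c₂, Φ, ha, ⟨-, hJ, -, hB, h0⟩, -, -, rfl, hτ, hBA, hΦ, hg⟩ := h
  have hτs := contDiffOn_of_hasDerivAt_one_div hI hA hA0 hτ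
  have hΦs : ContDiffOn ℝ ∞ Φ (slab I) := by
    rcases hΦ with hΦ | hΦ <;> rw [funext hΦ] <;> exact contDiffOn_rescale hτs _ _ _ _
  have hΦm : Set.MapsTo Φ (slab I) (slab (τ '' I)) := by
    intro p hp
    have : Φ p 0 = τ (p 0) := by rcases hΦ with hΦ | hΦ <;> rw [hΦ] <;> rfl
    exact ⟨p 0, hp, this.symm⟩
  exact (((isConformallyFlatOn_metric ha _ (isOpen_slab hJ)).smul (contDiffOn_comp_time hB)
    fun p hp => (h0 _ hp).2.2).pullback (isOpen_slab hI) hΦs hΦm).congr hg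

include hI hIc hA hA0 in
-- The coordinate change is a diffeomorphism of slabs, with the inverse time function and the
-- reciprocal rescalings as inverse, so a homothety would be carried to the scaled model metric.
lemma Represents.not_admitsHomothety (h : F.Represents A I) :
    ¬ AdmitsHomothety (bianchi A) (slab I) := by
  obtain ⟨a, J, B, τ, c₁, c₂, Φ, ha, hadm, hc₁, hc₂, rfl, hτ, hBA, hΦ, hg⟩ := h
  intro hhom
  refine not_admitsHomothety_scaledMetric hadm ?_
  obtain ⟨hJ, -, T, hT, -, hTl, hTr⟩ := exists_inverse_time hI hIc hA hA0 hτ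
  have hτs := contDiffOn_of_hasDerivAt_one_div hI hA hA0 hτ
  have hB := contDiffOn_scaledMetric (F := F) (a := a) hadm.2.2.2.1
  rcases hΦ with hΦ | hΦ
  · obtain rfl : Φ = fun p => ![τ (p 0), c₁ * p 1, c₂ * p 2, p 3] := funext hΦ
    refine hhom.of_pullback (isOpen_slab hI) (isOpen_slab hJ) (contDiffOn_rescale hτs c₁ c₂ 1 2)
      (contDiffOn_rescale hT c₁⁻¹ c₂⁻¹ 1 2) (fun p hp => ⟨p 0, hp, rfl⟩) (fun q hq => (hTr _ hq).1)
      (fun p hp => ?_) (fun q hq => ?_) hB hg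
    · ext i
      fin_cases i
      exacts [hTl _ hp, inv_mul_cancel_left₀ hc₁ _, inv_mul_cancel_left₀ hc₂ _, rfl]
    · ext i
      fin_cases i
      exacts [(hTr _ hq).2.1, mul_inv_cancel_left₀ hc₁ _, mul_inv_cancel_left₀ hc₂ _, rfl]
  · obtain rfl : Φ = fun p => ![τ (p 0), c₁ * p 2, c₂ * p 1, p 3] := funext hΦ
    refine hhom.of_pullback (isOpen_slab hI) (isOpen_slab hJ) (contDiffOn_rescale hτs c₁ c₂ 2 1)
      (contDiffOn_rescale hT c₂⁻¹ c₁⁻¹ 2 1) (fun p hp => ⟨p 0, hp, rfl⟩) (fun q hq => (hTr _ hq).1)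
      (fun p hp => ?_) (fun q hq => ?_) hB hg
    · ext i
      fin_cases i
      exacts [hTl _ hp, inv_mul_cancel_left₀ hc₂ _, inv_mul_cancel_left₀ hc₁ _, rfl]
    · ext i
      fin_cases i
      exacts [(hTr _ hq).2.1, mul_inv_cancel_left₀ hc₁ _, mul_inv_cancel_left₀ hc₂ _, rfl]

end Family

end BianchiI

end

theorem mainTheorem9 :
    (∀ (A : Fin 3 → ℝ → ℝ) (I : Set ℝ), IsOpen I → IsConnected I →
      (∀ μ, ContDiffOn ℝ ∞ (A μ) I) → (∀ μ, ∀ t ∈ I, A μ t ≠ 0) →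
      ((BianchiI.IsProper A I ∧
          BianchiI.IsConformallyFlatOn (BianchiI.bianchi A) (BianchiI.slab I)) ↔
        (BianchiI.Family.RT.Represents A I ∨ BianchiI.Family.ART.Represents A I)) ∧
      (BianchiI.IsProper A I →
        BianchiI.IsConformallyFlatOn (BianchiI.bianchi A) (BianchiI.slab I) →
        ¬ BianchiI.AdmitsHomothety (BianchiI.bianchi A) (BianchiI.slab I))) ∧
    (∀ (F : BianchiI.Family) (a : ℝ) (J : Set ℝ) (B : ℝ → ℝ), F.Admissible a J B →
      (∀ i, BianchiI.IsCKVWith (F.metric a) (BianchiI.slab J) (F.ckv a i) (F.factor a i)) ∧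
      (∀ i, BianchiI.IsCKVWith (F.scaledMetric a B) (BianchiI.slab J) (F.ckv a i)
        (F.scaledFactor a B i)) ∧
      LinearIndependent ℝ
        (fun (i : BianchiI.Family.Idx) (p : BianchiI.slab J) => F.ckv a i p) ∧
      (∀ ξ : BianchiI.Pt → BianchiI.Pt,
        BianchiI.IsCKV (F.scaledMetric a B) (BianchiI.slab J) ξ →
        ∃ c : BianchiI.Family.Idx → ℝ, ∀ p ∈ BianchiI.slab J, ξ p = ∑ i, c i • F.ckv a i p) ∧
      ¬ BianchiI.AdmitsHomothety (F.scaledMetric a B) (BianchiI.slab J)) := by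
  refine ⟨fun A I hI hIc hA hA0 => ?_, fun F a J B hadm => ?_⟩
  · have hrep := BianchiI.Family.represents_of_isProper hI hIc hA hA0
    refine ⟨⟨fun h => hrep h.1 h.2, fun h => ?_⟩, fun hp hf => ?_⟩
    · rcases h with h | h
      all_goals exact ⟨h.isProper hIc.nonempty hA0, h.isConformallyFlatOn hI (hA 2) (hA0 2)⟩
    · rcases hrep hp hf with h | h
      all_goals exact h.not_admitsHomothety hI hIc (hA 2) (hA0 2)
  · have h := hadm
    obtain ⟨ha, hJ, hJc, hB, h0⟩ := h
    have h0' : ∀ s ∈ J, F.sMP s a ≠ 0 ∧ F.cMP s a ≠ 0 := fun s hs => ⟨(h0 s hs).1, (h0 s hs).2.1⟩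
    refine ⟨fun i => BianchiI.Family.isCKVWith_ckv ha h0' i, fun i => ?_,
      BianchiI.Family.linearIndependent_ckv ha h0' hJc.nonempty, fun ξ hξ => ?_,
      BianchiI.Family.not_admitsHomothety_scaledMetric hadm⟩
    · exact (BianchiI.Family.isCKVWith_scaledMetric_iff hJ hB (fun s hs => (h0 s hs).2.2) _ _).2
        (BianchiI.Family.isCKVWith_ckv ha h0' i)
    · obtain ⟨ψ, hψ⟩ := hξ
      exact (BianchiI.Family.exists_eq_sum_ckv_scaled hadm hψ).1
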